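/- **Setting.** Let $p$ be a prime, let $0<\rho_1,\rho_2<1$ and $c\in\mathbb R$, and put $$M=\begin{pmatrix}\rho_1^{-1}&c\\0&\rho_2^{-1}\end{pmatrix}.$$ Let $D=\{d_0,\dots,d_{p-1}\}\subset\mathbb Z^2$ be a set of $p$ digits with $d_0=(0,0)^{T}$ and $d_1=(d_{1,1},0)^{T}\neq(0,0)^{T}$. Let $\delta_D=\frac1p\sum_{d\in D}\delta_d$, let $\widehat\mu(\xi)=\int e^{-2\pi i\langle\xi,x\rangle}\,d\mu(x)$ denote the Fourier transform, and suppose that for some $\boldsymbol a=(a_1,a_2)^{T}$ with $a_1,a_2\in\{1,\dots,p-1\}$ $$\{\xi\in\mathbb R^2:\widehat{\delta_D}(\xi)=0\}=\bigcup_{j=1}^{p-1}\Bigl(\frac{j\boldsymbol a}{p}+\mathbb Z^2\Bigr).$$ Let $\mu_{M,D}$ be the self-affine measure of $(M,D)$, i.e. the unique Borel probability measure with $\mu=\frac1p\sum_{d\in D}\mu\circ\varphi_d^{-1}$, where $\varphi_d(x)=M^{-1}(x+d)$; equivalently, the law of $\sum_{k\ge1}M^{-k}X_k$ with $X_k$ independent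 and uniformly distributed on $D$. A measure $\mu$ is called spectral if there is a countable $\Lambda\subset\mathbb R^2$ such that $\{e^{-2\pi i\langle\lambda,x\rangle}:\lambda\in\Lambda\}$ is an orthonormal basis of $L^2(\mu)$. Put $$E_{\boldsymbol a}=\Bigl\{\frac hl:\ h,l\in\mathbb Z,\ l\ne0,\ \gcd(h,l)=1,\ la_2-ha_1\in\mathbb Z\setminus p\mathbb Z\Bigr\}\cup\{0\},$$ and, if $\rho_1\neq\rho_2$, $c''=\dfrac{c}{\rho_1^{-1}-\rho_2^{-1}}$. **Theorem 1.6.** The measure $\mu_{M,D}$ is spectral if and only if one of the following holds: 1. $\rho_1\neq\rho_2$, $\rho_1^{-1}\in p\mathbb Z$ and $c''\in\mathbb Q\setminus E_{\boldsymbol a}$; 2. $\rho_1\neq\rho_2$, $\rho_1^{-1},\rho_2^{-1}\in p\mathbb Z$, and $c''=\frac st\in E_{\boldsymbol a}$ with $s,t\in\mathbb Z$, $t\neq0$, $\gcd(s,t)=1$, where $t\in p^{\ell}(\mathbb Z\setminus p\mathbb Z)$ and $p^{\ell+1}\mid(\rho_1^{-1}-\rho_2^{-1})$ for some integer $\ell\ge0$;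 3. $\rho_1=\rho_2$, $\rho_1^{-1}\in p\mathbb Z$ and $c\in\bigl\{\frac ts:\ s,t\in\mathbb Z,\ s\ne0,\ t\in p\mathbb Z,\ \gcd(t,s)=1\bigr\}\cup\{0\}$. -/

import Mathlib

open MeasureTheory
open scoped ENNReal BigOperators

namespace SierpinskiSpectral

/-- The plane with its Euclidean inner product. -/
abbrev Plane : Type := EuclideanSpace ℝ (Fin 2)

/-- An integer digit regarded as a point of the plane. -/
noncomputable def digitVec (d : Fin 2 → ℤ) : Plane := WithLp.toLp 2 (fun i => (d i : ℝ))

/-- The matrix `A` acting on column vectors of the plane. -/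
noncomputable def act (A : Matrix (Fin 2) (Fin 2) ℝ) : Plane →L[ℝ] Plane :=
  Matrix.toEuclideanCLM (𝕜 := ℝ) A

/-- The contraction `φ_d (x) = M⁻¹ (x + d)`. -/
noncomputable def ifsMap (M : Matrix (Fin 2) (Fin 2) ℝ) (d : Fin 2 → ℤ) (x : Plane) : Plane :=
  act M⁻¹ (x + digitVec d)

/-- The uniform probability measure on a finite digit set, as a measure on the subtype. -/
noncomputable def uniformDigit (D : Finset (Fin 2 → ℤ)) : Measure D :=
  (D.card : ℝ≥0∞)⁻¹ • ∑ d : D, Measure.dirac d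

/-- The series `∑_{k ≥ 1} M⁻ᵏ d_k` attached to a sequence of digits. -/
noncomputable def digitSeries (M : Matrix (Fin 2) (Fin 2) ℝ) (D : Finset (Fin 2 → ℤ))
    (ω : ℕ → D) : Plane :=
  ∑' k : ℕ, act (M⁻¹ ^ (k + 1)) (digitVec (ω k))

/-- The self-affine measure `μ_{M,D}`: the law of the random series `∑_{k ≥ 1} M⁻ᵏ d_k` whose
digits are independent and uniformly distributed on `D`. -/
noncomputable def selfAffineMeasure (M : Matrix (Fin 2) (Fin 2) ℝ) (D : Finset (Fin 2 → ℤ)) :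
    Measure Plane :=
  (Measure.infinitePi (fun _ : ℕ => uniformDigit D)).map (digitSeries M D)

/-- The discrete measure `δ_D = (1 / #D) ∑_{d ∈ D} δ_d` on the plane. -/
noncomputable def discreteMeasure (D : Finset (Fin 2 → ℤ)) : Measure Plane :=
  (D.card : ℝ≥0∞)⁻¹ • ∑ d ∈ D, Measure.dirac (digitVec d)

/-- The exponential function `x ↦ exp (-2πi ⟨ξ, x⟩)`. -/
noncomputable def expFun (ξ x : Plane) : ℂ :=
  Complex.exp (-2 * Real.pi * Complex.I * ((inner ℝ ξ x : ℝ) : ℂ))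

/-- The Fourier transform `ξ ↦ ∫ exp (-2πi ⟨ξ, x⟩) dμ(x)` of a measure. -/
noncomputable def fourierTransform (μ : Measure Plane) (ξ : Plane) : ℂ :=
  ∫ x, expFun ξ x ∂μ

/-- The zero set of the Fourier transform of a measure. -/
def fourierZeros (μ : Measure Plane) : Set Plane := {ξ | fourierTransform μ ξ = 0}

/-- The set `⋃_{j=1}^{p-1} (j a / p + ℤ²)`. -/
def latticeTranslates (p : ℕ) (a : Fin 2 → ℤ) : Set Plane :=
  ⋃ j ∈ Finset.Icc 1 (p - 1),
    {ξ : Plane | ∃ k : Fin 2 → ℤ, ∀ i, ξ i = (j : ℝ) * (a i : ℝ) / (p : ℝ) + (k i : ℝ)}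

/-- `μ` is a spectral measure: for some countable `Λ`, the exponentials with frequencies in `Λ`
form an orthonormal basis of `L²(μ)`. -/
def IsSpectralMeasure (μ : Measure Plane) : Prop :=
  ∃ Λ : Set Plane, Λ.Countable ∧
    ∃ b : HilbertBasis Λ ℂ (Lp ℂ 2 μ), ∀ ξ : Λ, (b ξ : Plane → ℂ) =ᵐ[μ] expFun (ξ : Plane)

/-- The upper triangular matrix with rows `(ρ₁⁻¹, c)` and `(0, ρ₂⁻¹)`. -/
noncomputable def triMatrix (ρ₁ ρ₂ c : ℝ) : Matrix (Fin 2) (Fin 2) ℝ :=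
  !![ρ₁⁻¹, c; 0, ρ₂⁻¹]

/-- The set `E_a` of the reduced fractions `h / l` with `l a₂ - h a₁` not divisible by `p`,
together with `0`. -/
def exceptionalSet (p : ℕ) (a : Fin 2 → ℤ) : Set ℝ :=
  {x | ∃ h l : ℤ, l ≠ 0 ∧ IsCoprime h l ∧ ¬ (p : ℤ) ∣ l * a 1 - h * a 0 ∧ x = (h : ℝ) / (l : ℝ)}
    ∪ {0}

/-- The real number `x` belongs to `n ℤ`. -/
def IsIntMultiple (n : ℕ) (x : ℝ) : Prop := ∃ m : ℤ, x = (n : ℝ) * (m : ℝ)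

section SelfAffine

instance isProbabilityMeasure_uniformDigit (D : Finset (Fin 2 → ℤ)) [Nonempty D] :
    IsProbabilityMeasure (uniformDigit D) := by
  constructor
  have hD : (D.card : ℝ≥0∞) ≠ 0 := by
    have : D.Nonempty := Finset.nonempty_coe_sort.mp inferInstance
    exact_mod_cast this.card_pos.ne'
  simp [uniformDigit, ENNReal.inv_mul_cancel hD]

/-- Prepend a digit to a sequence of digits. -/
def consDigit {α : Type*} (q : α × (ℕ → α)) : ℕ → α := fun n => Nat.casesOn n q.1 q.2

theorem measurable_consDigit {α : Type*} [MeasurableSpace α] :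
    Measurable (consDigit (α := α)) := by
  refine measurable_pi_lambda _ fun n => ?_
  cases n with
  | zero => exact measurable_fst
  | succ n => exact (measurable_pi_apply n).comp measurable_snd

theorem map_consDigit {α : Type*} [MeasurableSpace α] (P : Measure α) [IsProbabilityMeasure P] :
    (P.prod (Measure.infinitePi (fun _ : ℕ => P))).map consDigit
      = Measure.infinitePi (fun _ : ℕ => P) := by
  refine Measure.eq_infinitePi _ fun s t ht => ?_
  classical
  obtain ⟨N, hN⟩ : ∃ N, s ⊆ Finset.range (N + 1) :=
    ⟨s.sup id, fun i hi => Finset.mem_range.mpr (Nat.lt_succ_of_le (Finset.le_sup (f := id) hi))⟩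
  set t' : ℕ → Set α := fun i => if i ∈ s then t i else Set.univ with ht'
  have ht'm : ∀ i, MeasurableSet (t' i) := fun i => by
    by_cases h : i ∈ s
    · simpa [ht', h] using ht i
    · simp [ht', h]
  have h1 : Set.pi (s : Set ℕ) t = Set.pi (Finset.range (N + 1) : Set ℕ) t' := by
    ext x
    simp only [Set.mem_pi, Finset.mem_coe, ht']
    constructor
    · intro h i _
      by_cases hi : i ∈ s
      · simpa [hi] using h i hi
      · simp [hi]
    · intro h i hi
      simpa [hi] using h i (hN hi)
  have h2 : ∏ i ∈ s, P (t i) = ∏ i ∈ Finset.range (N + 1), P (t' i) := by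
    rw [← Finset.prod_subset hN (f := fun i => P (t' i))]
    · exact Finset.prod_congr rfl fun i hi => by simp [ht', hi]
    · intro i _ hi
      simp [ht', hi]
  have h3 : consDigit ⁻¹' (Set.pi (Finset.range (N + 1) : Set ℕ) t')
      = t' 0 ×ˢ Set.pi (Finset.range N : Set ℕ) (fun i => t' (i + 1)) := by
    ext ⟨x, y⟩
    simp only [Set.mem_preimage, Set.mem_pi, Finset.coe_range, Set.mem_Iio, Set.mem_prod]
    constructor
    · intro h
      exact ⟨h 0 (Nat.succ_pos _), fun i hi => h (i + 1) (Nat.succ_lt_succ hi)⟩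
    · rintro ⟨h0, hs⟩ i hi
      cases i with
      | zero => exact h0
      | succ i => exact hs i (Nat.lt_of_succ_lt_succ hi)
  rw [h1, h2, Measure.map_apply measurable_consDigit
    (MeasurableSet.pi (Finset.countable_toSet _) fun i _ => ht'm i), h3, Measure.prod_prod,
    Measure.infinitePi_pi _ (fun i _ => ht'm (i + 1)), Finset.prod_range_succ', mul_comm]

theorem act_mul (A B : Matrix (Fin 2) (Fin 2) ℝ) (x : Plane) :
    act (A * B) x = act A (act B x) := by
  simp [act, map_mul]

variable {M : Matrix (Fin 2) (Fin 2) ℝ} {D : Finset (Fin 2 → ℤ)}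

theorem summable_digitSeries (hM : Summable fun k : ℕ => ‖act (M⁻¹ ^ k)‖) (ω : ℕ → D) :
    Summable fun k : ℕ => act (M⁻¹ ^ (k + 1)) (digitVec (ω k)) := by
  have hb : ∀ d : D, ‖digitVec d‖ ≤ ∑ e : D, ‖digitVec e‖ := fun d =>
    Finset.single_le_sum (f := fun e : D => ‖digitVec e‖) (fun _ _ => norm_nonneg _)
      (Finset.mem_univ d)
  refine Summable.of_norm_bounded
    (((summable_nat_add_iff 1).mpr hM).mul_right (∑ e : D, ‖digitVec e‖)) fun k => ?_
  exact ((act (M⁻¹ ^ (k + 1))).le_opNorm _).trans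
    (mul_le_mul_of_nonneg_left (hb _) (norm_nonneg _))

theorem measurable_digitSeries (hM : Summable fun k : ℕ => ‖act (M⁻¹ ^ k)‖) :
    Measurable (digitSeries M D) := by
  refine measurable_of_tendsto_metrizable
    (f := fun n (ω : ℕ → D) => ∑ k ∈ Finset.range n, act (M⁻¹ ^ (k + 1)) (digitVec (ω k)))
    (fun n => ?_) ?_
  · refine Finset.measurable_sum _ fun k _ => ?_
    exact (measurable_from_top
      (f := fun d : D => act (M⁻¹ ^ (k + 1)) (digitVec d)) |>.mono
        (by
          intro s _
          exact (Set.to_countable s).measurableSet) le_rfl).comp (measurable_pi_apply k)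
  · rw [tendsto_pi_nhds]
    exact fun ω => (summable_digitSeries hM ω).hasSum.tendsto_sum_nat

theorem digitSeries_consDigit (hM : Summable fun k : ℕ => ‖act (M⁻¹ ^ k)‖) (d : D)
    (ω : ℕ → D) :
    digitSeries M D (consDigit (d, ω)) = ifsMap M d (digitSeries M D ω) := by
  unfold digitSeries ifsMap
  rw [(summable_digitSeries hM (consDigit (d, ω))).tsum_eq_zero_add, map_add,
    ContinuousLinearMap.map_tsum _ (summable_digitSeries hM ω), add_comm]
  congr 1
  · refine tsum_congr fun k => ?_
    rw [← act_mul, ← pow_succ']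
    rfl
  · simp [consDigit]

theorem isProbabilityMeasure_selfAffineMeasure [Nonempty D]
    (hM : Summable fun k : ℕ => ‖act (M⁻¹ ^ k)‖) :
    IsProbabilityMeasure (selfAffineMeasure M D) :=
  Measure.isProbabilityMeasure_map (measurable_digitSeries hM).aemeasurable

/-- The defining identity `μ = (1 / #D) ∑_{d ∈ D} μ ∘ φ_d⁻¹`. -/
theorem selfAffineMeasure_eq [Nonempty D] (hM : Summable fun k : ℕ => ‖act (M⁻¹ ^ k)‖) :
    selfAffineMeasure M D
      = (D.card : ℝ≥0∞)⁻¹ • ∑ d ∈ D, (selfAffineMeasure M D).map (ifsMap M d) := by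
  have hS := measurable_digitSeries (M := M) (D := D) hM
  have hφ : ∀ d, Measurable (ifsMap M d) := fun d => by
    unfold ifsMap
    fun_prop
  ext B hB
  have h0 : selfAffineMeasure M D B
      = (uniformDigit D).prod (Measure.infinitePi (fun _ : ℕ => uniformDigit D))
        ((fun q => digitSeries M D (consDigit q)) ⁻¹' B) := by
    unfold selfAffineMeasure
    conv_lhs => rw [← map_consDigit (uniformDigit D)]
    rw [Measure.map_map hS measurable_consDigit,
      Measure.map_apply (hS.comp measurable_consDigit) hB]
    rfl
  have hm : MeasurableSet ((fun q => digitSeries M D (consDigit q)) ⁻¹' B) :=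
    (hS.comp measurable_consDigit) hB
  rw [h0, Measure.prod_apply hm]
  simp only [uniformDigit, lintegral_smul_measure, lintegral_finsetSum_measure,
    lintegral_dirac, Measure.smul_apply, Measure.finsetSum_apply, smul_eq_mul]
  congr 1
  rw [← Finset.sum_coe_sort D]
  refine Finset.sum_congr rfl fun d _ => ?_
  rw [Measure.map_apply (hφ d) hB, selfAffineMeasure, Measure.map_apply hS (hφ d hB)]
  simp only [uniformDigit]
  congr 1
  ext ω
  simp [digitSeries_consDigit hM]

/-- The powers of the inverse of the triangular matrix are absolutely summable. -/
theorem summable_act_triMatrix {ρ₁ ρ₂ : ℝ} (c : ℝ) (h₁ : 0 < ρ₁) (h₁' : ρ₁ < 1) (h₂ : 0 < ρ₂)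
    (h₂' : ρ₂ < 1) : Summable fun k : ℕ => ‖act ((triMatrix ρ₁ ρ₂ c)⁻¹ ^ k)‖ := by
  set A : Matrix (Fin 2) (Fin 2) ℝ := !![ρ₁, -c * ρ₁ * ρ₂; 0, ρ₂] with hA
  have hinv : (triMatrix ρ₁ ρ₂ c)⁻¹ = A := by
    refine Matrix.inv_eq_right_inv ?_
    ext i j
    fin_cases i <;> fin_cases j <;> simp [triMatrix, hA, h₁.ne', h₂.ne']
    field_simp
    ring
  rw [hinv]
  set r := max ρ₁ ρ₂ with hr
  have hr0 : 0 < r := lt_max_of_lt_left h₁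
  have hr1 : r < 1 := max_lt h₁' h₂'
  have key : ∀ k : ℕ, ∃ x : ℝ, A ^ k = !![ρ₁ ^ k, x; 0, ρ₂ ^ k] ∧
      r * |x| ≤ |c * ρ₁ * ρ₂| * (k * r ^ k) := by
    intro k
    induction k with
    | zero => exact ⟨0, by ext i j; fin_cases i <;> fin_cases j <;> simp, by simp⟩
    | succ k ih =>
      obtain ⟨x, hx, hb⟩ := ih
      refine ⟨ρ₁ ^ k * (-c * ρ₁ * ρ₂) + x * ρ₂, ?_, ?_⟩
      · rw [pow_succ, hx, hA]
        ext i j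
        fin_cases i <;> fin_cases j <;> simp [Matrix.mul_apply, Fin.sum_univ_two, pow_succ]
      · have e1 : |ρ₁ ^ k * (-c * ρ₁ * ρ₂) + x * ρ₂|
            ≤ r ^ k * |c * ρ₁ * ρ₂| + |x| * r := by
          refine (abs_add_le _ _).trans (add_le_add ?_ ?_)
          · rw [abs_mul, abs_of_nonneg (pow_nonneg h₁.le k)]
            have : |-c * ρ₁ * ρ₂| = |c * ρ₁ * ρ₂| := by
              rw [← abs_neg]; congr 1; ring
            rw [this]
            exact mul_le_mul_of_nonneg_right
              (pow_le_pow_left₀ h₁.le (le_max_left _ _) k) (abs_nonneg _)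
          · rw [abs_mul, abs_of_pos h₂]
            exact mul_le_mul_of_nonneg_left (le_max_right _ _) (abs_nonneg _)
        calc r * |ρ₁ ^ k * (-c * ρ₁ * ρ₂) + x * ρ₂|
            ≤ r * (r ^ k * |c * ρ₁ * ρ₂| + |x| * r) := mul_le_mul_of_nonneg_left e1 hr0.le
          _ = r ^ (k + 1) * |c * ρ₁ * ρ₂| + (r * |x|) * r := by ring
          _ ≤ r ^ (k + 1) * |c * ρ₁ * ρ₂| + (|c * ρ₁ * ρ₂| * (k * r ^ k)) * r :=
              add_le_add le_rfl (mul_le_mul_of_nonneg_right hb hr0.le)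
          _ = |c * ρ₁ * ρ₂| * ((k + 1 : ℕ) * r ^ (k + 1)) := by push_cast; ring
  have hgeo : Summable fun k : ℕ => (k : ℝ) * r ^ k := by
    simpa using summable_pow_mul_geometric_of_norm_lt_one 1
      (show ‖r‖ < 1 by rwa [Real.norm_of_nonneg hr0.le])
  have hsum : Summable fun k : ℕ => A ^ k := by
    refine Pi.summable.mpr fun i => Pi.summable.mpr fun j => ?_
    fin_cases i <;> fin_cases j
    · refine (summable_geometric_of_lt_one h₁.le h₁').congr fun k => ?_
      obtain ⟨x, hx, -⟩ := key k
      simp [hx]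
    · refine Summable.of_norm_bounded ((hgeo.mul_left (|c * ρ₁ * ρ₂| / r))) fun k => ?_
      obtain ⟨x, hx, hb⟩ := key k
      have : |x| ≤ |c * ρ₁ * ρ₂| / r * (k * r ^ k) := by
        rw [div_mul_eq_mul_div, le_div_iff₀ hr0]
        linarith
      simpa [hx] using this
    · refine summable_zero.congr fun k => ?_
      obtain ⟨x, hx, -⟩ := key k
      simp [hx]
    · refine (summable_geometric_of_lt_one h₂.le h₂').congr fun k => ?_
      obtain ⟨x, hx, -⟩ := key k
      simp [hx]
  let T : Matrix (Fin 2) (Fin 2) ℝ →ₗ[ℝ] (Plane →L[ℝ] Plane) :=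
    { toFun := act
      map_add' := fun A B => by simp [act]
      map_smul' := fun t A => by simp [act] }
  have hT : Continuous T := T.continuous_of_finiteDimensional
  exact summable_norm_iff.mpr (hsum.map T hT)

end SelfAffine

end SierpinskiSpectral

namespace SierpinskiSpectral

/-! ### Exponentials and Fourier transforms -/

/-! Work on the frequency side, with A the transpose of M and B = A⁻¹. Self-affinity reads μ̂(ξ) =
mask(Bξ) μ̂(Bξ), where mask is the Fourier transform of δ_D. Hence μ̂(ξ) = 0 exactly when some
B^(k+1) ξ equals n/p with n an integer vector that is a nonzero multiple of a modulo p, and a set of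
frequencies is orthogonal when every pair is separated in this way at some digit level k.

Necessity. Let u be an integral eigenvector of M with eigenvalue R and ⟨u, a⟩ prime to p. Pairing
with u turns a spectrum into an infinite set of reals with differences R^(k+1) X / p, p ∤ X, and
this forces a valuation of ℝ with v(p) < 1 and v(R) < 1 (`exists_valuationSubring`). Through it a
subgroup G of the plane distinguishes level 0 from the later levels. In Parseval's identity Σ
|mask|² |μ̂|² = 1, Bessel's inequality for μ inside each class modulo G and for δ_D across the
classes leave no slack. So |mask(B(ξ + x))| depends only on the class of x, B sends differences
within a class to ℤ² (`integer_of_class`), and the B-image of a class is again a spectrum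
(`isSpectrum_class`).

Two renormalizations give a zero z of the mask with Az and A²z integral. Thus R is rational, with
numerator divisible by p. If its denominator q were at least 2, renormalization would give spectra
so sparse along u, and μ̂ would decay logarithmically along u, that Parseval's identity fails near a
zero of μ̂ (`not_isSpectrum_of_fraction`). Hence R ∈ pℤ. This applies to u = (1, 0) always, and to
the second eigenvector when c'' ∈ E_a; the other conditions are read off from Az and A²z.

Sufficiency. A spectrum is built digit by digit, adding A^(n+1)(j v / p + w) at stage n, with v a
multiple of a modulo p and w an integral correction. Completeness follows if the renormalized
frequencies stay in a compact set on which μ̂ has no zero (`isSpectralMeasure_of_compact`). Outside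
E_a an integral eigenvector of A for ρ₁⁻¹ serves as v and a segment as compact set. In the other
cases v is a multiple of a, and w ∈ {0, (0, 1)} suffices because ξ and ξ + (0, 1) are never both
zeros of μ̂. -/

theorem expFun_eq (ξ x : Plane) :
    expFun ξ x = Complex.exp (((-2 * Real.pi * inner ℝ ξ x : ℝ) : ℂ) * Complex.I) := by
  unfold expFun
  congr 1
  push_cast
  ring

@[simp] theorem norm_expFun (ξ x : Plane) : ‖expFun ξ x‖ = 1 := by
  rw [expFun_eq, Complex.norm_exp_ofReal_mul_I]

theorem expFun_add (ξ η x : Plane) : expFun (ξ + η) x = expFun ξ x * expFun η x := by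
  unfold expFun
  rw [← Complex.exp_add, inner_add_left]
  congr 1
  push_cast
  ring

theorem expFun_add_right (ξ x y : Plane) : expFun ξ (x + y) = expFun ξ x * expFun ξ y := by
  unfold expFun
  rw [← Complex.exp_add, inner_add_right]
  congr 1
  push_cast
  ring

@[simp] theorem expFun_zero (x : Plane) : expFun 0 x = 1 := by simp [expFun]

@[simp] theorem expFun_zero_right (ξ : Plane) : expFun ξ 0 = 1 := by simp [expFun]

theorem expFun_neg (ξ x : Plane) : expFun (-ξ) x = (starRingEnd ℂ) (expFun ξ x) := by
  rw [expFun_eq, expFun_eq, ← Complex.exp_conj, map_mul, Complex.conj_ofReal, Complex.conj_I,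
    inner_neg_left]
  congr 1
  push_cast
  ring

theorem continuous_expFun (ξ : Plane) : Continuous (expFun ξ) := by
  unfold expFun
  fun_prop

theorem continuous_expFun_left (x : Plane) : Continuous fun ξ => expFun ξ x := by
  unfold expFun
  fun_prop

section FourierTransform

variable (μ : Measure Plane)

theorem fourierTransform_neg (ξ : Plane) :
    fourierTransform μ (-ξ) = (starRingEnd ℂ) (fourierTransform μ ξ) := by
  unfold fourierTransform
  rw [← integral_conj]
  simp only [expFun_neg]

theorem norm_fourierTransform_neg (ξ : Plane) :
    ‖fourierTransform μ (-ξ)‖ = ‖fourierTransform μ ξ‖ := by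
  rw [fourierTransform_neg, RCLike.norm_conj]

/-- `Λ` has mutually orthogonal exponentials in `L²(μ)`. -/
def OrthogonalFrequencies (Λ : Set Plane) : Prop :=
  ∀ x ∈ Λ, ∀ y ∈ Λ, x ≠ y → fourierTransform μ (x - y) = 0

/-- A real integrable function all of whose Fourier coefficients vanish is zero almost
everywhere. -/
theorem ae_eq_zero_of_integral_expFun_real {μ : Measure Plane} {g : Plane → ℝ} (hg : Integrable g μ)
    (h : ∀ ξ, ∫ x, expFun ξ x * (g x : ℂ) ∂μ = 0) : g =ᵐ[μ] 0 := by
  have hpos : Integrable (fun x => max (g x) 0) μ := hg.pos_part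
  have hneg : Integrable (fun x => max (-g x) 0) μ := hg.neg_part
  have hmg : AEMeasurable (fun x => ENNReal.ofReal (-g x)) μ :=
    hg.neg.aemeasurable.ennreal_ofReal
  -- The positive and negative parts of g, used as densities, give finite measures with the same
  -- characteristic function, hence equal measures. At each point at most one of the two densities
  -- is nonzero, so both vanish almost everywhere.
  have key : μ.withDensity (fun x => ENNReal.ofReal (g x))
      = μ.withDensity (fun x => ENNReal.ofReal (-g x)) := by
    have f1 : IsFiniteMeasure (μ.withDensity (fun x => ENNReal.ofReal (g x))) :=
      isFiniteMeasure_withDensity_ofReal hg.2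
    have f2 : IsFiniteMeasure (μ.withDensity (fun x => ENNReal.ofReal (-g x))) :=
      isFiniteMeasure_withDensity_ofReal hg.neg.2
    refine Measure.ext_of_charFun (funext fun t => ?_)
    have e : ∀ x : Plane, Complex.exp (((inner ℝ x t : ℝ) : ℂ) * Complex.I)
        = expFun ((-2 * Real.pi)⁻¹ • t) x := fun x => by
      rw [expFun_eq, inner_smul_left, real_inner_comm]
      congr 3
      have := Real.pi_ne_zero
      simp
      field_simp
    simp only [charFun_apply, e]
    rw [integral_withDensity_eq_integral_toReal_smul₀ hg.aemeasurable.ennreal_ofReal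
      (Filter.Eventually.of_forall fun x => ENNReal.ofReal_lt_top),
      integral_withDensity_eq_integral_toReal_smul₀ hmg
      (Filter.Eventually.of_forall fun x => ENNReal.ofReal_lt_top), ← sub_eq_zero,
      ← integral_sub]
    · rw [← h ((-2 * Real.pi)⁻¹ • t)]
      refine integral_congr_ae (Filter.Eventually.of_forall fun x => ?_)
      simp only [ENNReal.toReal_ofReal', Complex.real_smul]
      rw [← sub_mul, mul_comm]
      congr 1
      rw [← Complex.ofReal_sub]
      congr 1
      rcases le_total (g x) 0 with hx | hx
      · rw [max_eq_right hx, max_eq_left (by linarith)]; simp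
      · rw [max_eq_left hx, max_eq_right (by linarith)]; simp
    · simp only [ENNReal.toReal_ofReal']
      exact hpos.smul_bdd 1 (continuous_expFun _).aestronglyMeasurable
        (Filter.Eventually.of_forall fun x => (norm_expFun _ x).le)
    · simp only [ENNReal.toReal_ofReal']
      exact hneg.smul_bdd 1 (continuous_expFun _).aestronglyMeasurable
        (Filter.Eventually.of_forall fun x => (norm_expFun _ x).le)
  rw [withDensity_eq_iff hg.aemeasurable.ennreal_ofReal hmg
    hg.lintegral_lt_top.ne] at key
  filter_upwards [key] with x hx
  rcases le_total (g x) 0 with h0 | h0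
  · rw [ENNReal.ofReal_of_nonpos h0] at hx
    have := ENNReal.ofReal_eq_zero.mp hx.symm
    simp only [Pi.zero_apply]; linarith
  · have h1 : ENNReal.ofReal (-g x) = 0 := ENNReal.ofReal_of_nonpos (by linarith)
    rw [h1] at hx
    have := ENNReal.ofReal_eq_zero.mp hx
    simp only [Pi.zero_apply]; linarith

variable [IsProbabilityMeasure μ]

theorem integrable_expFun (ξ : Plane) : Integrable (expFun ξ) μ :=
  Integrable.of_bound (continuous_expFun ξ).aestronglyMeasurable 1
    (Filter.Eventually.of_forall fun x => (norm_expFun ξ x).le)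

theorem continuous_fourierTransform : Continuous (fourierTransform μ) :=
  continuous_of_dominated (bound := fun _ => 1)
    (fun ξ => (continuous_expFun ξ).aestronglyMeasurable)
    (fun ξ => Filter.Eventually.of_forall fun x => (norm_expFun ξ x).le)
    (integrable_const _) (Filter.Eventually.of_forall continuous_expFun_left)

@[simp] theorem fourierTransform_zero : fourierTransform μ 0 = 1 := by
  simp [fourierTransform]

theorem norm_fourierTransform_le (ξ : Plane) : ‖fourierTransform μ ξ‖ ≤ 1 := by
  refine (norm_integral_le_integral_norm _).trans ?_
  simp

theorem memLp_expFun (ξ : Plane) : MemLp (expFun ξ) 2 μ :=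
  MemLp.of_bound (continuous_expFun ξ).aestronglyMeasurable 1
    (Filter.Eventually.of_forall fun x => (norm_expFun ξ x).le)

/-- The exponential function as an element of `L²(μ)`. -/
noncomputable def expLp (ξ : Plane) : Lp ℂ 2 μ := (memLp_expFun μ ξ).toLp _

theorem coe_expLp (ξ : Plane) : (expLp μ ξ : Plane → ℂ) =ᵐ[μ] expFun ξ :=
  (memLp_expFun μ ξ).coeFn_toLp

theorem inner_expLp (ξ η : Plane) :
    inner ℂ (expLp μ ξ) (expLp μ η) = fourierTransform μ (η - ξ) := by
  rw [L2.inner_def]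
  unfold fourierTransform
  refine integral_congr_ae ?_
  filter_upwards [coe_expLp μ ξ, coe_expLp μ η] with x h1 h2
  rw [h1, h2, sub_eq_add_neg, expFun_add, expFun_neg, RCLike.inner_apply]

theorem norm_expLp (ξ : Plane) : ‖expLp μ ξ‖ = 1 := by
  have h := inner_self_eq_norm_sq_to_K (𝕜 := ℂ) (expLp μ ξ)
  rw [inner_expLp, sub_self, fourierTransform_zero] at h
  have h' : (‖expLp μ ξ‖ : ℝ) ^ 2 = 1 := by
    exact (Complex.ofReal_injective (by simpa using h)).symm
  nlinarith [norm_nonneg (expLp μ ξ)]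

variable {μ}

theorem OrthogonalFrequencies.orthonormal {Λ : Set Plane} (h : OrthogonalFrequencies μ Λ) :
    Orthonormal ℂ fun l : Λ => expLp μ l := by
  refine ⟨fun l => norm_expLp μ l, fun x y hxy => ?_⟩
  simp only [inner_expLp]
  exact h y y.2 x x.2 fun e => hxy (Subtype.ext e.symm)

theorem norm_inner_expLp_neg (l ξ : Plane) :
    ‖inner ℂ (expLp μ l) (expLp μ (-ξ))‖ = ‖fourierTransform μ (ξ + l)‖ := by
  rw [inner_expLp, ← norm_fourierTransform_neg]
  congr 2
  abel

theorem OrthogonalFrequencies.summable {Λ : Set Plane} (h : OrthogonalFrequencies μ Λ)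
    (ξ : Plane) : Summable fun l : Λ => ‖fourierTransform μ (ξ + l)‖ ^ 2 := by
  simpa only [norm_inner_expLp_neg] using
    h.orthonormal.inner_products_summable (expLp μ (-ξ))

/-- Bessel's inequality for orthogonal exponentials. -/
theorem OrthogonalFrequencies.sum_le {F : Finset Plane}
    (h : OrthogonalFrequencies μ (F : Set Plane)) (ξ : Plane) : ∑ l ∈ F, ‖fourierTransform μ (ξ + l)‖ ^ 2 ≤ 1 := by
  have := h.orthonormal.sum_inner_products_le (expLp μ (-ξ)) (s := Finset.univ)
  simp only [norm_inner_expLp_neg, norm_expLp, one_pow] at this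
  rw [← Finset.sum_coe_sort]
  exact this

theorem IsSpectralMeasure.exists_hasSum (h : IsSpectralMeasure μ) :
    ∃ Λ : Set Plane, Λ.Countable ∧ OrthogonalFrequencies μ Λ ∧
      ∀ ξ, HasSum (fun l : Λ => ‖fourierTransform μ (ξ + l)‖ ^ 2) 1 := by
  obtain ⟨Λ, hc, b, hb⟩ := h
  have hb' : ∀ l : Λ, b l = expLp μ l := fun l =>
    Lp.ext ((hb l).trans (coe_expLp μ l).symm)
  refine ⟨Λ, hc, fun x hx y hy hxy => ?_, fun ξ => ?_⟩
  · have := b.orthonormal.2 (i := ⟨y, hy⟩) (j := ⟨x, hx⟩) (by simpa using hxy.symm)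
    simpa only [hb', inner_expLp] using this
  · have h1 := b.hasSum_inner_mul_inner (expLp μ (-ξ)) (expLp μ (-ξ))
    have h2 : ∀ l : Λ, inner ℂ (expLp μ (-ξ)) (b l) * inner ℂ (b l) (expLp μ (-ξ))
        = ((‖fourierTransform μ (ξ + l)‖ ^ 2 : ℝ) : ℂ) := fun l => by
      rw [hb', ← norm_inner_expLp_neg, ← inner_conj_symm, RCLike.conj_mul]
      norm_cast
    simp only [h2, inner_expLp, sub_self, fourierTransform_zero] at h1
    exact Complex.hasSum_ofReal.mp (by simpa using h1)

/-- An element of `L²(μ)` orthogonal to all exponentials vanishes. -/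
theorem eq_zero_of_inner_expLp (f : Lp ℂ 2 μ) (h : ∀ ξ, inner ℂ (expLp μ ξ) f = 0) : f = 0 := by
  have hf : Integrable (f : Plane → ℂ) μ := (Lp.memLp f).integrable (by norm_num)
  have h1 : ∀ ξ, ∫ x, expFun ξ x * f x ∂μ = 0 := fun ξ => by
    rw [← h (-ξ), L2.inner_def]
    refine integral_congr_ae ?_
    filter_upwards [coe_expLp μ (-ξ)] with x hx
    rw [hx, RCLike.inner_apply, expFun_neg, Complex.conj_conj, mul_comm]
  have hi : ∀ ξ, Integrable (fun x => expFun ξ x * f x) μ := fun ξ =>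
    hf.bdd_mul (c := 1) (continuous_expFun ξ).aestronglyMeasurable
      (Filter.Eventually.of_forall fun x => (norm_expFun _ x).le)
  have hi' : ∀ ξ, Integrable (fun x => expFun ξ x * (starRingEnd ℂ) (f x)) μ := fun ξ => by
    refine Integrable.bdd_mul (c := 1) ?_ (continuous_expFun ξ).aestronglyMeasurable
      (Filter.Eventually.of_forall fun x => (norm_expFun _ x).le)
    exact (integrable_norm_iff (Complex.continuous_conj.comp_aestronglyMeasurable
      hf.aestronglyMeasurable)).mp (by simpa using hf.norm)
  -- Conjugating the coefficient of f at −ξ gives that of its conjugate at ξ, so the real and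
  -- imaginary parts of f also have vanishing coefficients.
  have h2 : ∀ ξ, ∫ x, expFun ξ x * (starRingEnd ℂ) (f x) ∂μ = 0 := fun ξ => by
    have := congrArg (starRingEnd ℂ) (h1 (-ξ))
    rw [← integral_conj, map_zero] at this
    rw [← this]
    refine integral_congr_ae (Filter.Eventually.of_forall fun x => ?_)
    simp [expFun_neg]
  have hre : (fun x => (f x).re) =ᵐ[μ] 0 := by
    refine ae_eq_zero_of_integral_expFun_real hf.re fun ξ => ?_
    have e : ∀ x, expFun ξ x * (((f x).re : ℝ) : ℂ)
        = (2 : ℂ)⁻¹ * (expFun ξ x * f x + expFun ξ x * (starRingEnd ℂ) (f x)) := fun x => by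
      rw [← mul_add, Complex.add_conj]; push_cast; ring
    simp only [e]
    rw [integral_const_mul, integral_add (hi ξ) (hi' ξ), h1, h2]; simp
  have him : (fun x => (f x).im) =ᵐ[μ] 0 := by
    refine ae_eq_zero_of_integral_expFun_real hf.im fun ξ => ?_
    have e : ∀ x, expFun ξ x * (((f x).im : ℝ) : ℂ)
        = (2 * Complex.I)⁻¹ * (expFun ξ x * f x - expFun ξ x * (starRingEnd ℂ) (f x)) := fun x => by
      rw [← mul_sub, Complex.sub_conj]
      have := Complex.I_ne_zero
      push_cast
      field_simp
    simp only [e]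
    rw [integral_const_mul, integral_sub (hi ξ) (hi' ξ), h1, h2]; simp
  refine Lp.ext ?_
  filter_upwards [hre, him, Lp.coeFn_zero ℂ 2 μ] with x h1 h2 h3
  rw [h3]
  exact Complex.ext h1 h2

/-- Parseval's identity for the single vector `expLp μ (-ξ)` places it in the closed span of the
family. Every exponential therefore lies there, and by `eq_zero_of_inner_expLp` nothing is
orthogonal to all exponentials. -/
theorem isSpectralMeasure_of_hasSum {Λ : Set Plane} (hc : Λ.Countable)
    (ho : OrthogonalFrequencies μ Λ)
    (hs : ∀ ξ, HasSum (fun l : Λ => ‖fourierTransform μ (ξ + l)‖ ^ 2) 1) :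
    IsSpectralMeasure μ := by
  have hon := ho.orthonormal
  set v : Λ → Lp ℂ 2 μ := fun l => expLp μ l with hv
  set S := (Submodule.span ℂ (Set.range v)).topologicalClosure with hS
  have hcS : IsClosed (S : Set (Lp ℂ 2 μ)) := Submodule.isClosed_topologicalClosure _
  have : CompleteSpace S := hcS.completeSpace_coe
  have hmem : ∀ l, v l ∈ S := fun l =>
    Submodule.le_topologicalClosure _ (Submodule.subset_span ⟨l, rfl⟩)
  have hexp : ∀ ξ, expLp μ ξ ∈ S := by
    intro ξ
    obtain ⟨η, rfl⟩ : ∃ η, ξ = -η := ⟨-ξ, by simp⟩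
    have hsum := hs η
    have hle : ∀ ε > 0, ∃ y ∈ S, ‖expLp μ (-η) - y‖ ^ 2 < ε := by
      -- The squared distance from a unit vector to its projection on finitely many orthonormal
      -- vectors is 1 minus the partial Parseval sum.
      intro ε hε
      obtain ⟨F, hF⟩ := ((hsum.eventually_const_lt
        (show 1 - ε < 1 by linarith))).exists
      refine ⟨∑ l ∈ F, (inner ℂ (v l) (expLp μ (-η)) : ℂ) • v l,
        Submodule.sum_mem _ fun l _ => Submodule.smul_mem _ _ (hmem l), ?_⟩
      have e1 : inner ℂ (∑ l ∈ F, (inner ℂ (v l) (expLp μ (-η)) : ℂ) • v l) (expLp μ (-η))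
          = ((∑ l ∈ F, ‖fourierTransform μ (η + l)‖ ^ 2 : ℝ) : ℂ) := by
        rw [sum_inner]
        push_cast
        refine Finset.sum_congr rfl fun l _ => ?_
        rw [inner_smul_left, RCLike.conj_mul, hv, norm_inner_expLp_neg]
        rfl
      have e2 : ‖∑ l ∈ F, (inner ℂ (v l) (expLp μ (-η)) : ℂ) • v l‖ ^ 2
          = ∑ l ∈ F, ‖fourierTransform μ (η + l)‖ ^ 2 := by
        have h1 := hon.inner_sum (fun l => (inner ℂ (v l) (expLp μ (-η)) : ℂ))
          (fun l => (inner ℂ (v l) (expLp μ (-η)) : ℂ)) F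
        rw [inner_self_eq_norm_sq_to_K] at h1
        refine Complex.ofReal_injective ?_
        refine Eq.trans (by push_cast; rfl) (h1.trans ?_)
        push_cast
        refine Finset.sum_congr rfl fun l _ => ?_
        rw [RCLike.conj_mul, hv, norm_inner_expLp_neg]
        rfl
      rw [@norm_sub_sq ℂ, norm_expLp, e2, ← inner_conj_symm, e1]
      simp only [RCLike.re_to_complex, Complex.conj_ofReal, Complex.ofReal_re]
      linarith
    have : expLp μ (-η) ∈ closure (S : Set (Lp ℂ 2 μ)) := by
      rw [Metric.mem_closure_iff]
      intro ε hε
      obtain ⟨y, hy, hlt⟩ := hle (ε ^ 2) (by positivity)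
      refine ⟨y, hy, ?_⟩
      rw [dist_eq_norm]
      exact lt_of_pow_lt_pow_left₀ 2 hε.le hlt
    rwa [hcS.closure_eq] at this
  have htop : (Submodule.span ℂ (Set.range v))ᗮ = ⊥ := by
    rw [eq_bot_iff]
    intro f hf
    rw [Submodule.mem_bot]
    refine eq_zero_of_inner_expLp f fun ξ => ?_
    have : f ∈ Sᗮ := by rwa [hS, Submodule.orthogonal_closure]
    exact this _ (hexp ξ)
  refine ⟨Λ, hc, HilbertBasis.mkOfOrthogonalEqBot hon htop, fun l => ?_⟩
  rw [HilbertBasis.coe_mkOfOrthogonalEqBot]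
  exact coe_expLp μ l

end FourierTransform

/-! ### The trigonometric polynomial of the digit set -/

theorem inner_digitVec (ξ : Plane) (d : Fin 2 → ℤ) :
    inner ℝ ξ (digitVec d) = ξ 0 * d 0 + ξ 1 * d 1 := by
  simp [digitVec, PiLp.inner_apply, Fin.sum_univ_two, mul_comm]

@[simp] theorem digitVec_apply (d : Fin 2 → ℤ) (i : Fin 2) : digitVec d i = d i := rfl

theorem digitVec_add (d e : Fin 2 → ℤ) : digitVec (d + e) = digitVec d + digitVec e := by
  ext i; simp

theorem digitVec_sub (d e : Fin 2 → ℤ) : digitVec (d - e) = digitVec d - digitVec e := by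
  ext i; simp

theorem digitVec_neg (d : Fin 2 → ℤ) : digitVec (-d) = -digitVec d := by
  ext i; simp

@[simp] theorem digitVec_zero : digitVec 0 = 0 := by ext i; simp

/-- The integer points of the plane. -/
def integerPoints : AddSubgroup Plane where
  carrier := Set.range digitVec
  zero_mem' := ⟨0, digitVec_zero⟩
  add_mem' := by
    rintro _ _ ⟨d, rfl⟩ ⟨e, rfl⟩
    exact ⟨d + e, digitVec_add d e⟩
  neg_mem' := by
    rintro _ ⟨d, rfl⟩
    exact ⟨-d, digitVec_neg d⟩

theorem digitVec_mem (n : Fin 2 → ℤ) : digitVec n ∈ integerPoints := ⟨n, rfl⟩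

theorem expFun_eq_one_iff (ξ x : Plane) : expFun ξ x = 1 ↔ ∃ n : ℤ, inner ℝ ξ x = n := by
  unfold expFun
  rw [Complex.exp_eq_one_iff]
  have hpi : (2 * Real.pi * Complex.I : ℂ) ≠ 0 := by
    simp [Real.pi_ne_zero]
  constructor
  · rintro ⟨n, hn⟩
    refine ⟨-n, ?_⟩
    have : ((inner ℝ ξ x : ℝ) : ℂ) = ((-n : ℤ) : ℂ) := by
      apply mul_left_cancel₀ hpi
      push_cast
      linear_combination -hn
    exact_mod_cast this
  · rintro ⟨n, hn⟩
    refine ⟨-n, ?_⟩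
    rw [hn]
    push_cast
    ring

theorem expFun_integer {ξ : Plane} (hξ : ξ ∈ integerPoints) (d : Fin 2 → ℤ) :
    expFun ξ (digitVec d) = 1 := by
  obtain ⟨n, rfl⟩ := hξ
  rw [expFun_eq_one_iff]
  exact ⟨n 0 * d 0 + n 1 * d 1, by rw [inner_digitVec]; push_cast; simp⟩

/-- The Fourier transform of the discrete measure of a digit set. -/
noncomputable def mask (D : Finset (Fin 2 → ℤ)) (ξ : Plane) : ℂ :=
  fourierTransform (discreteMeasure D) ξ

theorem isProbabilityMeasure_discreteMeasure {D : Finset (Fin 2 → ℤ)} (hD : D.Nonempty) :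
    IsProbabilityMeasure (discreteMeasure D) := by
  constructor
  have hD' : (D.card : ℝ≥0∞) ≠ 0 := by exact_mod_cast hD.card_pos.ne'
  simp [discreteMeasure, ENNReal.inv_mul_cancel hD']

theorem mask_eq (D : Finset (Fin 2 → ℤ)) (ξ : Plane) :
    mask D ξ = (D.card : ℂ)⁻¹ * ∑ d ∈ D, expFun ξ (digitVec d) := by
  unfold mask fourierTransform discreteMeasure
  rw [integral_smul_measure, integral_finsetSum_measure]
  · simp [Complex.real_smul]
  · intro d _
    exact integrable_expFun _ ξ

theorem mask_add_integer (D : Finset (Fin 2 → ℤ)) (ξ : Plane) {n : Plane}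
    (hn : n ∈ integerPoints) : mask D (ξ + n) = mask D ξ := by
  simp only [mask_eq, expFun_add, expFun_integer hn, mul_one]

/-- The rational points `(X/p, Y/p)` at which the Fourier transform of the digit set vanishes. -/
def maskZeros (p : ℕ) (a : Fin 2 → ℤ) : Set Plane :=
  {z | ∃ n : Fin 2 → ℤ, ¬ (p : ℤ) ∣ n 0 ∧ (p : ℤ) ∣ n 0 * a 1 - n 1 * a 0 ∧
    (p : ℝ) • z = digitVec n}

theorem maskZeros_add {p : ℕ} {a : Fin 2 → ℤ} {z n : Plane} (hz : z ∈ maskZeros p a)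
    (hn : n ∈ integerPoints) : z + n ∈ maskZeros p a := by
  obtain ⟨m, h1, h2, h3⟩ := hz
  obtain ⟨k, rfl⟩ := hn
  refine ⟨fun i => m i + p * k i, ?_, ?_, ?_⟩
  · rwa [Int.dvd_add_left (Dvd.intro _ rfl)]
  · obtain ⟨t, ht⟩ := h2
    exact ⟨t + k 0 * a 1 - k 1 * a 0, by linear_combination ht⟩
  · rw [smul_add, h3]
    ext i
    simp

/-- Equality case of the triangle inequality. It isolates a single digit in the mask by comparison
with the digit 0. -/
theorem eq_one_of_norm_one_add {z : ℂ} (hz : ‖z‖ = 1) (h : 2 ≤ ‖1 + z‖) : z = 1 := by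
  have h1 : z.re ^ 2 + z.im ^ 2 = 1 := by
    have := Complex.sq_norm z
    rw [hz, Complex.normSq_apply] at this
    nlinarith
  have h2 : 4 ≤ (1 + z.re) ^ 2 + z.im ^ 2 := by
    have := Complex.sq_norm (1 + z)
    rw [Complex.normSq_apply] at this
    simp only [Complex.add_re, Complex.one_re, Complex.add_im, Complex.one_im, zero_add] at this
    nlinarith
  have h3 : z.re = 1 := by nlinarith [sq_nonneg z.im]
  have h4 : z.im = 0 := by rw [h3] at h1; nlinarith [sq_nonneg z.im]
  exact Complex.ext (by simp [h3]) (by simp [h4])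

theorem maskZeros_not_integer {p : ℕ} {a : Fin 2 → ℤ} {z : Plane} (hz : z ∈ maskZeros p a) :
    z ∉ integerPoints := by
  intro h
  obtain ⟨k, rfl⟩ := h
  obtain ⟨m, h1, h2, h3⟩ := hz
  have := congrArg (fun v : Plane => v 0) h3
  simp only [PiLp.smul_apply, smul_eq_mul, digitVec_apply] at this
  exact h1 ⟨k 0, by exact_mod_cast this.symm⟩

/-- The hypotheses on the digit set. -/
structure DigitSystem (p : ℕ) (D : Finset (Fin 2 → ℤ)) (a : Fin 2 → ℤ) : Prop where
  prime : p.Prime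
  card : D.card = p
  zero_mem : (0 : Fin 2 → ℤ) ∈ D
  horizontal : ∃ d ∈ D, d 0 ≠ 0 ∧ d 1 = 0
  residue : ∀ i, 1 ≤ a i ∧ a i ≤ (p : ℤ) - 1
  zeros : fourierZeros (discreteMeasure D) = latticeTranslates p a

namespace DigitSystem

variable {p : ℕ} {D : Finset (Fin 2 → ℤ)} {a : Fin 2 → ℤ} (H : DigitSystem p D a)
include H

theorem prime_int : Prime (p : ℤ) := Nat.prime_iff_prime_int.mp H.prime

theorem p_pos : (0 : ℝ) < p := by exact_mod_cast H.prime.pos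

theorem not_dvd (i : Fin 2) : ¬ (p : ℤ) ∣ a i := fun h => by
  have := Int.le_of_dvd (by linarith [(H.residue i).1]) h
  linarith [(H.residue i).2]

theorem nonempty : D.Nonempty := ⟨0, H.zero_mem⟩

theorem isProbabilityMeasure : IsProbabilityMeasure (discreteMeasure D) :=
  isProbabilityMeasure_discreteMeasure H.nonempty

theorem continuous_mask : Continuous (mask D) :=
  have := H.isProbabilityMeasure
  continuous_fourierTransform _

theorem norm_mask_le (ξ : Plane) : ‖mask D ξ‖ ≤ 1 :=
  have := H.isProbabilityMeasure
  norm_fourierTransform_le _ _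

theorem mask_zero : mask D 0 = 1 :=
  have := H.isProbabilityMeasure
  fourierTransform_zero _

/-- As p divides neither coordinate of a, the nonzero multiples of a modulo p are the vectors n with
n₀ ≢ 0 and n₀ a₁ ≡ n₁ a₀. The multiplier is recovered as n₀ times the inverse of a₀. -/
theorem latticeTranslates_eq : latticeTranslates p a = maskZeros p a := by
  have hp := H.p_pos
  have hpi := H.prime_int
  ext z
  simp only [latticeTranslates, Set.mem_iUnion, Finset.mem_Icc, Set.mem_ofPred_eq, maskZeros,
    exists_prop]
  constructor
  · rintro ⟨j, ⟨hj1, hj2⟩, k, hk⟩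
    have hj : ¬ (p : ℤ) ∣ j := fun h => by
      have h1 := Nat.le_of_dvd (by omega) (Int.natCast_dvd_natCast.mp h)
      have := H.prime.pos
      omega
    refine ⟨fun i => j * a i + p * k i, ?_, ⟨k 0 * a 1 - k 1 * a 0, by ring⟩, ?_⟩
    · intro h
      rw [Int.dvd_add_left (Dvd.intro _ rfl)] at h
      exact (hpi.dvd_or_dvd h).elim hj (H.not_dvd 0)
    · ext i
      simp only [PiLp.smul_apply, hk, smul_eq_mul, digitVec_apply]
      push_cast
      field_simp
  · rintro ⟨n, hn, hdet, hz⟩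
    obtain ⟨b, hb⟩ : ∃ b : ℤ, (p : ℤ) ∣ a 0 * b - 1 := by
      have hc : IsCoprime (a 0) (p : ℤ) :=
        ((Prime.coprime_iff_not_dvd hpi).mpr (H.not_dvd 0)).symm
      obtain ⟨u, v, huv⟩ := hc
      exact ⟨u, ⟨-v, by linear_combination huv⟩⟩
    set r := (n 0 * b) % p with hr
    have hr0 : 0 ≤ r := Int.emod_nonneg _ hpi.ne_zero
    have hrlt : r < p := Int.emod_lt_of_pos _ (by exact_mod_cast H.prime.pos)
    have hrd : (p : ℤ) ∣ n 0 * b - r := Int.dvd_self_sub_emod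
    have e0 : (p : ℤ) ∣ n 0 - r * a 0 := by
      obtain ⟨s, hs⟩ := hb
      obtain ⟨t, ht⟩ := hrd
      exact ⟨t * a 0 - n 0 * s, by linear_combination ht * a 0 - n 0 * hs⟩
    have e1 : (p : ℤ) ∣ n 1 - r * a 1 := by
      have : (p : ℤ) ∣ a 0 * (n 1 - r * a 1) := by
        obtain ⟨s, hs⟩ := e0
        obtain ⟨t, ht⟩ := hdet
        exact ⟨s * a 1 - t, by linear_combination hs * a 1 - ht⟩
      exact (hpi.dvd_or_dvd this).resolve_left (H.not_dvd 0)
    have hrne : r ≠ 0 := fun h => hn (by simpa [h] using e0)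
    refine ⟨r.toNat, ⟨by omega, by have := H.prime.pos; omega⟩, ?_⟩
    have hcast : ((r.toNat : ℕ) : ℝ) = r := by exact_mod_cast Int.toNat_of_nonneg hr0
    have hz' : ∀ i, z i = n i / p := fun i => by
      have := congrArg (fun v : Plane => v i) hz
      simp only [PiLp.smul_apply, smul_eq_mul, digitVec_apply] at this
      rw [eq_div_iff hp.ne']; linarith
    obtain ⟨k0, hk0⟩ := e0
    obtain ⟨k1, hk1⟩ := e1
    have c0 : (n 0 : ℝ) = r * a 0 + p * k0 := by
      exact_mod_cast (by linear_combination hk0 : n 0 = r * a 0 + p * k0)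
    have c1 : (n 1 : ℝ) = r * a 1 + p * k1 := by
      exact_mod_cast (by linear_combination hk1 : n 1 = r * a 1 + p * k1)
    refine ⟨![k0, k1], fun i => ?_⟩
    rw [hz', hcast]
    fin_cases i
    · simp [c0]; field_simp
    · simp [c1]; field_simp

theorem mask_eq_zero_iff (z : Plane) : mask D z = 0 ↔ z ∈ maskZeros p a := by
  rw [← H.latticeTranslates_eq, ← H.zeros]
  rfl

theorem smul_residue_mem {j : ℤ} (hj : ¬ (p : ℤ) ∣ j) :
    ((j : ℝ) / p) • digitVec a ∈ maskZeros p a := by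
  have hp := H.p_pos
  refine ⟨fun i => j * a i, fun h => (H.prime_int.dvd_or_dvd h).elim hj (H.not_dvd 0),
    ⟨0, by ring⟩, ?_⟩
  ext i
  simp
  field_simp

/-- Where the mask has modulus one, all characters of the digits are trivial. -/
theorem expFun_eq_one_of_norm_mask {ξ : Plane} (h : ‖mask D ξ‖ = 1) {d : Fin 2 → ℤ} (hd : d ∈ D) :
    expFun ξ (digitVec d) = 1 := by
  by_cases hd0 : d = 0
  · simp [hd0]
  refine eq_one_of_norm_one_add (norm_expFun _ _) ?_
  have hp := H.p_pos
  have h1 : ‖∑ e ∈ D, expFun ξ (digitVec e)‖ = p := by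
    rw [mask_eq, H.card, norm_mul, norm_inv, Complex.norm_natCast] at h
    field_simp at h
    exact h
  have hsub : ({0, d} : Finset (Fin 2 → ℤ)) ⊆ D := by
    intro e he
    rcases Finset.mem_insert.mp he with rfl | he
    · exact H.zero_mem
    · rwa [Finset.mem_singleton.mp he]
  rw [← Finset.sum_sdiff hsub, Finset.sum_pair (Ne.symm hd0), digitVec_zero,
    expFun_zero_right] at h1
  -- The p − 2 remaining unimodular terms contribute at most p − 2 to a sum of modulus p, so |1 +
  -- χ(d)| ≥ 2.
  have h2 : ‖∑ e ∈ D \ {0, d}, expFun ξ (digitVec e)‖ ≤ (p : ℝ) - 2 := by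
    refine (norm_sum_le _ _).trans ?_
    simp only [norm_expFun, Finset.sum_const, nsmul_eq_mul, mul_one]
    rw [Finset.card_sdiff_of_subset hsub, Finset.card_pair (Ne.symm hd0), H.card,
      Nat.cast_sub H.prime.two_le]
    simp
  have h3 := norm_add_le (∑ e ∈ D \ {0, d}, expFun ξ (digitVec e)) (1 + expFun ξ (digitVec d))
  linarith

/-- A period of the modulus of the mask is an integer point. -/
theorem integer_of_period {τ : Plane} (h : ∀ η, ‖mask D (η + τ)‖ = ‖mask D η‖) :
    τ ∈ integerPoints := by
  have hp := H.p_pos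
  have h1 : ‖mask D τ‖ = 1 := by
    have := h 0
    rwa [zero_add, H.mask_zero, norm_one] at this
  set z := (((1 : ℤ) : ℝ) / p) • digitVec a with hz
  have h1p : ¬ (p : ℤ) ∣ 1 := fun h => H.prime_int.not_isUnit (isUnit_of_dvd_one h)
  have hzm : z ∈ maskZeros p a := H.smul_residue_mem h1p
  -- The period carries the zero a/p to another zero, so pτ is an integer vector proportional to a
  -- modulo p. The multiple must be zero, since τ is not a zero of the mask.
  have hzτ : z + τ ∈ maskZeros p a := by
    rw [← H.mask_eq_zero_iff, ← norm_eq_zero, h, norm_eq_zero, H.mask_eq_zero_iff]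
    exact hzm
  have hτ : ¬ τ ∈ maskZeros p a := fun hm => by
    rw [(H.mask_eq_zero_iff τ).mpr hm] at h1
    simp at h1
  obtain ⟨n, -, hn2, hn3⟩ := hzτ
  have hτn : (p : ℝ) • τ = digitVec (n - a) := by
    rw [digitVec_sub, ← hn3, smul_add, hz, smul_smul]
    have : (p : ℝ) * (((1 : ℤ) : ℝ) / p) = 1 := by push_cast; field_simp
    rw [this, one_smul]; abel
  have hdet : (p : ℤ) ∣ (n - a) 0 * a 1 - (n - a) 1 * a 0 := by
    simp only [Pi.sub_apply]
    convert hn2 using 1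
    ring
  have h0 : (p : ℤ) ∣ (n - a) 0 := by
    by_contra hc
    exact hτ ⟨n - a, hc, hdet, hτn⟩
  have h1' : (p : ℤ) ∣ (n - a) 1 := by
    rw [dvd_sub_right (h0.mul_right _)] at hdet
    exact (H.prime_int.dvd_or_dvd hdet).resolve_right (H.not_dvd 0)
  obtain ⟨k0, hk0⟩ := h0
  obtain ⟨k1, hk1⟩ := h1'
  have : n - a = (p : ℤ) • ![k0, k1] := by
    funext i
    fin_cases i
    · simpa using hk0
    · simpa using hk1
  refine ⟨![k0, k1], ?_⟩
  rw [this] at hτn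
  have e : digitVec ((p : ℤ) • ![k0, k1]) = (p : ℝ) • digitVec ![k0, k1] := by
    ext i
    fin_cases i <;> simp
  rw [e] at hτn
  exact (smul_right_injective _ hp.ne' hτn).symm

/-- A full system of `p` mutually orthogonal characters of the digit set. -/
theorem sum_norm_mask_sq {η : Fin p → Plane} (hη : ∀ i j, i ≠ j → η i - η j ∈ maskZeros p a)
    (ξ : Plane) : ∑ i, ‖mask D (ξ + η i)‖ ^ 2 = 1 := by
  have hp := H.p_pos
  have hpc : (p : ℂ) ≠ 0 := by exact_mod_cast hp.ne'
  -- U is the table of characters and V its normalized adjoint. Orthogonality of the characters is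
  -- UV = 1; as there are p characters and p digits, VU = 1 follows, and this is Parseval's identity
  -- on D.
  let U : Matrix (Fin p) D ℂ := fun i d => expFun (η i) (digitVec d)
  let V : Matrix D (Fin p) ℂ := fun d i => (p : ℂ)⁻¹ * expFun (-η i) (digitVec d)
  have hUV : U * V = 1 := by
    ext i j
    have e : (U * V) i j = mask D (η i - η j) := by
      rw [Matrix.mul_apply, mask_eq, H.card, Finset.mul_sum, ← Finset.sum_coe_sort D]
      refine Finset.sum_congr rfl fun d _ => ?_
      simp only [U, V]
      rw [sub_eq_add_neg, expFun_add]
      ring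
    rw [e]
    by_cases hij : i = j
    · subst hij
      rw [sub_self, H.mask_zero, Matrix.one_apply_eq]
    · rw [Matrix.one_apply_ne hij]
      exact (H.mask_eq_zero_iff _).mpr (hη i j hij)
  have hVU : V * U = 1 := (Matrix.mul_eq_one_comm_of_card_eq _ _ _ (by simp [H.card])).mp hUV
  have e1 : ∀ i, ((‖mask D (ξ + η i)‖ ^ 2 : ℝ) : ℂ)
      = (p : ℂ)⁻¹ ^ 2 * ∑ d : D, ∑ e : D, expFun ξ (digitVec d) * expFun (-ξ) (digitVec e) *
        (U i d * expFun (-η i) (digitVec e)) := by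
    intro i
    have h1 : ((‖mask D (ξ + η i)‖ ^ 2 : ℝ) : ℂ)
        = mask D (ξ + η i) * (starRingEnd ℂ) (mask D (ξ + η i)) := by
      rw [Complex.mul_conj, Complex.normSq_eq_norm_sq]
    rw [h1, mask_eq, H.card, map_mul, map_sum, ← Finset.sum_coe_sort D,
      ← Finset.sum_coe_sort D (f := fun x => (starRingEnd ℂ) (expFun (ξ + η i) (digitVec x)))]
    simp only [map_inv₀, Complex.conj_natCast]
    rw [mul_mul_mul_comm, ← sq, Finset.sum_mul_sum]
    congr 1
    refine Finset.sum_congr rfl fun d _ => Finset.sum_congr rfl fun e _ => ?_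
    rw [← expFun_neg, neg_add, expFun_add, expFun_add]
    simp only [U]
    ring
  have e2 : ((∑ i, ‖mask D (ξ + η i)‖ ^ 2 : ℝ) : ℂ) = 1 := by
    push_cast
    have e3 : ∀ i, ((‖mask D (ξ + η i)‖ : ℝ) : ℂ) ^ 2
      = (p : ℂ)⁻¹ * ∑ d : D, ∑ e : D, expFun ξ (digitVec d) * expFun (-ξ) (digitVec e) *
        (V e i * U i d) := fun i => by
      rw [← Complex.ofReal_pow, e1, sq, mul_assoc, Finset.mul_sum]
      congr 1
      refine Finset.sum_congr rfl fun d _ => ?_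
      rw [Finset.mul_sum]
      refine Finset.sum_congr rfl fun e _ => ?_
      simp only [V]
      ring
    simp only [e3]
    rw [← Finset.mul_sum, Finset.sum_comm]
    have e4 : ∀ d : D, ∑ i, ∑ e : D, expFun ξ (digitVec d) * expFun (-ξ) (digitVec e) *
        (V e i * U i d) = 1 := by
      intro d
      rw [Finset.sum_comm]
      have e5 : ∀ e : D, ∑ i, expFun ξ (digitVec d) * expFun (-ξ) (digitVec e) *
        (V e i * U i d) = expFun ξ (digitVec d) * expFun (-ξ) (digitVec e) *
          (1 : Matrix D D ℂ) e d := fun e => by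
        rw [← hVU, Matrix.mul_apply, Finset.mul_sum]
      simp only [e5]
      rw [Finset.sum_eq_single d]
      · rw [Matrix.one_apply_eq, mul_one, ← expFun_add, add_neg_cancel, expFun_zero]
      · intro e _ hne
        rw [Matrix.one_apply_ne hne, mul_zero]
      · simp
    simp only [e4]
    simp [H.card, hpc]
  exact_mod_cast e2

/-- If all digits lay on the horizontal axis, the mask would ignore the second coordinate and its
zero set would contain vertical lines. The point with second coordinate 1/(2p) shows that it does
not. -/
theorem exists_snd_ne_zero : ∃ d ∈ D, d 1 ≠ 0 := by
  by_contra hc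
  push Not at hc
  have hp := H.p_pos
  have h1p : ¬ (p : ℤ) ∣ 1 := fun h => H.prime_int.not_isUnit (isUnit_of_dvd_one h)
  have hz := H.smul_residue_mem h1p
  set z := (((1 : ℤ) : ℝ) / p) • digitVec a with hzdef
  let w : Plane := WithLp.toLp 2 ![z 0, 1 / (2 * p)]
  have hw : mask D w = mask D z := by
    rw [mask_eq, mask_eq]
    congr 1
    refine Finset.sum_congr rfl fun d hd => ?_
    unfold expFun
    rw [inner_digitVec, inner_digitVec, hc d hd]
    simp [w]
  rw [(H.mask_eq_zero_iff z).mpr hz, H.mask_eq_zero_iff] at hw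
  obtain ⟨n, -, -, hn⟩ := hw
  have := congrArg (fun v : Plane => v 1) hn
  simp only [PiLp.smul_apply, smul_eq_mul, digitVec_apply, w, Matrix.cons_val_one,
    Matrix.cons_val_fin_one] at this
  have h2 : (2 : ℝ) * n 1 = 1 := by
    rw [← this]; field_simp
  have h3 : 2 * n 1 = 1 := by exact_mod_cast h2
  omega

/-- Away from the integers of `N ⟨u, ·⟩` the mask is bounded away from modulus one. -/
theorem exists_norm_mask_le (u : Fin 2 → ℤ) : ∃ N : ℤ, N ≠ 0 ∧ ∀ c : ℝ, 0 < c →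
    ∃ κ : ℝ, 0 < κ ∧ κ < 1 ∧ ∀ ξ : Plane, (∀ n : ℤ, c ≤ |N * inner ℝ ξ (digitVec u) - n|) →
      ‖mask D ξ‖ ≤ κ := by
  obtain ⟨d, hd, hd0, hd1⟩ := H.horizontal
  obtain ⟨e, he, he1⟩ := H.exists_snd_ne_zero
  -- N is the determinant of two independent digits. Where the mask has modulus one, both digits
  -- pair integrally with ξ, so Nξ is integral and so is N⟨ξ, u⟩. Periodicity and compactness then
  -- give the uniform bound.
  refine ⟨d 0 * e 1, mul_ne_zero hd0 he1, fun c hc => ?_⟩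
  set N : ℤ := d 0 * e 1 with hN
  let K : Set Plane := {ξ | ∀ n : ℤ, c ≤ |N * inner ℝ ξ (digitVec u) - n|}
  have hK : IsClosed K := by
    have : K = ⋂ n : ℤ, {ξ | c ≤ |N * inner ℝ ξ (digitVec u) - n|} := by
      ext; simp [K]
    rw [this]
    refine isClosed_iInter fun n => isClosed_le continuous_const ?_
    fun_prop
  have hcomp : IsCompact (K ∩ Metric.closedBall 0 2) :=
    (isCompact_closedBall _ _).inter_left hK
  have hlt : ∀ ξ ∈ K, ‖mask D ξ‖ < 1 := by
    intro ξ hξ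
    refine lt_of_le_of_ne (H.norm_mask_le ξ) fun h => ?_
    obtain ⟨n, hn⟩ := (expFun_eq_one_iff _ _).mp (H.expFun_eq_one_of_norm_mask h hd)
    obtain ⟨m, hm⟩ := (expFun_eq_one_iff _ _).mp (H.expFun_eq_one_of_norm_mask h he)
    rw [inner_digitVec] at hn hm
    have := hξ ((e 1 * u 0 - e 0 * u 1) * n + d 0 * u 1 * m)
    have e0 : (N : ℝ) * inner ℝ ξ (digitVec u)
        - (((e 1 * u 0 - e 0 * u 1) * n + d 0 * u 1 * m : ℤ) : ℝ) = 0 := by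
      rw [inner_digitVec, hN]
      push_cast
      rw [← hn, ← hm, hd1]
      push_cast
      ring
    rw [e0, abs_zero] at this
    linarith
  have hred : ∀ ξ ∈ K, ∃ η ∈ K ∩ Metric.closedBall 0 2, mask D ξ = mask D η := by
    intro ξ hξ
    set k : Fin 2 → ℤ := fun i => ⌊ξ i⌋ with hk
    refine ⟨ξ - digitVec k, ⟨fun n => ?_, ?_⟩, ?_⟩
    · have := hξ (n + N * (k 0 * u 0 + k 1 * u 1))
      convert this using 2
      rw [inner_sub_left, inner_digitVec, inner_digitVec]
      push_cast
      simp
      ring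
    · rw [mem_closedBall_zero_iff, EuclideanSpace.norm_eq, Real.sqrt_le_left (by norm_num)]
      simp only [Fin.sum_univ_two, PiLp.sub_apply, digitVec_apply, hk, Real.norm_eq_abs, sq_abs]
      have b : ∀ i, (ξ i - ⌊ξ i⌋) ^ 2 ≤ 1 := fun i => by
        have h1 := Int.floor_le (ξ i)
        have h2 := Int.lt_floor_add_one (ξ i)
        nlinarith
      linarith [b 0, b 1]
    · have := mask_add_integer D (ξ - digitVec k) (digitVec_mem k)
      rwa [sub_add_cancel] at this
  rcases (K ∩ Metric.closedBall 0 2).eq_empty_or_nonempty with hemp | hne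
  · refine ⟨1 / 2, by norm_num, by norm_num, fun ξ hξ => ?_⟩
    obtain ⟨η, hη, -⟩ := hred ξ hξ
    rw [hemp] at hη
    exact hη.elim
  · obtain ⟨η₀, hη₀, hmax⟩ := hcomp.exists_isMaxOn hne H.continuous_mask.norm.continuousOn
    refine ⟨max (1 / 2) ‖mask D η₀‖, lt_max_of_lt_left (by norm_num),
      max_lt (by norm_num) (hlt _ hη₀.1), fun ξ hξ => ?_⟩
    obtain ⟨η, hη, he⟩ := hred ξ hξ
    rw [he]
    exact le_max_of_le_right (hmax hη)

end DigitSystem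

/-! ### Self-affine systems -/

/-- A probability measure refined by the digit set `D` under the expansion `A = B⁻¹` of the
frequency plane. -/
structure SelfAffineSystem (p : ℕ) (D : Finset (Fin 2 → ℤ)) (a : Fin 2 → ℤ)
    (A B : Plane →L[ℝ] Plane) (μ : Measure Plane) : Prop extends DigitSystem p D a where
  prob : IsProbabilityMeasure μ
  left_inv : ∀ ξ, B (A ξ) = ξ
  right_inv : ∀ ξ, A (B ξ) = ξ
  tendsto_zero : ∀ ξ, Filter.Tendsto (fun n : ℕ => (B ^ n) ξ) Filter.atTop (nhds 0)
  refine : ∀ ξ, fourierTransform μ ξ = mask D (B ξ) * fourierTransform μ (B ξ)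

theorem smul_digitVec_mem_maskZeros {p : ℕ} (hp : p.Prime) {a v : Fin 2 → ℤ} (hv : ¬ (p : ℤ) ∣ v 0)
    (hdet : (p : ℤ) ∣ v 0 * a 1 - v 1 * a 0) {j : ℤ} (hj : ¬ (p : ℤ) ∣ j) :
    ((j : ℝ) / p) • digitVec v ∈ maskZeros p a := by
  have hp0 : (p : ℝ) ≠ 0 := by exact_mod_cast hp.ne_zero
  have hpi := Nat.prime_iff_prime_int.mp hp
  refine ⟨fun i => j * v i, fun h => (hpi.dvd_or_dvd h).elim hj hv, ?_, ?_⟩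
  · obtain ⟨t, ht⟩ := hdet
    exact ⟨j * t, by linear_combination j * ht⟩
  · ext i
    simp
    field_simp

/-- The `n`-th partial product of the Fourier transform. -/
noncomputable def partialProduct (D : Finset (Fin 2 → ℤ)) (B : Plane →L[ℝ] Plane) (n : ℕ)
    (ξ : Plane) : ℂ := ∏ k ∈ Finset.range n, mask D ((B ^ (k + 1)) ξ)

/-! ### Infinite products and the compactness criterion for spectrality -/

namespace SelfAffineSystem

variable {p : ℕ} {D : Finset (Fin 2 → ℤ)} {a : Fin 2 → ℤ} {A B : Plane →L[ℝ] Plane}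
  {μ : Measure Plane} (S : SelfAffineSystem p D a A B μ)
include S

theorem B_pow_A_pow (n : ℕ) (ξ : Plane) : (B ^ n) ((A ^ n) ξ) = ξ := by
  induction n with
  | zero => simp
  | succ n ih =>
    rw [pow_succ, pow_succ', mul_apply_eq_comp, mul_apply_eq_comp,
      S.left_inv, ih]

theorem A_pow_B_pow (n : ℕ) (ξ : Plane) : (A ^ n) ((B ^ n) ξ) = ξ := by
  induction n with
  | zero => simp
  | succ n ih =>
    rw [pow_succ, pow_succ', mul_apply_eq_comp, mul_apply_eq_comp,
      S.right_inv, ih]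

theorem B_pow_A_pow_add (n m : ℕ) (ξ : Plane) : (B ^ n) ((A ^ (n + m)) ξ) = (A ^ m) ξ := by
  rw [pow_add, mul_apply_eq_comp, S.B_pow_A_pow]

theorem fourierTransform_eq_partialProduct (n : ℕ) (ξ : Plane) :
    fourierTransform μ ξ = partialProduct D B n ξ * fourierTransform μ ((B ^ n) ξ) := by
  induction n with
  | zero => simp [partialProduct]
  | succ n ih =>
    have h : (B ^ (n + 1)) ξ = B ((B ^ n) ξ) := by
      rw [pow_succ', mul_apply_eq_comp]
    rw [ih, S.refine ((B ^ n) ξ), partialProduct, partialProduct, Finset.prod_range_succ, h]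
    ring

theorem norm_fourierTransform_le_pow (n : ℕ) (ξ : Plane) :
    ‖fourierTransform μ ξ‖ ≤ ‖fourierTransform μ ((B ^ n) ξ)‖ := by
  rw [S.fourierTransform_eq_partialProduct n ξ, norm_mul]
  refine mul_le_of_le_one_left (norm_nonneg _) ?_
  rw [partialProduct, norm_prod]
  exact Finset.prod_le_one (fun _ _ => norm_nonneg _) fun _ _ => S.norm_mask_le _

theorem tendsto_fourierTransform_pow (ξ : Plane) :
    Filter.Tendsto (fun n : ℕ => fourierTransform μ ((B ^ n) ξ)) Filter.atTop (nhds 1) := by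
  have := S.prob
  have h := (continuous_fourierTransform μ).tendsto 0
  rw [fourierTransform_zero] at h
  exact h.comp (S.tendsto_zero ξ)

theorem tendsto_partialProduct (ξ : Plane) :
    Filter.Tendsto (fun n : ℕ => ‖partialProduct D B n ξ‖ ^ 2) Filter.atTop
      (nhds (‖fourierTransform μ ξ‖ ^ 2)) := by
  have h1 := (S.tendsto_fourierTransform_pow ξ).norm
  rw [norm_one] at h1
  have h2 : Filter.Tendsto (fun n : ℕ => (‖fourierTransform μ ξ‖
      / ‖fourierTransform μ ((B ^ n) ξ)‖) ^ 2) Filter.atTop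
      (nhds ((‖fourierTransform μ ξ‖ / 1) ^ 2)) :=
    (tendsto_const_nhds.div h1 one_ne_zero).pow 2
  rw [div_one] at h2
  refine h2.congr' ?_
  filter_upwards [h1.eventually_ne one_ne_zero] with n hn
  rw [S.fourierTransform_eq_partialProduct n ξ, norm_mul, mul_div_assoc, div_self hn, mul_one]

/-- Since B^n ξ → 0 and μ̂ is continuous with μ̂(0) = 1, the tail factor is eventually nonzero; a
zero must come from one of finitely many mask factors. -/
theorem fourierTransform_eq_zero_iff (ξ : Plane) :
    fourierTransform μ ξ = 0 ↔ ∃ k : ℕ, (B ^ (k + 1)) ξ ∈ maskZeros p a := by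
  constructor
  · intro h
    obtain ⟨n, hn⟩ := ((S.tendsto_fourierTransform_pow ξ).eventually_ne one_ne_zero).exists
    rw [S.fourierTransform_eq_partialProduct n ξ, mul_eq_zero, or_iff_left hn, partialProduct,
      Finset.prod_eq_zero_iff] at h
    obtain ⟨k, -, hk⟩ := h
    exact ⟨k, (S.mask_eq_zero_iff _).mp hk⟩
  · rintro ⟨k, hk⟩
    rw [S.fourierTransform_eq_partialProduct (k + 1) ξ, partialProduct, Finset.prod_range_succ,
      (S.mask_eq_zero_iff _).mpr hk]
    simp

/-- A general criterion for spectrality: frequencies are built digit by digit, with integral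
corrections that keep the renormalized frequencies in a compact set without zeros. -/
theorem isSpectralMeasure_of_compact {v : Fin 2 → ℤ} (hv : ¬ (p : ℤ) ∣ v 0)
    (hdet : (p : ℤ) ∣ v 0 * a 1 - v 1 * a 0)
    (hint : ∀ k : ℕ, (A ^ (k + 1)) ((p : ℝ)⁻¹ • digitVec v) ∈ integerPoints)
    {K : Set Plane} (hK : IsCompact K) (h0 : (0 : Plane) ∈ K) (hB : ∀ η ∈ K, B η ∈ K)
    (hstep : ∀ η ∈ K, ∀ j : ℕ, j < p → ∃ w, (∀ k : ℕ, (A ^ k) w ∈ integerPoints) ∧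
      B η + (((j : ℤ) : ℝ) / p) • digitVec v + w ∈ K)
    (hne : ∀ η ∈ K, fourierTransform μ η ≠ 0) : IsSpectralMeasure μ := by
  classical
  have hprob := S.prob
  have hp := S.p_pos
  -- At stage n the finite set satisfies Parseval's identity for the partial product, its points are
  -- separated at levels below n, and its renormalizations lie in K.
  let Inv : ℕ → Finset Plane → Prop := fun n Λ =>
    (∀ ξ, ∑ l ∈ Λ, ‖partialProduct D B n (ξ + l)‖ ^ 2 = 1) ∧
    (∀ x ∈ Λ, ∀ y ∈ Λ, x ≠ y → ∃ k < n, (B ^ (k + 1)) (x - y) ∈ maskZeros p a) ∧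
    (∀ l ∈ Λ, (B ^ n) l ∈ K)
  have step : ∀ n Λ, Inv n Λ → ∃ Λ', Λ ⊆ Λ' ∧ Inv (n + 1) Λ' := by
    rintro n Λ ⟨ha, hb, hc⟩
    -- The correction is forced to be zero for j = 0 so that every old frequency survives into the
    -- next stage.
    have hw : ∀ l : Plane, ∀ j : Fin p, ∃ w, l ∈ Λ → (∀ k : ℕ, (A ^ k) w ∈ integerPoints) ∧
        B ((B ^ n) l) + (((j : ℕ) : ℤ) / p : ℝ) • digitVec v + w ∈ K ∧ ((j : ℕ) = 0 → w = 0) := by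
      intro l j
      by_cases hl : l ∈ Λ
      · by_cases hj : (j : ℕ) = 0
        · refine ⟨0, fun _ => ⟨fun k => ?_, ?_, fun _ => rfl⟩⟩
          · rw [map_zero]; exact zero_mem _
          · simpa [hj] using hB _ (hc l hl)
        · obtain ⟨w, h1, h2⟩ := hstep _ (hc l hl) j j.2
          exact ⟨w, fun _ => ⟨h1, h2, fun h => (hj h).elim⟩⟩
      · exact ⟨0, fun h => (hl h).elim⟩
    choose w hw using hw
    let τ : Plane → Fin p → Plane := fun l j => (((j : ℕ) : ℤ) / p : ℝ) • digitVec v + w l j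
    have hτint : ∀ l ∈ Λ, ∀ j, ∀ k : ℕ, (A ^ (k + 1)) (τ l j) ∈ integerPoints := by
      intro l hl j k
      simp only [τ]
      rw [map_add]
      refine add_mem ?_ ((hw l j hl).1 _)
      have : (((j : ℕ) : ℤ) / p : ℝ) • digitVec v = ((j : ℕ) : ℕ) • ((p : ℝ)⁻¹ • digitVec v) := by
        rw [← Nat.cast_smul_eq_nsmul ℝ, smul_smul]
        congr 1
      rw [this, map_nsmul]
      exact nsmul_mem (hint k) _
    have hτdiff : ∀ l ∈ Λ, ∀ i j, i ≠ j → τ l i - τ l j ∈ maskZeros p a := by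
      intro l hl i j hij
      have e : τ l i - τ l j = (((((i : ℕ) : ℤ) - ((j : ℕ) : ℤ) : ℤ) : ℝ) / p) • digitVec v
          + (w l i - w l j) := by
        simp only [τ]
        push_cast
        rw [sub_div, sub_smul]
        abel
      rw [e]
      refine maskZeros_add (smul_digitVec_mem_maskZeros S.prime hv hdet fun hd => hij ?_) ?_
      · have h1 := i.2
        have h2 := j.2
        have := Int.eq_zero_of_abs_lt_dvd hd (by rw [abs_lt]; constructor <;> omega)
        exact Fin.ext (by omega)
      · simpa using sub_mem ((hw l i hl).1 0) ((hw l j hl).1 0)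
    -- Levels below n see the new term as an integer point and do not change. Level n sees p
    -- mutually orthogonal characters of D, to which `sum_norm_mask_sq` applies.
    let c : Plane × Fin p → Plane := fun q => q.1 + (A ^ (n + 1)) (τ q.1 q.2)
    have hcB : ∀ q : Plane × Fin p, ∀ k < n, (B ^ (k + 1)) (c q)
        = (B ^ (k + 1)) q.1 + (A ^ (n - k)) (τ q.1 q.2) := by
      intro q k hk
      simp only [c]
      rw [map_add, show n + 1 = (k + 1) + (n - k) by omega, S.B_pow_A_pow_add]
    have hcn : ∀ q : Plane × Fin p, (B ^ (n + 1)) (c q) = (B ^ (n + 1)) q.1 + τ q.1 q.2 := by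
      intro q
      simp only [c]
      rw [map_add, S.B_pow_A_pow]
    have hsep : ∀ q ∈ Λ ×ˢ (Finset.univ : Finset (Fin p)),
        ∀ q' ∈ Λ ×ˢ (Finset.univ : Finset (Fin p)), q ≠ q' →
        ∃ k < n + 1, (B ^ (k + 1)) (c q - c q') ∈ maskZeros p a := by
      rintro ⟨x, i⟩ hq ⟨y, j⟩ hq' hne
      rw [Finset.mem_product] at hq hq'
      by_cases hxy : x = y
      · subst hxy
        refine ⟨n, Nat.lt_succ_self n, ?_⟩
        rw [map_sub, hcn, hcn]
        simp only [add_sub_add_left_eq_sub]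
        exact hτdiff x hq.1 i j fun h => hne (by rw [h])
      · obtain ⟨k, hk, hz⟩ := hb x hq.1 y hq'.1 hxy
        refine ⟨k, Nat.lt_succ_of_lt hk, ?_⟩
        rw [map_sub, hcB _ k hk, hcB _ k hk, add_sub_add_comm, ← map_sub]
        refine maskZeros_add hz ?_
        obtain ⟨m, hm⟩ : ∃ m, n - k = m + 1 := ⟨n - k - 1, by omega⟩
        rw [hm]
        exact sub_mem (hτint x hq.1 i m) (hτint y hq'.1 j m)
    have hinj : Set.InjOn c (Λ ×ˢ (Finset.univ : Finset (Fin p)) : Finset _) := by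
      intro q hq q' hq' h
      by_contra hne
      obtain ⟨k, -, hz⟩ := hsep q hq q' hq' hne
      rw [h, sub_self, map_zero] at hz
      exact maskZeros_not_integer hz (zero_mem _)
    refine ⟨(Λ ×ˢ Finset.univ).image c, ?_, ?_, ?_, ?_⟩
    · intro l hl
      rw [Finset.mem_image]
      refine ⟨(l, ⟨0, S.prime.pos⟩), by simp [hl], ?_⟩
      simp only [c, τ]
      rw [(hw l ⟨0, S.prime.pos⟩ hl).2.2 rfl]
      simp
    · intro ξ
      rw [Finset.sum_image hinj, Finset.sum_product, ← ha ξ]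
      refine Finset.sum_congr rfl fun l hl => ?_
      have e : ∀ j, ‖partialProduct D B (n + 1) (ξ + c (l, j))‖ ^ 2
          = ‖partialProduct D B n (ξ + l)‖ ^ 2
            * ‖mask D ((B ^ (n + 1)) (ξ + l) + τ l j)‖ ^ 2 := by
        intro j
        rw [partialProduct, Finset.prod_range_succ, norm_mul, mul_pow]
        congr 3
        · refine Finset.prod_congr rfl fun k hk => ?_
          rw [Finset.mem_range] at hk
          rw [map_add, hcB _ k hk, ← add_assoc, ← map_add]
          obtain ⟨m, hm⟩ : ∃ m, n - k = m + 1 := ⟨n - k - 1, by omega⟩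
          rw [hm]
          exact mask_add_integer _ _ (hτint l hl j m)
        · rw [map_add, hcn, ← add_assoc, ← map_add]
      simp only [e]
      rw [← Finset.mul_sum, S.sum_norm_mask_sq (hτdiff l hl), mul_one]
    · intro x hx y hy hxy
      obtain ⟨q, hq, rfl⟩ := Finset.mem_image.mp hx
      obtain ⟨q', hq', rfl⟩ := Finset.mem_image.mp hy
      exact hsep q hq q' hq' fun h => hxy (by rw [h])
    · intro x hx
      obtain ⟨⟨l, j⟩, hq, rfl⟩ := Finset.mem_image.mp hx
      rw [hcn, pow_succ', mul_apply_eq_comp, ← add_assoc]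
      exact (hw l j (Finset.mem_product.mp hq).1).2.1
  have base : Inv 0 {0} := by
    refine ⟨fun ξ => by simp [partialProduct], fun x hx y hy hxy => ?_, fun l hl => ?_⟩
    · rw [Finset.mem_singleton] at hx hy
      exact (hxy (hx.trans hy.symm)).elim
    · rw [Finset.mem_singleton] at hl
      simpa [hl] using h0
  obtain ⟨F, hF, hmono⟩ : ∃ F : ℕ → Finset Plane, (∀ n, Inv n (F n)) ∧ Monotone F := by
    choose! next hnext using step
    let F : ℕ → Finset Plane := fun n => Nat.rec (motive := fun _ => Finset Plane) {0} next n
    have hF : ∀ n, Inv n (F n) := by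
      intro n
      induction n with
      | zero => exact base
      | succ n ih => exact (hnext n (F n) ih).2
    exact ⟨F, hF, monotone_nat_of_le_succ fun n => (hnext n (F n) (hF n)).1⟩
  set Λ : Set Plane := {l | ∃ n, l ∈ F n} with hΛ
  have hcount : Λ.Countable := by
    rw [hΛ, Set.ofPred_exists]
    exact Set.countable_iUnion fun n => (F n).countable_toSet
  have hpair : ∀ x ∈ Λ, ∀ y ∈ Λ, ∃ n, x ∈ F n ∧ y ∈ F n := by
    intro x hx y hy
    obtain ⟨i, hi⟩ := hx
    obtain ⟨j, hj⟩ := hy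
    exact ⟨max i j, hmono (le_max_left i j) hi, hmono (le_max_right i j) hj⟩
  have horth : OrthogonalFrequencies μ Λ := by
    intro x hx y hy hxy
    obtain ⟨n, h1, h2⟩ := hpair x hx y hy
    obtain ⟨k, -, hk⟩ := (hF n).2.1 x h1 y h2 hxy
    exact (S.fourierTransform_eq_zero_iff _).mpr ⟨k, hk⟩
  obtain ⟨η₀, hη₀, hmin⟩ := hK.exists_isMinOn ⟨0, h0⟩
    (continuous_fourierTransform μ).norm.continuousOn
  set ε := ‖fourierTransform μ η₀‖ with hε
  have hεpos : 0 < ε := norm_pos_iff.mpr (hne _ hη₀)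
  refine isSpectralMeasure_of_hasSum hcount horth fun ξ => ?_
  -- a uniform lower bound near the compact set
  have hunif : ∀ᶠ n : ℕ in Filter.atTop, ∀ l ∈ F n,
      ε / 2 ≤ ‖fourierTransform μ ((B ^ n) (ξ + l))‖ := by
    have huc := (hK.uniformContinuousAt_of_continuousAt (fourierTransform μ)
      (fun x _ => (continuous_fourierTransform μ).continuousAt)
      (Metric.dist_mem_uniformity (half_pos hεpos)))
    rw [Metric.mem_uniformity_dist] at huc
    obtain ⟨δ, hδ, hu⟩ := huc
    filter_upwards [(Metric.tendsto_nhds.mp (S.tendsto_zero ξ)) δ hδ] with n hn l hl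
    have hlK := (hF n).2.2 l hl
    have h1 := hu (a := (B ^ n) l) (b := (B ^ n) (ξ + l))
      (by rw [map_add, dist_comm, dist_eq_norm, add_sub_cancel_right]; simpa using hn) hlK
    have h2 : ε ≤ ‖fourierTransform μ ((B ^ n) l)‖ := hmin hlK
    simp only [Set.mem_ofPred_eq, dist_eq_norm] at h1
    have h3 := norm_sub_norm_le (fourierTransform μ ((B ^ n) l))
      (fourierTransform μ ((B ^ n) (ξ + l)))
    linarith
  set g : Plane → ℝ := Λ.indicator fun l => ‖fourierTransform μ (ξ + l)‖ ^ 2 with hg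
  have hgs : Summable g := summable_subtype_iff_indicator.mp (horth.summable ξ)
  let f : ℕ → Plane → ℝ := fun n l =>
    if l ∈ F n then ‖partialProduct D B n (ξ + l)‖ ^ 2 else 0
  -- Eventually |μ̂(B^n(ξ + l))| ≥ ε/2 for all l in the n-th set, so the squared partial product is
  -- at most (2/ε)² |μ̂(ξ + l)|², which is summable by Bessel's inequality.
  have hlim : Filter.Tendsto (fun n => ∑' l, f n l) Filter.atTop (nhds (∑' l, g l)) := by
    refine tendsto_tsum_of_dominated_convergence (bound := fun l => (2 / ε) ^ 2 * g l)
      (hgs.mul_left _) (fun l => ?_) ?_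
    · by_cases hl : l ∈ Λ
      · obtain ⟨m, hm⟩ := hl
        rw [hg, Set.indicator_of_mem (show l ∈ Λ from ⟨m, hm⟩)]
        refine (S.tendsto_partialProduct (ξ + l)).congr' ?_
        filter_upwards [Filter.eventually_ge_atTop m] with n hn
        simp only [f]
        rw [if_pos (hmono hn hm)]
      · rw [hg, Set.indicator_of_notMem hl]
        refine tendsto_const_nhds.congr fun n => ?_
        simp only [f]
        rw [if_neg fun h => hl ⟨n, h⟩]
    · filter_upwards [hunif] with n hn l
      change ‖(if l ∈ F n then ‖partialProduct D B n (ξ + l)‖ ^ 2 else 0 : ℝ)‖ ≤ _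
      by_cases hl : l ∈ F n
      · rw [if_pos hl, Real.norm_of_nonneg (by positivity), hg,
          Set.indicator_of_mem (show l ∈ Λ from ⟨n, hl⟩), S.fourierTransform_eq_partialProduct n,
          norm_mul, mul_pow, div_pow]
        have h1 := hn l hl
        have h2 : (ε / 2) ^ 2 ≤ ‖fourierTransform μ ((B ^ n) (ξ + l))‖ ^ 2 :=
          pow_le_pow_left₀ (by positivity) h1 2
        rw [div_mul_eq_mul_div, le_div_iff₀ (by positivity)]
        nlinarith [sq_nonneg ‖partialProduct D B n (ξ + l)‖]
      · rw [if_neg hl, norm_zero, hg]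
        exact mul_nonneg (by positivity) (Set.indicator_nonneg (fun _ _ => by positivity) _)
  have hone : ∀ n, ∑' l, f n l = 1 := by
    intro n
    rw [tsum_eq_sum (s := F n) (fun l hl => if_neg hl), ← (hF n).1 ξ]
    exact Finset.sum_congr rfl fun l hl => if_pos hl
  have htsum : ∑' l, g l = 1 := by
    refine tendsto_nhds_unique hlim ?_
    simp only [hone]
    exact tendsto_const_nhds
  have : HasSum g 1 := htsum ▸ hgs.hasSum
  exact (hasSum_subtype_iff_indicator (f := fun l => ‖fourierTransform μ (ξ + l)‖ ^ 2)).mpr this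

end SelfAffineSystem

/-! ### Renormalization of spectra -/

section Classes

variable {ι κ : Type*} {π : ι → κ} {f g : ι → ℝ}

/-- In each class bound f by its maximum and use Σ g ≤ 1; the maximizers represent distinct classes,
so their f-values sum to at most 1. For the class of m the representative is m itself and the sum is
kept exact, which leaves at most 1 − f m for the others. -/
theorem sum_mul_le_of_classes (hf : ∀ i, 0 ≤ f i) (hg : ∀ i, 0 ≤ g i)
    (hclass : ∀ F : Finset ι, (∀ x ∈ F, ∀ y ∈ F, π x = π y) → ∑ i ∈ F, g i ≤ 1)
    (hrep : ∀ T : Finset ι, Set.InjOn π (T : Set ι) → ∑ i ∈ T, f i ≤ 1)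
    [DecidableEq κ] (F : Finset ι) {m : ι} (hm : m ∈ F) :
    ∑ i ∈ F, f i * g i ≤ 1 - f m + ∑ i ∈ F with π i = π m, f i * g i := by
  classical
  have hmax : ∀ k ∈ F.image π, ∃ r ∈ F, π r = k ∧
      (k ≠ π m → ∀ z ∈ F, π z = k → f z ≤ f r) ∧ (k = π m → r = m) := by
    intro k hk
    by_cases hkm : k = π m
    · exact ⟨m, hm, hkm.symm, fun h => (h hkm).elim, fun _ => rfl⟩
    · obtain ⟨x, hx, rfl⟩ := Finset.mem_image.mp hk
      obtain ⟨r, hr, hrm⟩ := Finset.exists_max_image (F.filter fun z => π z = π x) f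
        ⟨x, by simp [hx]⟩
      rw [Finset.mem_filter] at hr
      exact ⟨r, hr.1, hr.2, fun _ z hz hzx => hrm z (Finset.mem_filter.mpr ⟨hz, hzx⟩),
        fun h => (hkm h).elim⟩
  have hκ : ∀ k : κ, ∃ r, k ∈ F.image π → r ∈ F ∧ π r = k ∧
      (k ≠ π m → ∀ z ∈ F, π z = k → f z ≤ f r) ∧ (k = π m → r = m) := fun k => by
    by_cases hk : k ∈ F.image π
    · obtain ⟨r, h⟩ := hmax k hk
      exact ⟨r, fun _ => h⟩
    · exact ⟨m, fun h => (hk h).elim⟩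
  choose r hr using hκ
  have hkm : π m ∈ F.image π := Finset.mem_image_of_mem π hm
  rw [← Finset.sum_fiberwise_of_maps_to (t := F.image π)
    (fun i hi => Finset.mem_image_of_mem π hi), ← Finset.add_sum_erase _ _ hkm]
  have h1 : ∑ k ∈ (F.image π).erase (π m), ∑ i ∈ F with π i = k, f i * g i
      ≤ ∑ k ∈ (F.image π).erase (π m), f (r k) := by
    refine Finset.sum_le_sum fun k hk => ?_
    rw [Finset.mem_erase] at hk
    obtain ⟨-, -, h3, -⟩ := hr k hk.2
    calc ∑ i ∈ F with π i = k, f i * g i ≤ ∑ i ∈ F with π i = k, f (r k) * g i := by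
          refine Finset.sum_le_sum fun i hi => ?_
          rw [Finset.mem_filter] at hi
          exact mul_le_mul_of_nonneg_right (h3 hk.1 i hi.1 hi.2) (hg i)
      _ = f (r k) * ∑ i ∈ F with π i = k, g i := by rw [Finset.mul_sum]
      _ ≤ f (r k) := mul_le_of_le_one_right (hf _) (hclass _ fun x hx y hy => by
          rw [Finset.mem_filter] at hx hy
          rw [hx.2, hy.2])
  have hinj : Set.InjOn r (F.image π : Set κ) := by
    intro k hk l hl h
    rw [← (hr k hk).2.1, ← (hr l hl).2.1, h]
  have h2 : ∑ k ∈ F.image π, f (r k) ≤ 1 := by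
    rw [← Finset.sum_image (g := r) (f := f) hinj]
    refine hrep _ fun x hx y hy hxy => ?_
    simp only [Finset.coe_image, Set.mem_image] at hx hy
    obtain ⟨_, ⟨x', hx', rfl⟩, rfl⟩ := hx
    obtain ⟨_, ⟨y', hy', rfl⟩, rfl⟩ := hy
    rw [(hr _ (Finset.mem_image_of_mem π hx')).2.1,
      (hr _ (Finset.mem_image_of_mem π hy')).2.1] at hxy
    rw [hxy]
  rw [← Finset.add_sum_erase _ _ hkm, (hr _ hkm).2.2.2 rfl] at h2
  linarith

/-- If f x < f y within one class, replacing the class maximum of f by f x at the index x loses at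
least g x (f y − f x), and the total cannot reach 1. -/
theorem le_of_hasSum_classes (hf : ∀ i, 0 ≤ f i) (hg : ∀ i, 0 ≤ g i)
    (hclass : ∀ F : Finset ι, (∀ x ∈ F, ∀ y ∈ F, π x = π y) → ∑ i ∈ F, g i ≤ 1)
    (hrep : ∀ T : Finset ι, Set.InjOn π (T : Set ι) → ∑ i ∈ T, f i ≤ 1)
    (hsum : HasSum (fun i => f i * g i) 1) {x y : ι} (hxy : π x = π y) (hx : 0 < g x) :
    f y ≤ f x := by
  classical
  by_contra! hlt
  set Δ := g x * (f y - f x) with hΔ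
  have hΔ0 : 0 < Δ := mul_pos hx (sub_pos.mpr hlt)
  obtain ⟨F, hF, hFx⟩ := ((hsum.eventually_const_lt (show 1 - Δ < 1 by linarith)).and
    (Filter.eventually_ge_atTop ({x, y} : Finset ι))).exists
  have hxF : x ∈ F := hFx (by simp)
  have hyF : y ∈ F := hFx (by simp)
  obtain ⟨m, hm, hmax⟩ := Finset.exists_max_image (F.filter fun z => π z = π x) f
    ⟨x, by simp [hxF]⟩
  rw [Finset.mem_filter] at hm
  have h1 := sum_mul_le_of_classes hf hg hclass hrep F hm.1
  rw [hm.2] at h1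
  have hxm : x ∈ F.filter fun z => π z = π x := by simp [hxF]
  have h2 : ∑ i ∈ F with π i = π x, f i * g i
      ≤ ∑ i ∈ F with π i = π x, f m * g i - g x * (f m - f x) := by
    rw [← Finset.add_sum_erase _ _ hxm, ← Finset.add_sum_erase _ (fun i => f m * g i) hxm]
    have : ∑ i ∈ (F.filter fun z => π z = π x).erase x, f i * g i
        ≤ ∑ i ∈ (F.filter fun z => π z = π x).erase x, f m * g i :=
      Finset.sum_le_sum fun i hi =>
        mul_le_mul_of_nonneg_right (hmax i (Finset.mem_of_mem_erase hi)) (hg i)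
    linarith
  have h3 : ∑ i ∈ F with π i = π x, f m * g i ≤ f m := by
    rw [← Finset.mul_sum]
    refine mul_le_of_le_one_right (hf _) (hclass _ fun a ha b hb => ?_)
    rw [Finset.mem_filter] at ha hb
    rw [ha.2, hb.2]
  have h4 : f y ≤ f m := hmax y (by simp [hyF, hxy])
  have h5 : Δ ≤ g x * (f m - f x) := mul_le_mul_of_nonneg_left (by linarith) hx.le
  linarith

/-- When f is constant on the class of m, that class contributes f m Σ g and the others at most 1 −
f m. A total of 1 with f m > 0 leaves only Σ g = 1. -/
theorem hasSum_class_of_hasSum (hf : ∀ i, 0 ≤ f i) (hg : ∀ i, 0 ≤ g i)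
    (hclass : ∀ F : Finset ι, (∀ x ∈ F, ∀ y ∈ F, π x = π y) → ∑ i ∈ F, g i ≤ 1)
    (hrep : ∀ T : Finset ι, Set.InjOn π (T : Set ι) → ∑ i ∈ T, f i ≤ 1)
    (hsum : HasSum (fun i => f i * g i) 1) {m : ι} (hconst : ∀ y, π y = π m → f y = f m)
    (hm : 0 < f m) : HasSum (fun i : {i // π i = π m} => g i) 1 := by
  classical
  have hub : ∀ F : Finset {i // π i = π m}, ∑ i ∈ F, g i ≤ 1 := by
    intro F
    have := hclass (F.map ⟨Subtype.val, Subtype.val_injective⟩) (by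
      intro x hx y hy
      rw [Finset.mem_map] at hx hy
      obtain ⟨x', -, rfl⟩ := hx
      obtain ⟨y', -, rfl⟩ := hy
      exact x'.2.trans y'.2.symm)
    rwa [Finset.sum_map] at this
  refine hasSum_of_isLUB_of_nonneg _ (fun i => hg i) ⟨?_, fun b hb => ?_⟩
  · rintro _ ⟨F, rfl⟩
    exact hub F
  · by_contra! hlt
    obtain ⟨F, hF, hFm⟩ := ((hsum.eventually_const_lt
      (show 1 - f m * (1 - b) < 1 by nlinarith)).and
      (Filter.eventually_ge_atTop ({m} : Finset ι))).exists
    have hmF : m ∈ F := hFm (by simp)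
    have h1 := sum_mul_le_of_classes hf hg hclass hrep F hmF
    have h2 : ∑ i ∈ F with π i = π m, f i * g i = f m * ∑ i ∈ F with π i = π m, g i := by
      rw [Finset.mul_sum]
      refine Finset.sum_congr rfl fun i hi => ?_
      rw [hconst i (Finset.mem_filter.mp hi).2]
    have h3 : ∑ i ∈ F with π i = π m, g i ≤ b := by
      have := hb ⟨F.subtype fun i => π i = π m, rfl⟩
      simp only at this
      rwa [Finset.sum_subtype_eq_sum_filter] at this
    have h4 := mul_le_mul_of_nonneg_left h3 hm.le
    rw [h2] at h1
    linarith

end Classes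

/-- A set of frequencies with differences in the zero set satisfying Parseval's identity at all
but countably many points. -/
structure IsSpectrum (p : ℕ) (a : Fin 2 → ℤ) (B : Plane →L[ℝ] Plane) (μ : Measure Plane)
    (Λ : Set Plane) : Prop where
  zeros : ∀ x ∈ Λ, ∀ y ∈ Λ, x ≠ y → ∃ k : ℕ, (B ^ (k + 1)) (x - y) ∈ maskZeros p a
  total : ∃ E : Set Plane, E.Countable ∧
    ∀ ξ, ξ ∉ E → HasSum (fun l : Λ => ‖fourierTransform μ (ξ + l)‖ ^ 2) 1

theorem IsSpectrum.nonempty {p : ℕ} {a : Fin 2 → ℤ} {B : Plane →L[ℝ] Plane} {μ : Measure Plane}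
    {Λ : Set Plane} (hΛ : IsSpectrum p a B μ Λ) : Λ.Nonempty := by
  obtain ⟨E, hE, hsum⟩ := hΛ.total
  obtain ⟨ξ, hξ⟩ := (hE.dense_compl ℝ).nonempty
  by_contra hne
  rw [Set.not_nonempty_iff_eq_empty] at hne
  subst hne
  exact zero_ne_one (hasSum_empty.unique (hsum ξ hξ))

theorem countable_maskZeros {p : ℕ} (hp : p.Prime) (a : Fin 2 → ℤ) : (maskZeros p a).Countable := by
  have hp0 : (p : ℝ) ≠ 0 := by exact_mod_cast hp.ne_zero
  refine (Set.countable_range fun n : Fin 2 → ℤ => (p : ℝ)⁻¹ • digitVec n).mono ?_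
  rintro z ⟨n, -, -, hn⟩
  exact ⟨n, by simp only; rw [← hn, inv_smul_smul₀ hp0]⟩

/-! ### One renormalization step for a spectrum -/

namespace SelfAffineSystem

variable {p : ℕ} {D : Finset (Fin 2 → ℤ)} {a : Fin 2 → ℤ} {A B : Plane →L[ℝ] Plane}
  {μ : Measure Plane} (S : SelfAffineSystem p D a A B μ)
include S

theorem B_injective : Function.Injective B := fun x y h => by
  rw [← S.right_inv x, ← S.right_inv y, h]

theorem A_injective : Function.Injective A := fun x y h => by
  rw [← S.left_inv x, ← S.left_inv y, h]

theorem countable_zeros : {ξ | fourierTransform μ ξ = 0}.Countable := by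
  have : {ξ | fourierTransform μ ξ = 0} = ⋃ k : ℕ, (B ^ (k + 1)) ⁻¹' maskZeros p a := by
    ext ξ
    simp [S.fourierTransform_eq_zero_iff]
  rw [this]
  refine Set.countable_iUnion fun k => (countable_maskZeros S.prime a).preimage_of_injOn ?_
  intro x _ y _ h
  rw [← S.A_pow_B_pow (k + 1) x, ← S.A_pow_B_pow (k + 1) y]
  exact congrArg _ h

theorem exists_isSpectrum (h : IsSpectralMeasure μ) : ∃ Λ, IsSpectrum p a B μ Λ := by
  have := S.prob
  obtain ⟨Λ, -, ho, hs⟩ := h.exists_hasSum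
  exact ⟨Λ, fun x hx y hy hxy => (S.fourierTransform_eq_zero_iff _).mp (ho x hx y hy hxy),
    ∅, Set.countable_empty, fun ξ _ => hs ξ⟩

theorem continuous_norm_mask_comp (x : Plane) : Continuous fun ξ => ‖mask D (B (ξ + x))‖ ^ 2 := by
  have := S.continuous_mask
  fun_prop

variable {Λ : Set Plane} (hΛ : IsSpectrum p a B μ Λ) {G : AddSubgroup Plane}
include hΛ

/-- The estimates that govern one renormalization step. -/
theorem class_estimates (hG₁ : ∀ z, B z ∈ maskZeros p a → z ∉ G) (ξ : Plane) :
    (∀ F : Finset Λ, (∀ x ∈ F, ∀ y ∈ F, (x : Plane ⧸ G) = (y : Plane ⧸ G)) →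
      ∑ l ∈ F, ‖fourierTransform μ (B (ξ + l))‖ ^ 2 ≤ 1) := by
  classical
  have := S.prob
  intro F hF
  have hinj : Set.InjOn (fun l : Λ => B l) (F : Set Λ) := fun x _ y _ h =>
    Subtype.ext (S.B_injective h)
  have h := OrthogonalFrequencies.sum_le (μ := μ) (F := F.image fun l : Λ => B l) ?_ (B ξ)
  · rw [Finset.sum_image hinj] at h
    simpa only [map_add] using h
  · intro x hx y hy hxy
    simp only [Finset.coe_image, Set.mem_image] at hx hy
    obtain ⟨x', hx', rfl⟩ := hx
    obtain ⟨y', hy', rfl⟩ := hy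
    -- Points of one class are not separated at level 0, since such differences avoid G. They are
    -- separated later, so their B-images are orthogonal for μ.
    obtain ⟨k, hk⟩ := hΛ.zeros x' x'.2 y' y'.2 fun h => hxy (by rw [h])
    rw [← map_sub, S.fourierTransform_eq_zero_iff]
    cases k with
    | zero =>
      refine (hG₁ (x' - y') (by simpa using hk) ?_).elim
      have := hF x' hx' y' hy'
      rw [QuotientAddGroup.eq_iff_sub_mem] at this
      exact this
    | succ k =>
      refine ⟨k, ?_⟩
      rwa [pow_succ, mul_apply_eq_comp] at hk

/-- Differences separated at a later level lie in G, so representatives of distinct classes are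
separated at level 0. Their B-images are orthogonal for δ_D, and Bessel's inequality applies. -/
theorem representative_estimates (hG₂ : ∀ (k : ℕ) (z), (B ^ (k + 2)) z ∈ maskZeros p a → z ∈ G)
    (ξ : Plane) : (∀ T : Finset Λ, Set.InjOn (fun l : Λ => (l : Plane ⧸ G)) (T : Set Λ) →
      ∑ l ∈ T, ‖mask D (B (ξ + l))‖ ^ 2 ≤ 1) := by
  classical
  have := S.isProbabilityMeasure
  intro T hT
  have hinj : Set.InjOn (fun l : Λ => B l) (T : Set Λ) := fun x _ y _ h =>
    Subtype.ext (S.B_injective h)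
  have h := OrthogonalFrequencies.sum_le (μ := discreteMeasure D)
    (F := T.image fun l : Λ => B l) ?_ (B ξ)
  · rw [Finset.sum_image hinj] at h
    simpa only [mask, map_add] using h
  · intro x hx y hy hxy
    simp only [Finset.coe_image, Set.mem_image] at hx hy
    obtain ⟨x', hx', rfl⟩ := hx
    obtain ⟨y', hy', rfl⟩ := hy
    have hne : x' ≠ y' := fun h => hxy (by rw [h])
    obtain ⟨k, hk⟩ := hΛ.zeros x' x'.2 y' y'.2 fun h => hne (Subtype.ext h)
    rw [← map_sub]
    cases k with
    | zero => exact (S.mask_eq_zero_iff _).mpr (by simpa using hk)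
    | succ k =>
      refine (hne (hT hx' hy' ?_)).elim
      simp only
      rw [QuotientAddGroup.eq_iff_sub_mem]
      exact hG₂ k _ hk

theorem exists_hasSum_mul : ∃ E : Set Plane, E.Countable ∧ ∀ ξ, ξ ∉ E →
    HasSum (fun l : Λ => ‖mask D (B (ξ + l))‖ ^ 2 * ‖fourierTransform μ (B (ξ + l))‖ ^ 2) 1 := by
  obtain ⟨E, hE, h⟩ := hΛ.total
  refine ⟨E, hE, fun ξ hξ => ?_⟩
  convert h ξ hξ using 2 with l
  rw [S.refine (ξ + l), norm_mul, mul_pow]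

/-- `le_of_hasSum_classes` gives the inequality off the countable set where Parseval's identity is
unknown or μ̂(B(ξ + x)) = 0. A strict violation would hold on a nonempty open set, which meets the
complement of any countable set. -/
theorem norm_mask_le_of_class (hG₁ : ∀ z, B z ∈ maskZeros p a → z ∉ G)
    (hG₂ : ∀ (k : ℕ) (z), (B ^ (k + 2)) z ∈ maskZeros p a → z ∈ G) {x y : Plane} (hx : x ∈ Λ)
    (hy : y ∈ Λ) (hxy : y - x ∈ G) (ξ : Plane) :
    ‖mask D (B (ξ + y))‖ ^ 2 ≤ ‖mask D (B (ξ + x))‖ ^ 2 := by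
  by_contra! hlt
  obtain ⟨E, hE, hsum⟩ := S.exists_hasSum_mul hΛ
  have hopen : IsOpen {ξ | ‖mask D (B (ξ + x))‖ ^ 2 < ‖mask D (B (ξ + y))‖ ^ 2} :=
    isOpen_lt (S.continuous_norm_mask_comp x) (S.continuous_norm_mask_comp y)
  have hcount : (E ∪ (fun ξ => B (ξ + x)) ⁻¹' {ξ | fourierTransform μ ξ = 0}).Countable :=
    hE.union (S.countable_zeros.preimage_of_injOn fun u _ v _ h =>
      add_right_cancel (S.B_injective h))
  obtain ⟨η, hη, hη'⟩ := (hcount.dense_compl ℝ).inter_open_nonempty _ hopen ⟨ξ, hlt⟩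
  simp only [Set.mem_compl_iff, Set.mem_union, not_or, Set.mem_preimage, Set.mem_ofPred_eq] at hη'
  have := le_of_hasSum_classes (π := fun l : Λ => (l : Plane ⧸ G))
    (fun _ => sq_nonneg _) (fun _ => sq_nonneg _)
    (S.class_estimates hΛ hG₁ η) (S.representative_estimates hΛ hG₂ η) (hsum η hη'.1)
    (x := ⟨x, hx⟩) (y := ⟨y, hy⟩) (by
      simp only
      rw [eq_comm, QuotientAddGroup.eq_iff_sub_mem]; exact hxy)
    (pow_pos (norm_pos_iff.mpr hη'.2) 2)
  exact absurd hη (not_lt.mpr this)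

theorem norm_mask_eq_of_class (hG₁ : ∀ z, B z ∈ maskZeros p a → z ∉ G)
    (hG₂ : ∀ (k : ℕ) (z), (B ^ (k + 2)) z ∈ maskZeros p a → z ∈ G) {x y : Plane} (hx : x ∈ Λ)
    (hy : y ∈ Λ) (hxy : y - x ∈ G) (ξ : Plane) :
    ‖mask D (B (ξ + y))‖ ^ 2 = ‖mask D (B (ξ + x))‖ ^ 2 :=
  le_antisymm (S.norm_mask_le_of_class hΛ hG₁ hG₂ hx hy hxy ξ)
    (S.norm_mask_le_of_class hΛ hG₁ hG₂ hy hx (by rw [← neg_sub]; exact neg_mem hxy) ξ)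

/-- Frequencies in the same class differ by an integer point after renormalization. -/
theorem integer_of_class (hG₁ : ∀ z, B z ∈ maskZeros p a → z ∉ G)
    (hG₂ : ∀ (k : ℕ) (z), (B ^ (k + 2)) z ∈ maskZeros p a → z ∈ G) {x y : Plane} (hx : x ∈ Λ)
    (hy : y ∈ Λ) (hxy : y - x ∈ G) : B (y - x) ∈ integerPoints := by
  refine S.integer_of_period fun η => ?_
  have h := S.norm_mask_eq_of_class hΛ hG₁ hG₂ hx hy hxy (A η - x)
  rw [sub_add_cancel, S.left_inv, map_add, map_sub, S.left_inv] at h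
  rw [map_sub, show η + (B y - B x) = η - B x + B y by abel]
  exact (pow_left_inj₀ (norm_nonneg _) (norm_nonneg _) two_ne_zero).mp h

/-- A renormalized class of a spectrum is a spectrum. -/
theorem isSpectrum_class (hG₁ : ∀ z, B z ∈ maskZeros p a → z ∉ G)
    (hG₂ : ∀ (k : ℕ) (z), (B ^ (k + 2)) z ∈ maskZeros p a → z ∈ G) {x : Plane} (hx : x ∈ Λ) :
    IsSpectrum p a B μ (B '' {y | y ∈ Λ ∧ y - x ∈ G}) := by
  refine ⟨?_, ?_⟩
  · rintro _ ⟨y, ⟨hy, hyG⟩, rfl⟩ _ ⟨z, ⟨hz, hzG⟩, rfl⟩ hne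
    obtain ⟨k, hk⟩ := hΛ.zeros y hy z hz fun h => hne (by rw [h])
    cases k with
    | zero =>
      refine (hG₁ (y - z) (by simpa using hk) ?_).elim
      have := sub_mem hyG hzG
      rwa [sub_sub_sub_cancel_right] at this
    | succ k =>
      refine ⟨k, ?_⟩
      rwa [pow_succ, mul_apply_eq_comp, map_sub] at hk
  · obtain ⟨E, hE, hsum⟩ := S.exists_hasSum_mul hΛ
    -- The class sum is obtained only where its mask factor is nonzero. This is why `IsSpectrum`
    -- tolerates a countable exceptional set.
    have hmz : {ξ | mask D ξ = 0}.Countable := by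
      have : {ξ | mask D ξ = 0} = maskZeros p a := Set.ext S.mask_eq_zero_iff
      rw [this]
      exact countable_maskZeros S.prime a
    have hcount : (E ∪ (fun ξ => B (ξ + x)) ⁻¹' {ξ | mask D ξ = 0}).Countable :=
      hE.union (hmz.preimage_of_injOn fun u _ v _ h => add_right_cancel (S.B_injective h))
    refine ⟨A ⁻¹' (E ∪ (fun ξ => B (ξ + x)) ⁻¹' {ξ | mask D ξ = 0}),
      hcount.preimage_of_injOn fun u _ v _ h => S.A_injective h, fun η hη => ?_⟩
    simp only [Set.mem_union, not_or, Set.mem_preimage, Set.mem_ofPred_eq] at hη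
    have h := hasSum_class_of_hasSum (π := fun l : Λ => (l : Plane ⧸ G))
      (fun _ => sq_nonneg _) (fun _ => sq_nonneg _)
      (S.class_estimates hΛ hG₁ (A η)) (S.representative_estimates hΛ hG₂ (A η))
      (hsum (A η) hη.1) (m := ⟨x, hx⟩) (fun y hy => S.norm_mask_eq_of_class hΛ hG₁ hG₂ hx y.2 (by
        simp only at hy
        rwa [QuotientAddGroup.eq_iff_sub_mem] at hy) _)
      (pow_pos (norm_pos_iff.mpr hη.2) 2)
    let e : {l : Λ // (l : Plane ⧸ G) = ((⟨x, hx⟩ : Λ) : Plane ⧸ G)}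
        ≃ B '' {y | y ∈ Λ ∧ y - x ∈ G} :=
      Equiv.ofBijective (fun l => ⟨B l, l, ⟨l.1.2, QuotientAddGroup.eq_iff_sub_mem.mp l.2⟩, rfl⟩)
        ⟨fun u v h => Subtype.ext (Subtype.ext (S.B_injective (congrArg Subtype.val h))), by
          rintro ⟨_, y, ⟨hy, hyG⟩, rfl⟩
          exact ⟨⟨⟨y, hy⟩, QuotientAddGroup.eq_iff_sub_mem.mpr hyG⟩, rfl⟩⟩
    rw [← e.hasSum_iff]
    convert h using 2 with l
    simp only [Function.comp_apply, map_add, S.left_inv]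
    rfl

/-- A spectrum does not consist of a single class. -/
theorem exists_sub_mem_maskZeros (hG₁ : ∀ z, B z ∈ maskZeros p a → z ∉ G)
    (hG₂ : ∀ (k : ℕ) (z), (B ^ (k + 2)) z ∈ maskZeros p a → z ∈ G) {x : Plane} (hx : x ∈ Λ) :
    ∃ y ∈ Λ, B (y - x) ∈ maskZeros p a := by
  by_contra! hcon
  -- Without a separation at level 0 from x, all of Λ is one class and the mask factors out of
  -- Parseval's identity. Then |mask| ≥ 1 everywhere, although the mask vanishes at a/p.
  have hall : ∀ y ∈ Λ, y - x ∈ G := by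
    intro y hy
    by_cases hyx : y = x
    · rw [hyx, sub_self]; exact zero_mem _
    obtain ⟨k, hk⟩ := hΛ.zeros y hy x hx hyx
    cases k with
    | zero => exact (hcon y hy (by simpa using hk)).elim
    | succ k => exact hG₂ k _ hk
  obtain ⟨E, hE, hsum⟩ := S.exists_hasSum_mul hΛ
  have hge : ∀ ξ, ξ ∉ E → 1 ≤ ‖mask D (B (ξ + x))‖ ^ 2 := by
    intro ξ hξ
    refine hasSum_le_of_sum_le (hsum ξ hξ) fun F => ?_
    calc ∑ l ∈ F, ‖mask D (B (ξ + l))‖ ^ 2 * ‖fourierTransform μ (B (ξ + l))‖ ^ 2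
        = ‖mask D (B (ξ + x))‖ ^ 2 * ∑ l ∈ F, ‖fourierTransform μ (B (ξ + l))‖ ^ 2 := by
          rw [Finset.mul_sum]
          refine Finset.sum_congr rfl fun l _ => ?_
          rw [S.norm_mask_eq_of_class hΛ hG₁ hG₂ hx l.2 (hall l l.2)]
      _ ≤ _ := mul_le_of_le_one_right (sq_nonneg _) (S.class_estimates hΛ hG₁ ξ F
          fun u _ v _ => by
            rw [QuotientAddGroup.eq_iff_sub_mem]
            have := sub_mem (hall u u.2) (hall v v.2)
            rwa [sub_sub_sub_cancel_right] at this)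
  have hclosed : IsClosed {ξ | 1 ≤ ‖mask D (B (ξ + x))‖ ^ 2} :=
    isClosed_le continuous_const (S.continuous_norm_mask_comp x)
  have huniv : ∀ ξ, 1 ≤ ‖mask D (B (ξ + x))‖ ^ 2 := fun ξ => by
    have := closure_minimal (s := Eᶜ) (fun ξ hξ => hge ξ hξ) hclosed
    rw [(hE.dense_compl ℝ).closure_eq] at this
    exact this (Set.mem_univ ξ)
  have h1p : ¬ (p : ℤ) ∣ 1 := fun h => S.prime_int.not_isUnit (isUnit_of_dvd_one h)
  have hz := (S.mask_eq_zero_iff _).mpr (S.smul_residue_mem h1p)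
  have := huniv (A ((((1 : ℤ) : ℝ) / p) • digitVec a) - x)
  rw [sub_add_cancel, S.left_inv, hz] at this
  norm_num at this

/-- A spectrum is infinite. -/
theorem spectrum_infinite : Λ.Infinite := by
  intro hfin
  have hprob := S.prob
  obtain ⟨E, hE, hsum⟩ := hΛ.total
  have h1p : ¬ (p : ℤ) ∣ 1 := fun h => S.prime_int.not_isUnit (isUnit_of_dvd_one h)
  set z₀ : Plane := A ((((1 : ℤ) : ℝ) / p) • digitVec a) with hz₀
  have hz : fourierTransform μ z₀ = 0 := by
    rw [S.fourierTransform_eq_zero_iff]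
    exact ⟨0, by simpa [hz₀, S.left_inv] using S.smul_residue_mem h1p⟩
  -- With N frequencies, all B^n l are small for large n. At A^n η with η near the zero z₀, each
  -- term is at most 1/(N + 1), so the total stays below 1.
  set N : ℝ := (hfin.toFinset.card : ℝ) with hN
  have hN0 : 0 ≤ N := Nat.cast_nonneg _
  have hcont : Continuous fun ξ => ‖fourierTransform μ ξ‖ ^ 2 :=
    (continuous_fourierTransform μ).norm.pow 2
  have hev : ∀ᶠ ξ in nhds z₀, ‖fourierTransform μ ξ‖ ^ 2 < 1 / (N + 1) := by
    refine hcont.continuousAt.eventually_lt continuousAt_const ?_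
    rw [hz, norm_zero, zero_pow two_ne_zero]
    positivity
  obtain ⟨δ, hδ, hball⟩ := Metric.eventually_nhds_iff.mp hev
  have hn : ∀ᶠ n : ℕ in Filter.atTop, ∀ l ∈ Λ, ‖(B ^ n) l‖ < δ / 2 := by
    rw [Filter.eventually_all_finite hfin]
    intro l _
    have := Metric.tendsto_nhds.mp (S.tendsto_zero l) (δ / 2) (half_pos hδ)
    simpa using this
  obtain ⟨n, hn⟩ := hn.exists
  have hcE : ((A ^ n) ⁻¹' E).Countable := hE.preimage_of_injOn fun u _ v _ h => by
    rw [← S.B_pow_A_pow n u, ← S.B_pow_A_pow n v, h]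
  obtain ⟨η, hη, hη'⟩ := (hcE.dense_compl ℝ).inter_open_nonempty _ Metric.isOpen_ball
    ⟨z₀, Metric.mem_ball_self (half_pos hδ)⟩
  have hs := hsum ((A ^ n) η) hη'
  have hle : ∀ F : Finset Λ, ∑ l ∈ F, ‖fourierTransform μ ((A ^ n) η + l)‖ ^ 2 ≤ N / (N + 1) := by
    intro F
    have hb : ∀ l ∈ F, ‖fourierTransform μ ((A ^ n) η + l)‖ ^ 2 ≤ 1 / (N + 1) := by
      intro l _
      refine le_trans (pow_le_pow_left₀ (norm_nonneg _) (S.norm_fourierTransform_le_pow n _) 2) ?_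
      rw [map_add, S.B_pow_A_pow]
      refine (hball ?_).le
      rw [Metric.mem_ball] at hη
      calc dist (η + (B ^ n) l) z₀ ≤ dist (η + (B ^ n) l) η + dist η z₀ := dist_triangle _ _ _
        _ < δ / 2 + δ / 2 := by
          refine add_lt_add ?_ hη
          rw [dist_eq_norm, add_sub_cancel_left]
          exact hn l l.2
        _ = δ := by ring
    refine (Finset.sum_le_card_nsmul F _ _ hb).trans ?_
    rw [nsmul_eq_mul, mul_one_div]
    refine div_le_div_of_nonneg_right ?_ (by positivity)
    rw [hN]
    have : F.card ≤ hfin.toFinset.card := by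
      rw [← Finset.card_map ⟨Subtype.val, Subtype.val_injective⟩]
      refine Finset.card_le_card fun u hu => ?_
      obtain ⟨u', -, rfl⟩ := Finset.mem_map.mp hu
      simp
    exact_mod_cast this
  have := hasSum_le_of_sum_le hs hle
  rw [le_div_iff₀ (by positivity)] at this
  linarith

end SelfAffineSystem

/-! ### A valuation adapted to the expansion rate -/

section Valuation

variable {p : ℕ} (hp : p.Prime)
include hp

/-- A valuation subring contains ℤ, so the Bézout relation u p + w X = 1 excludes v(X) < 1. -/
theorem valuation_intCast_eq_one {V : ValuationSubring ℝ} (hV : V.valuation (p : ℝ) < 1) {X : ℤ}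
    (hX : ¬ (p : ℤ) ∣ X) : V.valuation (X : ℝ) = 1 := by
  have hint : ∀ n : ℤ, V.valuation (n : ℝ) ≤ 1 := fun n =>
    (V.valuation_le_one_iff _).mpr (intCast_mem V n)
  refine le_antisymm (hint X) (not_lt.mp fun hlt => ?_)
  obtain ⟨u, w, huw⟩ := (Prime.coprime_iff_not_dvd (Nat.prime_iff_prime_int.mp hp)).mpr hX
  have h1 : V.valuation ((u : ℝ) * p + w * X) < 1 := by
    refine (V.valuation.map_add _ _).trans_lt (max_lt ?_ ?_)
    · rw [map_mul]
      exact mul_lt_one_of_nonneg_of_lt_one_right (hint u) zero_le hV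
    · rw [map_mul]
      exact mul_lt_one_of_nonneg_of_lt_one_right (hint w) zero_le hlt
  have h2 : (u : ℝ) * p + w * X = 1 := by exact_mod_cast huw
  rw [h2, map_one] at h1
  exact lt_irrefl _ h1

/-- Sets of reals with differences `R^(k+1) X / p`, where `k < n` and `p ∤ X`, are finite provided
the exponent is governed by a valuation. -/
theorem finite_of_bounded_exponent {R : ℝ} {V : ValuationSubring ℝ} (hV : V.valuation (p : ℝ) < 1)
    (hR : 1 < V.valuation R) (n : ℕ) : ∀ L : Set ℝ,
    (∀ x ∈ L, ∀ y ∈ L, x ≠ y → ∃ k < n, ∃ X : ℤ, ¬ (p : ℤ) ∣ X ∧ x - y = R ^ (k + 1) * X / p) →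
    L.Finite := by
  have hp0 : (p : ℝ) ≠ 0 := by exact_mod_cast hp.ne_zero
  induction n with
  | zero =>
    intro L hL
    refine Set.Subsingleton.finite fun x hx y hy => ?_
    by_contra hxy
    obtain ⟨k, hk, -⟩ := hL x hx y hy hxy
    omega
  | succ n ih =>
    intro L hL
    rcases L.eq_empty_or_nonempty with rfl | ⟨x₀, hx₀⟩
    · exact Set.finite_empty
    -- Color x by the residue of X modulo p if x − x₀ has the top exponent, and by 0 otherwise.
    -- Points of equal color never differ with the top exponent: by the valuation for color 0, by
    -- the congruence for the others. The p color classes then fall under the induction hypothesis.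
    have hcol : ∀ x : ℝ, ∃ X : ℤ, x ∈ L → x ≠ x₀ →
        ((¬ (p : ℤ) ∣ X ∧ x - x₀ = R ^ (n + 1) * X / p) ∨
          (X = 0 ∧ ∃ k < n, ∃ Y : ℤ, ¬ (p : ℤ) ∣ Y ∧ x - x₀ = R ^ (k + 1) * Y / p)) := by
      intro x
      by_cases hx : x ∈ L ∧ x ≠ x₀
      · obtain ⟨k, hk, X, hX, he⟩ := hL x hx.1 x₀ hx₀ hx.2
        rcases Nat.lt_succ_iff_lt_or_eq.mp hk with hlt | rfl
        · exact ⟨0, fun _ _ => Or.inr ⟨rfl, k, hlt, X, hX, he⟩⟩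
        · exact ⟨X, fun _ _ => Or.inl ⟨hX, he⟩⟩
      · exact ⟨0, fun h1 h2 => (hx ⟨h1, h2⟩).elim⟩
    choose c hc using hcol
    have hpinst : NeZero p := ⟨hp.ne_zero⟩
    let c' : ℝ → ZMod p := fun x => if x = x₀ then 0 else (c x : ZMod p)
    have hval : ∀ (k : ℕ) (X : ℤ), ¬ (p : ℤ) ∣ X →
        V.valuation (R ^ (k + 1) * X / p) = V.valuation R ^ (k + 1) / V.valuation (p : ℝ) := by
      intro k X hX
      rw [map_div₀, map_mul, map_pow, valuation_intCast_eq_one hp hV hX, mul_one]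
    have hvp : 0 < V.valuation (p : ℝ) := (V.valuation.pos_iff).mpr hp0
    have hmonoval : ∀ k l : ℕ, k < l → V.valuation R ^ (k + 1) / V.valuation (p : ℝ)
        < V.valuation R ^ (l + 1) / V.valuation (p : ℝ) := fun k l hkl =>
      (div_lt_div_iff_of_pos_right hvp).mpr (pow_lt_pow_right₀ hR (by omega))
    refine Set.Finite.of_finite_fibers c' (Set.toFinite _) ?_
    rintro _ ⟨z, hz, rfl⟩
    refine ih _ ?_
    rintro x ⟨hx, hxz⟩ y ⟨hy, hyz⟩ hxy
    obtain ⟨k, hk, X, hX, he⟩ := hL x hx y hy hxy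
    rcases Nat.lt_succ_iff_lt_or_eq.mp hk with hlt | rfl
    · exact ⟨k, hlt, X, hX, he⟩
    exfalso
    have hcc : c' x = c' y := by
      rw [Set.mem_preimage, Set.mem_singleton_iff] at hxz hyz
      rw [hxz, hyz]
    -- the valuation of a point in the class of `x₀`
    have hsmall : ∀ w ∈ L, c' w = 0 →
        V.valuation (w - x₀) < V.valuation R ^ (k + 1) / V.valuation (p : ℝ) := by
      intro w hw h0
      by_cases hwx : w = x₀
      · rw [hwx, sub_self, map_zero]
        exact div_pos (pow_pos (zero_lt_one.trans hR) _) hvp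
      · simp only [c', if_neg hwx] at h0
        rcases hc w hw hwx with ⟨h1, -⟩ | ⟨-, l, hl, Y, hY, he'⟩
        · exact (h1 ((ZMod.intCast_zmod_eq_zero_iff_dvd _ _).mp h0)).elim
        · rw [he', hval l Y hY]
          exact hmonoval l k hl
    by_cases h0 : c' x = 0
    · have h1 := hsmall x hx h0
      have h2 := hsmall y hy (hcc ▸ h0)
      have h3 := V.valuation.map_sub (x - x₀) (y - x₀)
      rw [sub_sub_sub_cancel_right, he, hval k X hX] at h3
      exact absurd h3 (not_le.mpr (max_lt h1 h2))
    · have key : ∀ w ∈ L, c' w ≠ 0 → c' w = (c w : ZMod p) ∧ w - x₀ = R ^ (k + 1) * c w / p := by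
        intro w hw hw0
        by_cases hwx : w = x₀
        · exact (hw0 (by simp [c', hwx])).elim
        · refine ⟨by simp [c', hwx], ?_⟩
          rcases hc w hw hwx with ⟨-, h2⟩ | ⟨h2, -⟩
          · exact h2
          · exact (hw0 (by simp [c', hwx, h2])).elim
      obtain ⟨x1, x2⟩ := key x hx h0
      obtain ⟨y1, y2⟩ := key y hy (hcc ▸ h0)
      have hR0 : R ≠ 0 := fun h => by rw [h, map_zero] at hR; exact not_lt_zero hR
      have h4 : R ^ (k + 1) * (X : ℝ) = R ^ (k + 1) * ((c x - c y : ℤ) : ℝ) := by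
        have : x - y = (x - x₀) - (y - x₀) := by ring
        rw [he, x2, y2] at this
        field_simp at this
        push_cast
        rw [← this]
      have h5 : X = c x - c y := by
        exact_mod_cast mul_left_cancel₀ (pow_ne_zero _ hR0) h4
      refine hX ((ZMod.intCast_zmod_eq_zero_iff_dvd _ _).mp ?_)
      rw [h5, Int.cast_sub, ← x1, ← y1, hcc, sub_self]

/-- The exponents cannot be governed by a valuation at which `R` is large. -/
theorem not_one_lt_valuation {R : ℝ} (hR1 : 1 < R) {L : Set ℝ} (hL : L.Infinite)
    (h : ∀ x ∈ L, ∀ y ∈ L, x ≠ y → ∃ k : ℕ, ∃ X : ℤ, ¬ (p : ℤ) ∣ X ∧ x - y = R ^ (k + 1) * X / p)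
    {V : ValuationSubring ℝ} (hV : V.valuation (p : ℝ) < 1) : ¬ 1 < V.valuation R := by
  intro hR
  have hp0 : (0 : ℝ) < p := by exact_mod_cast hp.pos
  have hvp : 0 < V.valuation (p : ℝ) := (V.valuation.pos_iff).mpr hp0.ne'
  have hval : ∀ (k : ℕ) (X : ℤ), ¬ (p : ℤ) ∣ X →
      V.valuation (R ^ (k + 1) * X / p) = V.valuation R ^ (k + 1) / V.valuation (p : ℝ) := by
    intro k X hX
    rw [map_div₀, map_mul, map_pow, valuation_intCast_eq_one hp hV hX, mul_one]
  have hmono : ∀ k l : ℕ, V.valuation R ^ (k + 1) / V.valuation (p : ℝ)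
        ≤ V.valuation R ^ (l + 1) / V.valuation (p : ℝ) → k ≤ l := fun k l hkl => by
    by_contra! hlt
    exact absurd hkl (not_le.mpr
      ((div_lt_div_iff_of_pos_right hvp).mpr (pow_lt_pow_right₀ hR (by omega))))
  obtain ⟨x₀, hx₀, x₁, hx₁, hne⟩ := hL.nontrivial
  obtain ⟨k₁, X₁, hX₁, he₁⟩ := h x₁ hx₁ x₀ hx₀ hne.symm
  -- An infinite set has arbitrarily large exponents, so some z has v(z − x₀) > v(x₁ − x₀). Then z −
  -- x₀ and z − x₁ have the same large exponent l, and x₁ − x₀ is R^(l+1)/p times a nonzero integer.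
  -- This exceeds its absolute value.
  obtain ⟨n, hn⟩ := pow_unbounded_of_one_lt (|x₁ - x₀| * p) hR1
  have hlarge : ∃ x ∈ L, ∃ y ∈ L, x ≠ y ∧ ∃ k, max n (k₁ + 1) ≤ k ∧ ∃ X : ℤ, ¬ (p : ℤ) ∣ X ∧
      x - y = R ^ (k + 1) * X / p := by
    by_contra! hcon
    refine hL (finite_of_bounded_exponent hp hV hR (max n (k₁ + 1)) L fun x hx y hy hxy => ?_)
    obtain ⟨k, X, hX, he⟩ := h x hx y hy hxy
    exact ⟨k, not_le.mp fun hk => hcon x hx y hy hxy k hk X hX he, X, hX, he⟩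
  obtain ⟨x, hx, y, hy, hxy, k, hk, X, hX, he⟩ := hlarge
  have hz : ∃ z ∈ L, V.valuation R ^ (k + 1) / V.valuation (p : ℝ) ≤ V.valuation (z - x₀) := by
    have h3 := V.valuation.map_sub (x - x₀) (y - x₀)
    rw [sub_sub_sub_cancel_right, he, hval k X hX] at h3
    rcases le_max_iff.mp h3 with h4 | h4
    · exact ⟨x, hx, h4⟩
    · exact ⟨y, hy, h4⟩
  obtain ⟨z, hz, hzk⟩ := hz
  have hv1 : V.valuation (x₁ - x₀) < V.valuation (z - x₀) := by
    refine lt_of_lt_of_le ?_ hzk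
    rw [he₁, hval k₁ X₁ hX₁]
    exact (div_lt_div_iff_of_pos_right hvp).mpr (pow_lt_pow_right₀ hR (by omega))
  have hzx₀ : z ≠ x₀ := fun h => by
    rw [h, sub_self, map_zero] at hv1; exact not_lt_zero hv1
  have hzx₁ : z ≠ x₁ := fun h => by rw [h] at hv1; exact lt_irrefl _ hv1
  have hv2 : V.valuation (z - x₁) = V.valuation (z - x₀) := by
    rw [← sub_sub_sub_cancel_right z x₁ x₀]
    exact Valuation.map_sub_eq_of_lt_left _ hv1
  obtain ⟨l, Y, hY, heY⟩ := h z hz x₀ hx₀ hzx₀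
  obtain ⟨m, Z, hZ, heZ⟩ := h z hz x₁ hx₁ hzx₁
  have hlm : l = m := by
    rw [heY, heZ, hval l Y hY, hval m Z hZ] at hv2
    exact le_antisymm (hmono _ _ hv2.ge) (hmono _ _ hv2.le)
  subst hlm
  have hkl : k ≤ l := by
    rw [heY, hval l Y hY] at hzk
    exact hmono _ _ hzk
  have hd : x₁ - x₀ = R ^ (l + 1) * ((Y - Z : ℤ) : ℝ) / p := by
    have : x₁ - x₀ = (z - x₀) - (z - x₁) := by ring
    rw [this, heY, heZ]
    push_cast
    ring
  have hYZ : Y - Z ≠ 0 := fun h0 => by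
    rw [h0] at hd
    simp only [Int.cast_zero, mul_zero, zero_div] at hd
    exact hne (sub_eq_zero.mp hd).symm
  have h1 : (1 : ℝ) ≤ |((Y - Z : ℤ) : ℝ)| := by
    rw [← Int.cast_abs]
    exact_mod_cast Int.one_le_abs hYZ
  have hRpos : 0 < R := by linarith
  have h2 : |x₁ - x₀| * p = R ^ (l + 1) * |((Y - Z : ℤ) : ℝ)| := by
    rw [hd, abs_div, abs_mul, abs_of_pos hp0, abs_of_pos (pow_pos hRpos _)]
    field_simp
  have h3 : R ^ n ≤ R ^ (l + 1) := pow_le_pow_right₀ hR1.le (by omega)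
  nlinarith [pow_pos hRpos (l + 1)]

open Polynomial in
/-- The differences `R^(k+1) X / p` with `R` a unit at a suitable place above `p` are finite in
number. -/
theorem finite_of_ideals_eq_top {R : ℝ} (hR1 : 1 < R) {L : Set ℝ}
    (h : ∀ x ∈ L, ∀ y ∈ L, x ≠ y → ∃ k : ℕ, ∃ X : ℤ, ¬ (p : ℤ) ∣ X ∧ x - y = R ^ (k + 1) * X / p)
    {F₁ G₁ F₂ G₂ : ℤ[X]} (h₁ : aeval R F₁ * p + aeval R G₁ * R = 1)
    (h₂ : aeval R⁻¹ F₂ * p + aeval R⁻¹ G₂ * R⁻¹ = 1) : L.Finite := by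
  have hp0 : (p : ℝ) ≠ 0 := by exact_mod_cast hp.ne_zero
  have hR0 : R ≠ 0 := by positivity
  -- Take any place above p. The identity `h₁` excludes v(R) < 1 and `h₂` excludes v(R⁻¹) < 1, so R
  -- is a unit there.
  obtain ⟨V, -, hV⟩ := Ideal.image_subset_nonunits_valuationSubring
    (A := (Int.castRingHom ℝ).range) (Ideal.span {⟨(p : ℝ), ⟨(p : ℤ), by simp⟩⟩}) (by
      rw [Ne, Ideal.span_singleton_eq_top]
      rintro hu
      obtain ⟨⟨_, n, rfl⟩, hn⟩ := isUnit_iff_exists_inv.mp hu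
      have := congrArg Subtype.val hn
      simp only [Subring.coe_mul, Subring.coe_one, eq_intCast] at this
      have h2 : (p : ℤ) * n = 1 := by exact_mod_cast this
      exact (Nat.prime_iff_prime_int.mp hp).not_isUnit (IsUnit.of_mul_eq_one _ h2))
  have hvp : V.valuation (p : ℝ) < 1 := by
    rw [← V.mem_nonunits_iff]
    exact hV ⟨_, Ideal.mem_span_singleton_self _, rfl⟩
  have hpoly : ∀ (x : ℝ), V.valuation x ≤ 1 → ∀ P : ℤ[X], V.valuation (aeval x P) ≤ 1 := by
    intro x hx P
    have hx' := (V.valuation_le_one_iff x).mp hx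
    have e : aeval x P = ((aeval (⟨x, hx'⟩ : V) P : V) : ℝ) := by
      have := Polynomial.aeval_algebraMap_apply ℝ (⟨x, hx'⟩ : V) P
      exact this
    rw [e]
    exact (V.valuation_le_one_iff _).mpr (Subtype.property _)
  have hno : ∀ (x : ℝ) (F G : ℤ[X]), aeval x F * p + aeval x G * x = 1 →
      ¬ V.valuation x < 1 := by
    intro x F G hFG hx
    have h1 : V.valuation (aeval x F * p + aeval x G * x) < 1 := by
      refine (V.valuation.map_add _ _).trans_lt (max_lt ?_ ?_)
      · rw [map_mul]
        exact mul_lt_one_of_nonneg_of_lt_one_right (hpoly x hx.le F) zero_le hvp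
      · rw [map_mul]
        exact mul_lt_one_of_nonneg_of_lt_one_right (hpoly x hx.le G) zero_le hx
    rw [hFG, map_one] at h1
    exact lt_irrefl _ h1
  have hvR : V.valuation R = 1 := by
    refine le_antisymm (not_lt.mp fun hlt => hno R⁻¹ F₂ G₂ h₂ ?_) (not_lt.mp (hno R F₁ G₁ h₁))
    rw [map_inv₀]
    exact inv_lt_one_of_one_lt₀ hlt
  have hRV : R ∈ V := (V.valuation_le_one_iff R).mp hvR.le
  have hpV : (p : ℝ) ∈ V := natCast_mem V p
  set res := IsLocalRing.residue V with hres
  set κ := IsLocalRing.ResidueField V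
  have hchar : (p : κ) = 0 := by
    have : res ((p : ℕ) : V) = 0 := by
      rw [hres, IsLocalRing.residue_eq_zero_iff]
      have := (V.valuation_lt_one_iff ((p : ℕ) : V)).mpr (by simpa using hvp)
      exact this
    rwa [map_natCast] at this
  have hpf : Fact p.Prime := ⟨hp⟩
  have hCharP : CharP κ p := by
    obtain ⟨q, hq⟩ := CharP.exists κ
    rcases (Nat.dvd_prime hp).mp ((CharP.cast_eq_zero_iff κ q p).mp hchar) with rfl | rfl
    · exact (CharP.false_of_nontrivial_of_char_one (R := κ)).elim
    · exact hq
  let _ : Algebra (ZMod p) κ := ZMod.algebra κ p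
  set ρ : κ := res ⟨R, hRV⟩ with hρ
  -- Modulo the maximal ideal p vanishes and `h₁` becomes G₁(ρ) ρ = 1. The polynomial G₁ X − 1 has
  -- constant term −1, so ρ is algebraic over the prime field and generates a finite ring.
  have hunit : aeval ρ G₁ * ρ = 1 := by
    have e : aeval (⟨R, hRV⟩ : V) F₁ * ((p : ℕ) : V) + aeval (⟨R, hRV⟩ : V) G₁ * ⟨R, hRV⟩ = 1 := by
      apply Subtype.ext
      have e1 : ∀ P : ℤ[X], ((aeval (⟨R, hRV⟩ : V) P : V) : ℝ) = aeval R P := fun P =>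
        (Polynomial.aeval_algebraMap_apply ℝ (⟨R, hRV⟩ : V) P).symm
      push_cast
      rw [e1, e1]
      exact h₁
    have := congrArg res e
    rw [map_add, map_mul, map_mul, map_natCast, hchar, mul_zero, zero_add, map_one] at this
    rw [← this, hρ]
    congr 1
    exact Polynomial.aeval_algebraMap_apply κ (⟨R, hRV⟩ : V) G₁
  have halg : IsIntegral (ZMod p) ρ := by
    refine IsAlgebraic.isIntegral ⟨(G₁ * X - 1).map (Int.castRingHom (ZMod p)), fun h0 => ?_, ?_⟩
    · have := congrArg (fun P => P.coeff 0) h0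
      simp at this
    · have e : aeval ρ ((G₁ * X - 1 : ℤ[X]).map (Int.castRingHom (ZMod p)))
          = aeval ρ (G₁ * X - 1) := by
        rw [Polynomial.aeval_def, Polynomial.aeval_def, Polynomial.eval₂_map]
        congr 1
        exact RingHom.ext_int _ _
      rw [e]
      simp [hunit]
  have hfin : Finite (Algebra.adjoin (ZMod p) {ρ}) := by
    have h1 : Module.Finite (ZMod p) (Algebra.adjoin (ZMod p) {ρ}) :=
      Module.Finite.iff_fg.mpr halg.fg_adjoin_singleton
    exact Module.finite_of_finite (ZMod p)
  rcases L.eq_empty_or_nonempty with rfl | ⟨x₀, hx₀⟩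
  · exact Set.finite_empty
  have hmul : ∀ x ∈ L, ∀ y ∈ L, ∃ hm : (p : ℝ) * (x - y) ∈ V,
      res ⟨_, hm⟩ ∈ Algebra.adjoin (ZMod p) {ρ} ∧ (x ≠ y → res ⟨_, hm⟩ ≠ 0) := by
    intro x hx y hy
    by_cases hxy : x = y
    · subst hxy
      refine ⟨by rw [sub_self, mul_zero]; exact zero_mem _, ?_, fun h => (h rfl).elim⟩
      have : (⟨(p : ℝ) * (x - x), by rw [sub_self, mul_zero]; exact zero_mem _⟩ : V) = 0 := by
        apply Subtype.ext; simp
      rw [this, map_zero]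
      exact zero_mem _
    · obtain ⟨k, X, hX, he⟩ := h x hx y hy hxy
      have e : (p : ℝ) * (x - y) = R ^ (k + 1) * X := by rw [he]; field_simp
      have hm : R ^ (k + 1) * (X : ℝ) ∈ V := mul_mem (pow_mem hRV _) (intCast_mem V X)
      refine ⟨e ▸ hm, ?_, fun _ h0 => ?_⟩
      · have : (⟨(p : ℝ) * (x - y), e ▸ hm⟩ : V) = ⟨R, hRV⟩ ^ (k + 1) * (X : V) := by
          apply Subtype.ext; simp [e]
        rw [this, map_mul, map_pow, map_intCast]
        exact mul_mem (pow_mem (Algebra.self_mem_adjoin_singleton _ _) _) (intCast_mem _ X)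
      · rw [hres, IsLocalRing.residue_eq_zero_iff, V.valuation_lt_one_iff] at h0
        simp only [e] at h0
        rw [map_mul, map_pow, hvR, one_pow, one_mul, valuation_intCast_eq_one hp hvp hX] at h0
        exact lt_irrefl _ h0
  -- For x ≠ y, p(x − y) = R^(k+1) X is a unit at V, so distinct points have distinct residues in a
  -- finite ring.
  let c : L → Algebra.adjoin (ZMod p) {ρ} := fun x =>
    ⟨res ⟨_, (hmul x x.2 x₀ hx₀).1⟩, (hmul x x.2 x₀ hx₀).2.1⟩
  have hinj : Function.Injective c := by
    intro x y hxy
    by_contra hne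
    obtain ⟨hm, -, hm2⟩ := hmul x x.2 y y.2
    refine hm2 (fun h => hne (Subtype.ext h)) ?_
    have e : (⟨_, hm⟩ : V) = ⟨_, (hmul x x.2 x₀ hx₀).1⟩ - ⟨_, (hmul y y.2 x₀ hx₀).1⟩ := by
      apply Subtype.ext
      push_cast
      ring
    rw [e, map_sub, sub_eq_zero]
    exact congrArg Subtype.val hxy
  have := Finite.of_injective c hinj
  exact Set.toFinite L

open Polynomial in
/-- A place above `p` at which the expansion rate is small. -/
theorem exists_valuationSubring {R : ℝ} (hR1 : 1 < R) {L : Set ℝ} (hL : L.Infinite)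
    (h : ∀ x ∈ L, ∀ y ∈ L, x ≠ y → ∃ k : ℕ, ∃ X : ℤ, ¬ (p : ℤ) ∣ X ∧
      x - y = R ^ (k + 1) * X / p) :
    ∃ V : ValuationSubring ℝ, V.valuation (p : ℝ) < 1 ∧ V.valuation R < 1 := by
  -- If (p, x) is a proper ideal of ℤ[x], Chevalley's extension theorem provides a place where both
  -- are small; otherwise 1 lies in it. This is used for R and for R⁻¹.
  have key : ∀ x : ℝ, (∃ V : ValuationSubring ℝ, V.valuation (p : ℝ) < 1 ∧ V.valuation x < 1) ∨
      ∃ F G : ℤ[X], aeval x F * p + aeval x G * x = 1 := by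
    intro x
    set 𝒜 := (Algebra.adjoin ℤ ({x} : Set ℝ)).toSubring
    let P : 𝒜 := ⟨p, natCast_mem 𝒜 p⟩
    let Q : 𝒜 := ⟨x, Algebra.self_mem_adjoin_singleton ℤ x⟩
    by_cases hI : Ideal.span {P, Q} = ⊤
    · right
      obtain ⟨f, g, hfg⟩ := Ideal.mem_span_pair.mp ((Ideal.eq_top_iff_one _).mp hI)
      obtain ⟨f, hf⟩ := f
      obtain ⟨g, hg⟩ := g
      change f ∈ Algebra.adjoin ℤ {x} at hf
      change g ∈ Algebra.adjoin ℤ {x} at hg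
      have hfg' := congrArg Subtype.val hfg
      rw [Algebra.adjoin_singleton_eq_range_aeval] at hf hg
      obtain ⟨F, rfl⟩ := hf
      obtain ⟨G, rfl⟩ := hg
      exact ⟨F, G, hfg'⟩
    · left
      obtain ⟨V, -, hV⟩ := Ideal.image_subset_nonunits_valuationSubring _ hI
      refine ⟨V, ?_, ?_⟩
      · rw [← V.mem_nonunits_iff]
        exact hV ⟨P, Ideal.subset_span (by simp), rfl⟩
      · rw [← V.mem_nonunits_iff]
        exact hV ⟨Q, Ideal.subset_span (by simp), rfl⟩
  rcases key R with hV | ⟨F₁, G₁, h₁⟩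
  · exact hV
  rcases key R⁻¹ with ⟨V, hV1, hV2⟩ | ⟨F₂, G₂, h₂⟩
  · refine (not_one_lt_valuation hp hR1 hL h hV1 ?_).elim
    rw [map_inv₀] at hV2
    have h0 : 0 < V.valuation R := V.valuation.pos_iff.mpr (by positivity)
    exact (inv_lt_one₀ h0).mp hV2
  · exact (hL (finite_of_ideals_eq_top hp hR1 h h₁ h₂)).elim

end Valuation

/-! ### Integral eigenvectors and integrality of spectra -/

/-- An integral vector whose pairing with frequencies is scaled by `R` under the expansion. -/
structure Eigenfunctional (p : ℕ) (a : Fin 2 → ℤ) (A : Plane →L[ℝ] Plane) (u : Fin 2 → ℤ)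
    (R : ℝ) : Prop where
  one_lt : 1 < R
  scale : ∀ ξ, inner ℝ (A ξ) (digitVec u) = R * inner ℝ ξ (digitVec u)
  not_dvd : ¬ (p : ℤ) ∣ u 0 * a 0 + u 1 * a 1

namespace SelfAffineSystem

variable {p : ℕ} {D : Finset (Fin 2 → ℤ)} {a : Fin 2 → ℤ} {A B : Plane →L[ℝ] Plane}
  {μ : Measure Plane} (S : SelfAffineSystem p D a A B μ) {u : Fin 2 → ℤ} {R : ℝ}
  (U : Eigenfunctional p a A u R)

section Functional

include S U

theorem inner_B (ξ : Plane) : inner ℝ (B ξ) (digitVec u) = R⁻¹ * inner ℝ ξ (digitVec u) := by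
  have hR : R ≠ 0 := by linarith [U.one_lt]
  have := U.scale (B ξ)
  rw [S.right_inv] at this
  rw [this]
  field_simp

theorem inner_B_pow (k : ℕ) (ξ : Plane) :
    inner ℝ ((B ^ k) ξ) (digitVec u) = R⁻¹ ^ k * inner ℝ ξ (digitVec u) := by
  induction k generalizing ξ with
  | zero => simp
  | succ k ih => rw [pow_succ, mul_apply_eq_comp, ih, S.inner_B U, pow_succ]; ring

/-- For a zero n/p, a₀⟨n, u⟩ ≡ n₀⟨a, u⟩ modulo p, and the right side is prime to p. -/
theorem inner_of_mem_maskZeros {z : Plane} (hz : z ∈ maskZeros p a) :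
    ∃ X : ℤ, ¬ (p : ℤ) ∣ X ∧ inner ℝ z (digitVec u) = X / p := by
  have hp := S.p_pos
  obtain ⟨n, h1, h2, h3⟩ := hz
  refine ⟨u 0 * n 0 + u 1 * n 1, fun h => ?_, ?_⟩
  · obtain ⟨s, hs⟩ := h
    obtain ⟨t, ht⟩ := h2
    have : (p : ℤ) ∣ n 0 * (u 0 * a 0 + u 1 * a 1) :=
      ⟨s * a 0 + u 1 * t, by linear_combination hs * a 0 + u 1 * ht⟩
    exact (S.prime_int.dvd_or_dvd this).elim h1 U.not_dvd
  · have : (p : ℝ) * inner ℝ z (digitVec u) = inner ℝ (digitVec n) (digitVec u) := by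
      rw [← h3, inner_smul_left]; simp
    rw [inner_digitVec (digitVec n)] at this
    rw [eq_div_iff hp.ne', mul_comm, this]
    push_cast
    simp
    ring

theorem inner_of_pow_mem_maskZeros {k : ℕ} {z : Plane} (hz : (B ^ (k + 1)) z ∈ maskZeros p a) :
    ∃ X : ℤ, ¬ (p : ℤ) ∣ X ∧ inner ℝ z (digitVec u) = R ^ (k + 1) * X / p := by
  have hR : R ≠ 0 := by linarith [U.one_lt]
  obtain ⟨X, hX, he⟩ := S.inner_of_mem_maskZeros U hz
  refine ⟨X, hX, ?_⟩
  rw [S.inner_B_pow U] at he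
  rw [mul_div_assoc, ← he, ← mul_assoc, ← mul_pow, mul_inv_cancel₀ hR, one_pow, one_mul]

end Functional

/-- A subgroup separating the first digit of differences from the later ones. -/
structure ClassSubgroup (p : ℕ) (a : Fin 2 → ℤ) (B : Plane →L[ℝ] Plane)
    (G : AddSubgroup Plane) : Prop where
  first : ∀ z, B z ∈ maskZeros p a → z ∉ G
  later : ∀ (k : ℕ) (z), (B ^ (k + 2)) z ∈ maskZeros p a → z ∈ G

-- Pairing with u is injective on Λ, so `exists_valuationSubring` provides v with v(p), v(R) < 1. A
-- difference separated at level k has valuation v(R)^(k+1) / v(p), strictly decreasing in k. The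
-- ball of radius v(R)² / v(p) therefore contains all levels k ≥ 1 and avoids level 0.
include S U in
theorem exists_classSubgroup {Λ : Set Plane} (hΛ : IsSpectrum p a B μ Λ) :
    ∃ G, ClassSubgroup p a B G := by
  have hp := S.p_pos
  have hR : R ≠ 0 := by linarith [U.one_lt]
  have hinj : Set.InjOn (fun z : Plane => (inner ℝ z (digitVec u) : ℝ)) Λ := by
    intro x hx y hy hxy
    by_contra hne
    obtain ⟨k, hk⟩ := hΛ.zeros x hx y hy hne
    obtain ⟨X, hX, he⟩ := S.inner_of_pow_mem_maskZeros U hk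
    have h0 : (X : ℝ) = 0 := by
      simp only at hxy
      rw [inner_sub_left, hxy, sub_self, eq_comm, div_eq_zero_iff, or_iff_left hp.ne',
        mul_eq_zero, or_iff_right (pow_ne_zero _ hR)] at he
      exact he
    exact hX (by rw [Int.cast_eq_zero.mp h0]; exact dvd_zero _)
  obtain ⟨V, hVp, hVR⟩ := exists_valuationSubring S.prime U.one_lt
    ((S.spectrum_infinite hΛ).image hinj) (by
      rintro _ ⟨x, hx, rfl⟩ _ ⟨y, hy, rfl⟩ hxy
      obtain ⟨k, hk⟩ := hΛ.zeros x hx y hy fun h => hxy (by rw [h])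
      obtain ⟨X, hX, he⟩ := S.inner_of_pow_mem_maskZeros U hk
      exact ⟨k, X, hX, by rw [← he, inner_sub_left]⟩)
  have hvp : 0 < V.valuation (p : ℝ) := (V.valuation.pos_iff).mpr hp.ne'
  have hvR : 0 < V.valuation R := (V.valuation.pos_iff).mpr hR
  have hval : ∀ (k : ℕ) (z : Plane), (B ^ (k + 1)) z ∈ maskZeros p a →
      V.valuation (inner ℝ z (digitVec u)) = V.valuation R ^ (k + 1) / V.valuation (p : ℝ) := by
    intro k z hz
    obtain ⟨X, hX, he⟩ := S.inner_of_pow_mem_maskZeros U hz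
    rw [he, map_div₀, map_mul, map_pow, valuation_intCast_eq_one S.prime hVp hX, mul_one]
  let G : AddSubgroup Plane :=
    { carrier := {z | V.valuation (inner ℝ z (digitVec u))
        ≤ V.valuation R ^ 2 / V.valuation (p : ℝ)}
      zero_mem' := by simp
      add_mem' := by
        intro x y hx hy
        simp only [Set.mem_ofPred_eq] at hx hy ⊢
        rw [inner_add_left]
        exact (V.valuation.map_add _ _).trans (max_le hx hy)
      neg_mem' := by
        intro x hx
        simp only [Set.mem_ofPred_eq] at hx ⊢
        rwa [inner_neg_left, Valuation.map_neg] }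
  have hmem : ∀ z, z ∈ G ↔
      V.valuation (inner ℝ z (digitVec u)) ≤ V.valuation R ^ 2 / V.valuation (p : ℝ) := fun z => by
    rw [← AddSubgroup.mem_carrier]
    exact Set.mem_ofPred
  refine ⟨G, fun z hz hG => ?_, fun k z hz => ?_⟩
  · have h1 := hval 0 z (by simpa using hz)
    rw [hmem, h1, div_le_div_iff_of_pos_right hvp, zero_add, pow_one, sq] at hG
    exact absurd hG (not_le.mpr (mul_lt_of_lt_one_left hvR hVR))
  · have h1 := hval (k + 1) z hz
    rw [hmem, h1, div_le_div_iff_of_pos_right hvp]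
    exact pow_le_pow_right_of_le_one' hVR.le (by omega)

/-! ### Integrality by repeated renormalization -/

section Descent

variable {Λ : Set Plane} (hΛ : IsSpectrum p a B μ Λ) {G : AddSubgroup Plane}
  (hG : ClassSubgroup p a B G)
include S hΛ hG

/-- A separation at a positive level puts x and y in one class, whose B-image is a spectrum where
the level has dropped by one. `integer_of_class` is applied once per level. -/
theorem integer_of_pow_mem {x y : Plane} (hx : x ∈ Λ) (hy : y ∈ Λ) {k j : ℕ}
    (hk : (B ^ (k + 1)) (x - y) ∈ maskZeros p a) (hj : j < k) :
    (B ^ (j + 1)) (x - y) ∈ integerPoints := by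
  induction j generalizing Λ x y k with
  | zero =>
    obtain ⟨m, rfl⟩ : ∃ m, k = m + 1 := ⟨k - 1, by omega⟩
    simpa using S.integer_of_class hΛ hG.first hG.later hy hx (hG.later m _ hk)
  | succ j ih =>
    obtain ⟨m, rfl⟩ : ∃ m, k = m + 1 := ⟨k - 1, by omega⟩
    have hxy : x - y ∈ G := hG.later m _ hk
    have h := ih (S.isSpectrum_class hΛ hG.first hG.later hy) (x := B x) (y := B y) (k := m)
      ⟨x, ⟨hx, hxy⟩, rfl⟩ ⟨y, ⟨hy, by rw [sub_self]; exact zero_mem _⟩, rfl⟩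
      (by rwa [← map_sub, ← mul_apply_eq_comp, ← pow_succ]) (by omega)
    rwa [← map_sub, ← mul_apply_eq_comp, ← pow_succ] at h

/-- One renormalization step makes the differences integral. -/
theorem exists_isSpectrum_integer : ∃ Λ', IsSpectrum p a B μ Λ' ∧
    (∀ x ∈ Λ', ∀ y ∈ Λ', x - y ∈ integerPoints) ∧
    (∀ x ∈ Λ', ∀ y ∈ Λ', ∃ x' ∈ Λ, ∃ y' ∈ Λ, A (x - y) = x' - y') := by
  obtain ⟨x₀, hx₀⟩ := hΛ.nonempty
  refine ⟨_, S.isSpectrum_class hΛ hG.first hG.later hx₀, ?_, ?_⟩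
  · rintro _ ⟨x, ⟨hx, hxG⟩, rfl⟩ _ ⟨y, ⟨hy, hyG⟩, rfl⟩
    rw [← map_sub]
    refine S.integer_of_class hΛ hG.first hG.later hy hx ?_
    have := sub_mem hxG hyG
    rwa [sub_sub_sub_cancel_right] at this
  · rintro _ ⟨x, ⟨hx, -⟩, rfl⟩ _ ⟨y, ⟨hy, -⟩, rfl⟩
    exact ⟨x, hx, y, hy, by rw [← map_sub, S.right_inv]⟩

/-- Two integral conditions satisfied by some zero of the mask. -/
theorem exists_zero_integer : ∃ z ∈ maskZeros p a, A z ∈ integerPoints ∧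
    A (A z) ∈ integerPoints := by
  -- Take z = B(y − x) with x, y in Λ₂. Then Az is a difference in Λ₂ and A²z a difference in Λ₁,
  -- both integral.
  obtain ⟨Λ₁, h₁, hint₁, -⟩ := S.exists_isSpectrum_integer hΛ hG
  obtain ⟨Λ₂, h₂, hint₂, hA⟩ := S.exists_isSpectrum_integer h₁ hG
  obtain ⟨x, hx⟩ := h₂.nonempty
  obtain ⟨y, hy, hz⟩ := S.exists_sub_mem_maskZeros h₂ hG.first hG.later hx
  refine ⟨_, hz, by rw [S.right_inv]; exact hint₂ y hy x hx, ?_⟩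
  rw [S.right_inv]
  obtain ⟨x', hx', y', hy', he⟩ := hA y hy x hx
  rw [he]
  exact hint₁ x' hx' y' hy'

end Descent

/-- Differences are integral up to their last digit, where the functional is large. -/
def IsSparse (p : ℕ) (a : Fin 2 → ℤ) (B : Plane →L[ℝ] Plane) (u : Fin 2 → ℤ) (q K t : ℕ)
    (Λ : Set Plane) : Prop :=
  ∀ x ∈ Λ, ∀ y ∈ Λ, x ≠ y → ∃ k < K, (∀ j < k, (B ^ (j + 1)) (x - y) ∈ integerPoints) ∧
    (B ^ (k + 1)) (x - y) ∈ maskZeros p a ∧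
    (q : ℝ) ^ (k + 1 + t) / p ≤ |inner ℝ ((B ^ (k + 1)) (x - y)) (digitVec u)|

theorem IsSparse.mono {q K t : ℕ} {Λ Λ' : Set Plane} (h : IsSparse p a B u q K t Λ)
    (hs : Λ' ⊆ Λ) : IsSparse p a B u q K t Λ' :=
  fun x hx y hy hxy => h x (hs hx) y (hs hy) hxy

/-- Applying B drops one digit. Levels fall by one, and the exponent k + 1 + t of the lower bound is
preserved by raising t. -/
theorem IsSparse.image {q K t : ℕ} {Λ : Set Plane} (h : IsSparse p a B u q K t Λ)
    (hs : ∀ x ∈ Λ, ∀ y ∈ Λ, B (x - y) ∉ maskZeros p a) :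
    IsSparse p a B u q (K - 1) (t + 1) (B '' Λ) := by
  rintro _ ⟨x, hx, rfl⟩ _ ⟨y, hy, rfl⟩ hne
  obtain ⟨k, hk, h1, h2, h3⟩ := h x hx y hy fun h => hne (by rw [h])
  cases k with
  | zero => exact (hs x hx y hy (by simpa using h2)).elim
  | succ k =>
    have e : ∀ j : ℕ, (B ^ (j + 1)) (B x - B y) = (B ^ (j + 1 + 1)) (x - y) := fun j => by
      rw [← map_sub, ← mul_apply_eq_comp, ← pow_succ]
    refine ⟨k, by omega, fun j hj => ?_, ?_, ?_⟩
    · rw [e]; exact h1 _ (by omega)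
    · rw [e]; exact h2
    · rw [e]
      convert h3 using 3
      ring

include S U in
/-- For a rational expansion rate `m / q` there are spectra as sparse as desired. -/
theorem exists_isSparse {Λ : Set Plane} (hΛ : IsSpectrum p a B μ Λ) {m q : ℤ} (hq : 0 < q)
    (hcop : IsCoprime m q) (hR : R = m / q) (t : ℕ) :
    ∃ Λ' : Set Plane, IsSpectrum p a B μ Λ' ∧ ∀ F : Finset Plane, (F : Set Plane) ⊆ Λ' →
      ∃ K, IsSparse p a B u q.toNat K t F := by
  classical
  have hp := S.p_pos
  obtain ⟨G, hG⟩ := S.exists_classSubgroup U hΛ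
  have hqR : (0 : ℝ) < q := by exact_mod_cast hq
  have hqc : ((q.toNat : ℕ) : ℝ) = q := by exact_mod_cast Int.toNat_of_nonneg hq.le
  suffices h : ∃ Λ' : Set Plane, IsSpectrum p a B μ Λ' ∧ ∀ x ∈ Λ', ∀ y ∈ Λ', x ≠ y →
      ∃ k, (∀ j < k, (B ^ (j + 1)) (x - y) ∈ integerPoints) ∧
      (B ^ (k + 1)) (x - y) ∈ maskZeros p a ∧
      (q.toNat : ℝ) ^ (k + 1 + t) / p ≤ |inner ℝ ((B ^ (k + 1)) (x - y)) (digitVec u)| by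
    obtain ⟨Λ', h1, h2⟩ := h
    refine ⟨Λ', h1, fun F hF => ?_⟩
    choose! k hk using h2
    refine ⟨(F ×ˢ F).sup (fun q => k q.1 q.2) + 1, fun x hx y hy hxy =>
      ⟨k x y, ?_, hk x (hF hx) y (hF hy) hxy⟩⟩
    exact Nat.lt_succ_of_le (Finset.le_sup (f := fun q : Plane × Plane => k q.1 q.2)
      (Finset.mk_mem_product hx hy))
  induction t with
  | zero =>
    obtain ⟨Λ', h1, h2, -⟩ := S.exists_isSpectrum_integer hΛ hG
    refine ⟨Λ', h1, fun x hx y hy hxy => ?_⟩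
    obtain ⟨k, hk⟩ := h1.zeros x hx y hy hxy
    refine ⟨k, fun j hj => S.integer_of_pow_mem h1 hG hx hy hk hj, hk, ?_⟩
    obtain ⟨X, hX, he⟩ := S.inner_of_mem_maskZeros U hk
    obtain ⟨n, hn⟩ := h2 x hx y hy
    have h3 : inner ℝ (x - y) (digitVec u) = ((n 0 * u 0 + n 1 * u 1 : ℤ) : ℝ) := by
      rw [← hn, inner_digitVec]; push_cast; simp
    set N := n 0 * u 0 + n 1 * u 1
    rw [S.inner_B_pow U, h3, hR] at he
    have hm : (m : ℝ) ≠ 0 := fun h0 => by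
      have := U.one_lt; rw [hR, h0] at this; norm_num at this
    -- Integrality of ⟨x − y, u⟩ with R = m/q makes q^(k+1) divide the nonzero integer X. This gives
    -- sparsity with t = 0; each later renormalization raises t by one.
    have h4 : m ^ (k + 1) * X = q ^ (k + 1) * (p * N) := by
      have : (m : ℝ) ^ (k + 1) * X = q ^ (k + 1) * (p * N) := by
        rw [inv_div, div_pow] at he
        field_simp at he
        linarith
      exact_mod_cast this
    have h5 : q ^ (k + 1) ∣ X :=
      (hcop.symm.pow : IsCoprime (q ^ (k + 1)) (m ^ (k + 1))).dvd_of_dvd_mul_left ⟨_, h4⟩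
    have hX0 : X ≠ 0 := fun h0 => hX (by rw [h0]; exact dvd_zero _)
    have h6 : q ^ (k + 1) ≤ |X| := Int.le_of_dvd (abs_pos.mpr hX0) ((dvd_abs _ _).mpr h5)
    obtain ⟨X', hX', he'⟩ := S.inner_of_mem_maskZeros U hk
    rw [S.inner_B_pow U, h3, hR, he, abs_div, abs_of_pos hp, hqc, add_zero]
    refine div_le_div_of_nonneg_right ?_ hp.le
    exact_mod_cast h6
  | succ t ih =>
    obtain ⟨Λ₀, h1, h2⟩ := ih
    obtain ⟨x₀, hx₀⟩ := h1.nonempty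
    refine ⟨_, S.isSpectrum_class h1 hG.first hG.later hx₀, ?_⟩
    rintro _ ⟨x, ⟨hx, hxG⟩, rfl⟩ _ ⟨y, ⟨hy, hyG⟩, rfl⟩ hne
    obtain ⟨k, hk1, hk2, hk3⟩ := h2 x hx y hy fun h => hne (by rw [h])
    cases k with
    | zero =>
      refine (hG.first (x - y) (by simpa using hk2) ?_).elim
      have := sub_mem hxG hyG
      rwa [sub_sub_sub_cancel_right] at this
    | succ k =>
      have e : ∀ j : ℕ, (B ^ (j + 1)) (B x - B y) = (B ^ (j + 1 + 1)) (x - y) := fun j => by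
        rw [← map_sub, ← mul_apply_eq_comp, ← pow_succ]
      refine ⟨k, fun j hj => ?_, ?_, ?_⟩
      · rw [e]; exact hk1 _ (by omega)
      · rw [e]; exact hk2
      · rw [e]
        convert hk3 using 3
        ring

end SelfAffineSystem

/-! ### Sparse frequencies do not span -/

namespace SelfAffineSystem

variable {p : ℕ} {D : Finset (Fin 2 → ℤ)} {a : Fin 2 → ℤ} {A B : Plane →L[ℝ] Plane}
  {μ : Measure Plane} (S : SelfAffineSystem p D a A B μ) {u : Fin 2 → ℤ} {R : ℝ}
  (U : Eigenfunctional p a A u R)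

include S U

/-- If |mask| exceeded κ at all levels of the window, the numbers N⟨B^(j+1) η, u⟩ would lie near
integers n_j with m n_(j+1) = q n_j. The last n_j would then be a nonzero multiple of q^(τ + j₀),
too large for the upper end of the window. -/
theorem exists_norm_mask_le_of_window {m q : ℤ} (hq : 2 ≤ q) (hm : 0 < m) (hcop : IsCoprime m q)
    (hR : R = m / q) : ∃ κ : ℝ, 0 < κ ∧ κ < 1 ∧ ∃ j₀ : ℕ, ∀ (τ : ℕ) (η : Plane),
      R ^ (τ + j₀ + 1) * (q : ℝ) ^ τ ≤ |inner ℝ η (digitVec u)| →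
      |inner ℝ η (digitVec u)| < R * (R ^ (τ + j₀ + 1) * (q : ℝ) ^ τ) →
      ∃ j < τ + j₀ + 1, ‖mask D ((B ^ (j + 1)) η)‖ ≤ κ := by
  obtain ⟨N, hN, hmask⟩ := S.exists_norm_mask_le u
  have hq0 : (0 : ℝ) < q := by exact_mod_cast (by omega : 0 < q)
  have hm0 : (0 : ℝ) < m := by exact_mod_cast hm
  have hR0 : 0 < R := by linarith [U.one_lt]
  have hN1 : (1 : ℝ) ≤ |(N : ℝ)| := by
    rw [← Int.cast_abs]; exact_mod_cast Int.one_le_abs hN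
  -- With this tolerance the integer m n_(j+1) − q n_j has absolute value at most (m + q)c = 1/2,
  -- hence is zero.
  set c : ℝ := 1 / (2 * (m + q)) with hc
  have hc0 : 0 < c := by positivity
  have hc1 : c < 1 := by
    rw [hc, div_lt_one (by positivity)]
    have : (2 : ℝ) ≤ q := by exact_mod_cast hq
    linarith
  obtain ⟨κ, hκ0, hκ1, hκ⟩ := hmask c hc0
  have hq1 : (1 : ℝ) < q := by exact_mod_cast (by omega : 1 < q)
  obtain ⟨j₀, hj₀⟩ := pow_unbounded_of_one_lt (|(N : ℝ)| * R + 1) hq1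
  refine ⟨κ, hκ0, hκ1, j₀, fun τ η h1 h2 => ?_⟩
  by_contra! hcon
  have hex : ∀ j : ℕ, ∃ n : ℤ, j < τ + j₀ + 1 →
      |N * inner ℝ ((B ^ (j + 1)) η) (digitVec u) - n| < c := by
    intro j
    by_cases hj : j < τ + j₀ + 1
    · by_contra! hcon'
      have := hκ ((B ^ (j + 1)) η) fun n => (hcon' n).2
      exact absurd this (not_le.mpr (hcon j hj))
    · exact ⟨0, fun h => (hj h).elim⟩
  choose n hn using hex
  set x : ℝ := inner ℝ η (digitVec u) with hx
  have hrec : ∀ j, j + 1 < τ + j₀ + 1 → m * n (j + 1) = q * n j := by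
    intro j hj
    have e1 := hn j (by omega)
    have e2 := hn (j + 1) hj
    rw [S.inner_B_pow U, ← hx] at e1 e2
    have e3 : (m : ℝ) * (N * (R⁻¹ ^ (j + 1 + 1) * x)) = q * (N * (R⁻¹ ^ (j + 1) * x)) := by
      rw [pow_succ R⁻¹ (j + 1)]
      have : (m : ℝ) * R⁻¹ = q := by rw [hR]; field_simp
      linear_combination (N * (R⁻¹ ^ (j + 1) * x)) * this
    have e4 : |((m * n (j + 1) - q * n j : ℤ) : ℝ)| < 1 := by
      have : ((m * n (j + 1) - q * n j : ℤ) : ℝ)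
          = q * (N * (R⁻¹ ^ (j + 1) * x) - n j)
            - m * (N * (R⁻¹ ^ (j + 1 + 1) * x) - n (j + 1)) := by
        push_cast
        linear_combination e3
      rw [this]
      calc _ ≤ |q * (N * (R⁻¹ ^ (j + 1) * x) - n j)|
            + |m * (N * (R⁻¹ ^ (j + 1 + 1) * x) - n (j + 1))| := abs_sub _ _
        _ ≤ q * c + m * c := by
          rw [abs_mul, abs_mul, abs_of_pos hq0, abs_of_pos hm0]
          exact add_le_add (mul_le_mul_of_nonneg_left e1.le hq0.le)
            (mul_le_mul_of_nonneg_left e2.le hm0.le)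
        _ = 1 / 2 := by rw [hc]; field_simp; ring
        _ < 1 := by norm_num
    have e5 : |m * n (j + 1) - q * n j| < 1 := by exact_mod_cast e4
    have := Int.abs_lt_one_iff.mp e5
    linarith
  have hpow : ∀ i, i < τ + j₀ + 1 → m ^ i * n i = q ^ i * n 0 := by
    intro i
    induction i with
    | zero => simp
    | succ i ih =>
      intro hi
      have h3 := hrec i hi
      have h4 := ih (by omega)
      rw [pow_succ, pow_succ]
      linear_combination m ^ i * h3 + q * h4
  have hdvd : q ^ (τ + j₀) ∣ n (τ + j₀) :=
    (hcop.symm.pow : IsCoprime (q ^ (τ + j₀)) (m ^ (τ + j₀))).dvd_of_dvd_mul_left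
      ⟨_, hpow (τ + j₀) (by omega)⟩
  have hlast := hn (τ + j₀) (by omega)
  rw [S.inner_B_pow U, ← hx] at hlast
  have hRJ : 0 < R ^ (τ + j₀ + 1) := pow_pos hR0 _
  have habs : |N * (R⁻¹ ^ (τ + j₀ + 1) * x)| = |(N : ℝ)| * (|x| / R ^ (τ + j₀ + 1)) := by
    rw [abs_mul, abs_mul, inv_pow, abs_of_pos (inv_pos.mpr hRJ), div_eq_inv_mul]
  have hqτ : (1 : ℝ) ≤ (q : ℝ) ^ τ := one_le_pow₀ hq1.le
  have hlow : (q : ℝ) ^ τ ≤ |x| / R ^ (τ + j₀ + 1) := by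
    rw [le_div_iff₀ hRJ, mul_comm]; exact h1
  have hup : |x| / R ^ (τ + j₀ + 1) < R * (q : ℝ) ^ τ := by
    rw [div_lt_iff₀ hRJ]
    calc |x| < _ := h2
      _ = _ := by ring
  have hne : n (τ + j₀) ≠ 0 := by
    intro h0
    rw [h0, Int.cast_zero, sub_zero, habs] at hlast
    nlinarith
  have hbig : (q : ℝ) ^ (τ + j₀) ≤ |(n (τ + j₀) : ℝ)| := by
    have : q ^ (τ + j₀) ≤ |n (τ + j₀)| := Int.le_of_dvd (abs_pos.mpr hne) ((dvd_abs _ _).mpr hdvd)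
    rw [← Int.cast_abs]
    exact_mod_cast this
  have hsmall : |(n (τ + j₀) : ℝ)| < |(N : ℝ)| * (R * (q : ℝ) ^ τ) + 1 := by
    have h3 : |(n (τ + j₀) : ℝ)| ≤ |N * (R⁻¹ ^ (τ + j₀ + 1) * x)|
        + |N * (R⁻¹ ^ (τ + j₀ + 1) * x) - n (τ + j₀)| := by
      have := abs_sub_abs_le_abs_sub (n (τ + j₀) : ℝ) (N * (R⁻¹ ^ (τ + j₀ + 1) * x))
      rw [abs_sub_comm] at this
      linarith
    rw [habs] at h3
    have h4 : |(N : ℝ)| * (|x| / R ^ (τ + j₀ + 1)) ≤ |(N : ℝ)| * (R * (q : ℝ) ^ τ) :=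
      mul_le_mul_of_nonneg_left hup.le (abs_nonneg _)
    linarith
  have hfin : |(N : ℝ)| * (R * (q : ℝ) ^ τ) + 1 ≤ (q : ℝ) ^ (τ + j₀) := by
    rw [pow_add]
    nlinarith
  linarith

/-- One step of the logarithmic decay of the Fourier transform. -/
theorem exists_decay_step {m q : ℤ} (hq : 2 ≤ q) (hm : 0 < m) (hcop : IsCoprime m q)
    (hR : R = m / q) : ∃ κ : ℝ, 0 < κ ∧ κ < 1 ∧ ∃ h : ℕ, 1 ≤ h ∧ ∀ (τ : ℕ) (b : ℝ),
      (∀ η : Plane, (q : ℝ) ^ τ ≤ |inner ℝ η (digitVec u)| → ‖fourierTransform μ η‖ ≤ b) →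
      ∀ η : Plane, (q : ℝ) ^ (h * (τ + 1)) ≤ |inner ℝ η (digitVec u)| →
        ‖fourierTransform μ η‖ ≤ κ * b := by
  obtain ⟨κ, hκ0, hκ1, j₀, hwin⟩ := S.exists_norm_mask_le_of_window U hq hm hcop hR
  have hq1 : (1 : ℝ) < q := by exact_mod_cast (by omega : 1 < q)
  have hR1 := U.one_lt
  have hR0 : 0 < R := by linarith
  obtain ⟨h₀, hh₀⟩ := pow_unbounded_of_one_lt R hq1
  -- Since R < q^(h₀), this h guarantees that q^(h(τ+1)) exceeds the lower end Y of the window.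
  refine ⟨κ, hκ0, hκ1, h₀ * (j₀ + 1) + h₀ + 1, by omega, fun τ b hb η hη => ?_⟩
  set Y : ℝ := R ^ (τ + j₀ + 1) * (q : ℝ) ^ τ with hY
  have hq0 : (0 : ℝ) < q := by linarith
  have hY0 : 0 < Y := by positivity
  have hYle : Y ≤ |inner ℝ η (digitVec u)| := by
    refine le_trans ?_ hη
    calc Y ≤ ((q : ℝ) ^ h₀) ^ (τ + j₀ + 1) * (q : ℝ) ^ τ :=
          mul_le_mul_of_nonneg_right (pow_le_pow_left₀ hR0.le hh₀.le _) (by positivity)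
      _ = (q : ℝ) ^ (h₀ * (τ + j₀ + 1) + τ) := by rw [← pow_mul, ← pow_add]
      _ ≤ _ := pow_le_pow_right₀ hq1.le (by
          have : 0 ≤ h₀ * j₀ * τ := Nat.zero_le _
          nlinarith)
  -- Divide by powers of R until the pairing lies in [Y, RY). One of the next τ + j₀ + 1 mask
  -- factors is at most κ, and after them the pairing is still at least q^τ.
  obtain ⟨i, hi1, hi2⟩ := exists_nat_pow_near (x := |inner ℝ η (digitVec u)| / Y)
    ((one_le_div hY0).mpr hYle) hR1
  have hRi : 0 < R ^ i := pow_pos hR0 i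
  have hφ : |inner ℝ ((B ^ i) η) (digitVec u)| = |inner ℝ η (digitVec u)| / R ^ i := by
    rw [S.inner_B_pow U, abs_mul, inv_pow, abs_of_pos (inv_pos.mpr hRi), div_eq_inv_mul]
  rw [le_div_iff₀ hY0] at hi1
  rw [div_lt_iff₀ hY0] at hi2
  have hw1 : Y ≤ |inner ℝ ((B ^ i) η) (digitVec u)| := by
    rw [hφ, le_div_iff₀ hRi]; linarith
  have hw2 : |inner ℝ ((B ^ i) η) (digitVec u)| < R * Y := by
    rw [hφ, div_lt_iff₀ hRi]
    rw [pow_succ] at hi2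
    linarith
  obtain ⟨j, hj, hjκ⟩ := hwin τ ((B ^ i) η) hw1 hw2
  refine (S.norm_fourierTransform_le_pow i η).trans ?_
  set η' := (B ^ i) η
  rw [S.fourierTransform_eq_partialProduct (τ + j₀ + 1) η', norm_mul]
  refine mul_le_mul ?_ (hb _ ?_) (norm_nonneg _) hκ0.le
  · rw [partialProduct, norm_prod, ← Finset.mul_prod_erase _ _ (Finset.mem_range.mpr hj)]
    refine le_trans (mul_le_of_le_one_right (norm_nonneg _) ?_) hjκ
    exact Finset.prod_le_one (fun _ _ => norm_nonneg _) fun _ _ => S.norm_mask_le _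
  · have hRJ : 0 < R ^ (τ + j₀ + 1) := pow_pos hR0 _
    rw [S.inner_B_pow U, abs_mul, inv_pow, abs_of_pos (inv_pos.mpr hRJ), ← div_eq_inv_mul,
      le_div_iff₀ hRJ, mul_comm]
    exact hw1

/-- Logarithmic decay of the Fourier transform for non-integral expansion rates. -/
theorem exists_decay {m q : ℤ} (hq : 2 ≤ q) (hm : 0 < m) (hcop : IsCoprime m q)
    (hR : R = m / q) : ∃ C γ : ℝ, 0 < C ∧ 0 < γ ∧ ∀ (τ : ℕ) (η : Plane),
      (q : ℝ) ^ τ ≤ |inner ℝ η (digitVec u)| →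
      ‖fourierTransform μ η‖ ≤ C * ((τ : ℝ) + 1) ^ (-γ) := by
  have := S.prob
  obtain ⟨κ, hκ0, hκ1, h, hh, hstep⟩ := S.exists_decay_step U hq hm hcop hR
  have hq1 : (1 : ℝ) < q := by exact_mod_cast (by omega : 1 < q)
  have hhR : (1 : ℝ) ≤ h := by exact_mod_cast hh
  have h2h : (1 : ℝ) < 2 * h := by linarith
  -- Chosen so that κ (2h)^γ = 1. One step gains κ and passes from τ to a σ with σ + 1 ≥ (τ +
  -- 1)/(2h), so the power law reproduces itself. C covers the initial range τ < 4h.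
  set γ : ℝ := -Real.log κ / Real.log (2 * h) with hγ
  have hlog : 0 < Real.log (2 * h) := Real.log_pos h2h
  have hγ0 : 0 < γ := div_pos (neg_pos.mpr (Real.log_neg hκ0 hκ1)) hlog
  have hκγ : κ * (2 * h : ℝ) ^ γ = 1 := by
    rw [Real.rpow_def_of_pos (by linarith), hγ, mul_div_cancel₀ _ hlog.ne', Real.exp_neg,
      Real.exp_log hκ0, mul_inv_cancel₀ hκ0.ne']
  set C : ℝ := (4 * h + 1 : ℝ) ^ γ with hC
  have hC0 : 0 < C := by positivity
  refine ⟨C, γ, hC0, hγ0, fun τ => ?_⟩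
  induction τ using Nat.strong_induction_on with
  | _ τ ih =>
    intro η hη
    rcases lt_or_ge τ (4 * h) with hlt | hge
    · refine (norm_fourierTransform_le μ η).trans ?_
      rw [Real.rpow_neg (by positivity), ← div_eq_mul_inv, one_le_div (by positivity)]
      refine Real.rpow_le_rpow (by positivity) ?_ hγ0.le
      have : (τ : ℝ) ≤ 4 * h := by exact_mod_cast hlt.le
      linarith
    · set σ := τ / h - 1 with hσ
      have hdiv : 4 ≤ τ / h := (Nat.le_div_iff_mul_le hh).mpr (by linarith)
      have hσ1 : σ + 1 = τ / h := by omega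
      have hσlt : σ < τ := by
        have := Nat.div_le_self τ h
        omega
      have hle : h * (σ + 1) ≤ τ := by rw [hσ1]; exact Nat.mul_div_le τ h
      have h1 := hstep σ _ (ih σ hσlt) η ((pow_le_pow_right₀ hq1.le hle).trans hη)
      refine h1.trans ?_
      have h3 : ((τ : ℝ) + 1) / (2 * h) ≤ (σ : ℝ) + 1 := by
        rw [div_le_iff₀ (by linarith)]
        have h4 : τ < h * (τ / h + 1) := Nat.lt_mul_div_succ τ hh
        have h5 : τ + 1 ≤ (σ + 1) * (2 * h) := by
          rw [hσ1]
          have : h ≤ h * (τ / h) := Nat.le_mul_of_pos_right h (by omega)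
          nlinarith
        exact_mod_cast h5
      have h6 : ((σ : ℝ) + 1) ^ (-γ) ≤ (((τ : ℝ) + 1) / (2 * h)) ^ (-γ) :=
        Real.rpow_le_rpow_of_nonpos (by positivity) h3 (by linarith)
      calc κ * (C * ((σ : ℝ) + 1) ^ (-γ)) ≤ κ * (C * (((τ : ℝ) + 1) / (2 * h)) ^ (-γ)) := by
            gcongr
        _ = (κ * (2 * h : ℝ) ^ γ) * (C * ((τ : ℝ) + 1) ^ (-γ)) := by
            rw [Real.div_rpow (by positivity) (by positivity),
              Real.rpow_neg (by positivity : (0 : ℝ) ≤ 2 * h),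
              div_inv_eq_mul]
            ring
        _ = _ := by rw [hκγ, one_mul]

/-- A summable-type gauge for the recursion over scales. -/
theorem exists_gauge {m q : ℤ} (hq : 2 ≤ q) (hm : 0 < m) (hcop : IsCoprime m q)
    (hR : R = m / q) : ∃ δ : ℕ → ℝ, Antitone δ ∧ (∀ t, 0 < δ t) ∧
      Filter.Tendsto δ Filter.atTop (nhds 0) ∧ ∃ t₁ : ℕ, ∀ t, t₁ ≤ t → ∃ s, 1 ≤ s ∧
        ∀ η : Plane, (q : ℝ) ^ t / (2 * p) ≤ R ^ s * |inner ℝ η (digitVec u)| →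
          ‖fourierTransform μ η‖ ^ 2 + δ (t + s) ≤ δ t := by
  have := S.prob
  have hp := S.p_pos
  obtain ⟨C, γ, hC, hγ, hdec⟩ := S.exists_decay U hq hm hcop hR
  have hq1 : (1 : ℝ) < q := by exact_mod_cast (by omega : 1 < q)
  have hR0 : 0 < R := by linarith [U.one_lt]
  obtain ⟨h, hh⟩ := pow_unbounded_of_one_lt R hq1
  have hh1 : 1 ≤ h := by
    by_contra! h0
    have : h = 0 := by omega
    rw [this, pow_zero] at hh
    linarith [U.one_lt]
  obtain ⟨c, hc⟩ := pow_unbounded_of_one_lt (2 * p : ℝ) hq1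
  have hhR : (1 : ℝ) ≤ h := by exact_mod_cast hh1
  set ϑ : ℝ := (1 + 1 / (8 * h) : ℝ) ^ (-γ) with hϑ
  have hϑ1 : ϑ < 1 := Real.rpow_lt_one_of_one_lt_of_neg (by
    have : (0 : ℝ) < 1 / (8 * h) := by positivity
    linarith) (by linarith)
  -- The solution of C 2^γ + C' ϑ = C', where C 2^γ comes from the decay of μ̂ and ϑ from the
  -- passage from t to t + s.
  set C' : ℝ := C * (2 : ℝ) ^ γ / (1 - ϑ) with hC'
  have hC'0 : 0 < C' := div_pos (by positivity) (by linarith)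
  refine ⟨fun t => C' * ((t : ℝ) + 1) ^ (-γ), ?_, fun t => by positivity, ?_, 8 * h + 4 * c, ?_⟩
  · intro s t hst
    have : (s : ℝ) ≤ t := by exact_mod_cast hst
    exact mul_le_mul_of_nonneg_left
      (Real.rpow_le_rpow_of_nonpos (by positivity) (by linarith) (by linarith)) hC'0.le
  · have h1 : Filter.Tendsto (fun t : ℕ => (t : ℝ) + 1) Filter.atTop Filter.atTop :=
      Filter.tendsto_atTop_add_const_right _ _ tendsto_natCast_atTop_atTop
    have := ((tendsto_rpow_neg_atTop hγ).comp h1).const_mul C'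
    rwa [mul_zero] at this
  · intro t ht
    -- Proportional to t, so that δ(t + s) ≤ ϑ δ(t), but small enough that R^s and the factor 2p
    -- each cost at most q^(t/4), leaving a pairing of at least q^(t/2).
    set s := t / (4 * h) with hs
    have h4h : 0 < 4 * h := by omega
    have hs2 : 2 ≤ s := (Nat.le_div_iff_mul_le h4h).mpr (by omega)
    have hs_le : 4 * h * s ≤ t := Nat.mul_div_le t (4 * h)
    have hs_lt : t < 4 * h * (s + 1) := Nat.lt_mul_div_succ t h4h
    refine ⟨s, by omega, fun η hη => ?_⟩
    have hτ : (q : ℝ) ^ (t / 2) ≤ |inner ℝ η (digitVec u)| := by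
      have h1 : (q : ℝ) ^ (c + h * s + t / 2) ≤ (q : ℝ) ^ t :=
        pow_le_pow_right₀ hq1.le (by
          have e : 4 * h * s = 4 * (h * s) := by ring
          omega)
      have h2 : (q : ℝ) ^ t ≤ 2 * p * (R ^ s * |inner ℝ η (digitVec u)|) := by
        rw [div_le_iff₀ (by positivity)] at hη
        linarith
      have h3 : 2 * p * (R ^ s * |inner ℝ η (digitVec u)|)
          ≤ (q : ℝ) ^ c * (((q : ℝ) ^ h) ^ s * |inner ℝ η (digitVec u)|) := by
        gcongr
      have e : (q : ℝ) ^ c * (((q : ℝ) ^ h) ^ s * |inner ℝ η (digitVec u)|)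
          = (q : ℝ) ^ (c + h * s) * |inner ℝ η (digitVec u)| := by
        rw [← pow_mul, pow_add]; ring
      rw [e] at h3
      rw [pow_add] at h1
      have h4 : (0 : ℝ) < (q : ℝ) ^ (c + h * s) := by positivity
      exact le_of_mul_le_mul_left (h1.trans (h2.trans h3)) h4
    have hT : (0 : ℝ) < (t : ℝ) + 1 := by positivity
    have h5 : ‖fourierTransform μ η‖ ^ 2 ≤ C * (2 : ℝ) ^ γ * ((t : ℝ) + 1) ^ (-γ) := by
      have h6 := hdec (t / 2) η hτ
      have h7 : ((t : ℝ) + 1) / 2 ≤ ((t / 2 : ℕ) : ℝ) + 1 := by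
        have : t + 1 ≤ 2 * (t / 2 + 1) := by omega
        have : ((t + 1 : ℕ) : ℝ) ≤ ((2 * (t / 2 + 1) : ℕ) : ℝ) := by exact_mod_cast this
        push_cast at this ⊢
        linarith
      have h8 : (((t / 2 : ℕ) : ℝ) + 1) ^ (-γ) ≤ (((t : ℝ) + 1) / 2) ^ (-γ) :=
        Real.rpow_le_rpow_of_nonpos (by positivity) h7 (by linarith)
      have h9 := norm_fourierTransform_le μ η
      calc ‖fourierTransform μ η‖ ^ 2 ≤ ‖fourierTransform μ η‖ := by
            nlinarith [norm_nonneg (fourierTransform μ η)]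
        _ ≤ C * (((t / 2 : ℕ) : ℝ) + 1) ^ (-γ) := h6
        _ ≤ C * (((t : ℝ) + 1) / 2) ^ (-γ) := by gcongr
        _ = _ := by
          rw [Real.div_rpow hT.le (by norm_num), Real.rpow_neg (by norm_num : (0:ℝ) ≤ 2),
            div_inv_eq_mul]
          ring
    have h10 : C' * (((t + s : ℕ) : ℝ) + 1) ^ (-γ) ≤ C' * ϑ * ((t : ℝ) + 1) ^ (-γ) := by
      rw [mul_assoc, hϑ, ← Real.mul_rpow (by positivity) hT.le]
      refine mul_le_mul_of_nonneg_left
        (Real.rpow_le_rpow_of_nonpos (by positivity) ?_ (by linarith)) hC'0.le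
      push_cast
      have h11 : ((t : ℝ) + 1) ≤ 8 * h * s := by
        have : t + 1 ≤ 8 * h * s := by nlinarith
        exact_mod_cast this
      have h12 : ((t : ℝ) + 1) / (8 * h) ≤ s := by
        rw [div_le_iff₀ (by positivity)]; linarith
      calc (1 + 1 / (8 * h) : ℝ) * ((t : ℝ) + 1) = (t : ℝ) + 1 + ((t : ℝ) + 1) / (8 * h) := by ring
        _ ≤ _ := by linarith
    have h13 : C * (2 : ℝ) ^ γ + C' * ϑ = C' := by
      have : C' * (1 - ϑ) = C * (2 : ℝ) ^ γ := div_mul_cancel₀ _ (by linarith)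
      linarith
    calc _ ≤ C * (2 : ℝ) ^ γ * ((t : ℝ) + 1) ^ (-γ) + C' * ϑ * ((t : ℝ) + 1) ^ (-γ) :=
          add_le_add h5 h10
      _ = (C * (2 : ℝ) ^ γ + C' * ϑ) * ((t : ℝ) + 1) ^ (-γ) := by ring
      _ = _ := by rw [h13]

end SelfAffineSystem

/-! ### Summing sparse frequencies over the scales -/

namespace SelfAffineSystem

variable {p : ℕ} {D : Finset (Fin 2 → ℤ)} {a : Fin 2 → ℤ} {A B : Plane →L[ℝ] Plane}
  {μ : Measure Plane} (S : SelfAffineSystem p D a A B μ) {u : Fin 2 → ℤ} {R : ℝ}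

theorem IsSparse.image_of_integer {q K t : ℕ} {Λ : Set Plane} (h : IsSparse p a B u q K t Λ)
    (hs : ∀ x ∈ Λ, ∀ y ∈ Λ, B (x - y) ∈ integerPoints) :
    IsSparse p a B u q (K - 1) (t + 1) (B '' Λ) :=
  h.image fun x hx y hy hz => maskZeros_not_integer hz (hs x hx y hy)

include S in
/-- A bound for the integral classes of a sparse set passes to the whole set. -/
theorem sum_le_of_split {q K t : ℕ} {F : Finset Plane} (h : IsSparse p a B u q K t F) {C : ℝ}
    (hC : 0 < C) (ξ : Plane)
    (hclass : ∀ F' ⊆ F, (∀ x ∈ F', ∀ y ∈ F', B (x - y) ∈ integerPoints) →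
      ∑ l ∈ F', ‖fourierTransform μ (B (ξ + l))‖ ^ 2 ≤ C) :
    ∑ l ∈ F, ‖fourierTransform μ (ξ + l)‖ ^ 2 ≤ C := by
  classical
  have := S.isProbabilityMeasure
  rcases F.eq_empty_or_nonempty with rfl | ⟨m, hm⟩
  · simpa using hC.le
  -- For this subgroup the mask is constant on classes by periodicity, and sparse points in distinct
  -- classes must be separated at level 0.
  let G : AddSubgroup Plane := integerPoints.comap (B : Plane →+ Plane)
  have hG : ∀ x y : Plane, (x : Plane ⧸ G) = (y : Plane ⧸ G) ↔ B (x - y) ∈ integerPoints :=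
    fun x y => QuotientAddGroup.eq_iff_sub_mem
  have hconst : ∀ x y : Plane, (x : Plane ⧸ G) = (y : Plane ⧸ G) →
      ‖mask D (B (ξ + x))‖ ^ 2 = ‖mask D (B (ξ + y))‖ ^ 2 := by
    intro x y hxy
    have h1 := mask_add_integer D (B (ξ + y)) ((hG x y).mp hxy)
    rw [← map_add, show ξ + y + (x - y) = ξ + x by abel] at h1
    rw [h1]
  have key := sum_mul_le_of_classes (ι := F) (π := fun l : F => ((l : Plane) : Plane ⧸ G))
    (f := fun l => ‖mask D (B (ξ + l))‖ ^ 2)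
    (g := fun l => ‖fourierTransform μ (B (ξ + l))‖ ^ 2 / C)
    (fun _ => sq_nonneg _) (fun _ => div_nonneg (sq_nonneg _) hC.le) ?_ ?_ Finset.univ
    (m := ⟨m, hm⟩) (Finset.mem_univ _)
  rotate_left
  · intro T hT
    rw [← Finset.sum_div, div_le_one hC]
    have := hclass (T.map ⟨Subtype.val, Subtype.val_injective⟩) ?_ ?_
    · rwa [Finset.sum_map] at this
    · intro x hx
      obtain ⟨x', -, rfl⟩ := Finset.mem_map.mp hx
      exact x'.2
    · intro x hx y hy
      obtain ⟨x', hx', rfl⟩ := Finset.mem_map.mp hx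
      obtain ⟨y', hy', rfl⟩ := Finset.mem_map.mp hy
      exact (hG _ _).mp (hT x' hx' y' hy')
  · intro T hT
    have hinj : Set.InjOn (fun l : F => B l) (T : Set F) := fun x _ y _ h =>
      Subtype.ext (S.B_injective h)
    have h1 := OrthogonalFrequencies.sum_le (μ := discreteMeasure D)
      (F := T.image fun l : F => B l) ?_ (B ξ)
    · rw [Finset.sum_image hinj] at h1
      simpa only [mask, map_add] using h1
    · intro x hx y hy hxy
      simp only [Finset.coe_image, Set.mem_image] at hx hy
      obtain ⟨x', hx', rfl⟩ := hx
      obtain ⟨y', hy', rfl⟩ := hy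
      have hne : x' ≠ y' := fun h => hxy (by rw [h])
      obtain ⟨k, -, h2, h3, -⟩ := h x' x'.2 y' y'.2 fun h => hne (Subtype.ext h)
      rw [← map_sub]
      cases k with
      | zero => exact (S.mask_eq_zero_iff _).mpr (by simpa using h3)
      | succ k =>
        exact (hne (hT hx' hy' ((hG _ _).mpr (by simpa using h2 0 (Nat.succ_pos k))))).elim
  · have h4 : ∑ i ∈ (Finset.univ : Finset F).filter
        fun i : F => ((i : Plane) : Plane ⧸ G) = (m : Plane ⧸ G),
        ‖mask D (B (ξ + i))‖ ^ 2 * (‖fourierTransform μ (B (ξ + i))‖ ^ 2 / C)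
          ≤ ‖mask D (B (ξ + m))‖ ^ 2 := by
      have h5 : ∑ i ∈ (Finset.univ : Finset F).filter
        fun i : F => ((i : Plane) : Plane ⧸ G) = (m : Plane ⧸ G),
          ‖fourierTransform μ (B (ξ + i))‖ ^ 2 ≤ C := by
        have := hclass (((Finset.univ : Finset F).filter fun i : F =>
          ((i : Plane) : Plane ⧸ G) = (m : Plane ⧸ G)).map ⟨Subtype.val, Subtype.val_injective⟩)
          ?_ ?_
        · rwa [Finset.sum_map] at this
        · intro x hx
          obtain ⟨x', -, rfl⟩ := Finset.mem_map.mp hx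
          exact x'.2
        · intro x hx y hy
          obtain ⟨x', hx', rfl⟩ := Finset.mem_map.mp hx
          obtain ⟨y', hy', rfl⟩ := Finset.mem_map.mp hy
          rw [Finset.mem_filter] at hx' hy'
          exact (hG _ _).mp (hx'.2.trans hy'.2.symm)
      rw [Finset.sum_congr rfl fun i hi => by
        rw [hconst i m (Finset.mem_filter.mp hi).2], ← Finset.mul_sum, ← Finset.sum_div]
      exact mul_le_of_le_one_right (sq_nonneg _) ((div_le_one hC).mpr h5)
    have h6 := key.trans (add_le_add_right h4 _)
    rw [sub_add_cancel] at h6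
    have h7 : ∑ l ∈ F, ‖fourierTransform μ (ξ + l)‖ ^ 2
        = C * ∑ i : F, ‖mask D (B (ξ + i))‖ ^ 2 * (‖fourierTransform μ (B (ξ + i))‖ ^ 2 / C) := by
      rw [← Finset.sum_coe_sort, Finset.mul_sum]
      refine Finset.sum_congr rfl fun l _ => ?_
      rw [S.refine (ξ + l), norm_mul, mul_pow]
      field_simp
    rw [h7]
    exact mul_le_of_le_one_right hC.le h6

include S in
/-- The bound of `sum_le_of_split` iterated `s` times. -/
theorem sum_le_of_split_pow {q K t : ℕ} {F : Finset Plane} (h : IsSparse p a B u q K t F) {C : ℝ}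
    (hC : 0 < C) (ξ : Plane) (s : ℕ)
    (hclass : ∀ F' : Finset Plane, IsSparse p a B u q (K - s) (t + s) F' →
      (∀ l' ∈ F', ∃ l ∈ F, l' = (B ^ s) l) →
      ∑ l ∈ F', ‖fourierTransform μ ((B ^ s) ξ + l)‖ ^ 2 ≤ C) :
    ∑ l ∈ F, ‖fourierTransform μ (ξ + l)‖ ^ 2 ≤ C := by
  classical
  induction s generalizing K t F ξ with
  | zero => exact hclass F h fun l hl => ⟨l, hl, rfl⟩
  | succ s ih =>
    refine S.sum_le_of_split h hC ξ fun F' hF' hint => ?_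
    have h1 : IsSparse p a B u q (K - 1) (t + 1) (F'.image B : Finset Plane) := by
      rw [Finset.coe_image]
      exact (h.mono (by exact_mod_cast hF')).image_of_integer (by exact_mod_cast hint)
    have h2 := ih h1 (B ξ) fun F'' h3 h4 => ?_
    · rw [Finset.sum_image S.B_injective.injOn] at h2
      simpa only [map_add] using h2
    · have h5 := hclass F'' (by
        rwa [Nat.sub_sub, add_comm 1 s, add_assoc, add_comm 1 s] at h3) fun l' hl' => ?_
      · rwa [pow_succ, mul_apply_eq_comp] at h5
      · obtain ⟨y, hy, rfl⟩ := h4 l' hl'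
        obtain ⟨l, hl, rfl⟩ := Finset.mem_image.mp hy
        exact ⟨l, hF' hl, by rw [pow_succ, mul_apply_eq_comp]⟩

include S in
/-- Sparse frequencies carry little mass away from the origin of the functional. -/
theorem sum_le_of_isSparse (U : Eigenfunctional p a A u R) {q : ℕ} (hq : 1 ≤ q) {δ : ℕ → ℝ}
    (hδ : Antitone δ) (hδ0 : ∀ t, 0 < δ t) {t₁ : ℕ}
    (hgauge : ∀ t, t₁ ≤ t → ∃ s, 1 ≤ s ∧
        ∀ η : Plane, (q : ℝ) ^ t / (2 * p) ≤ R ^ s * |inner ℝ η (digitVec u)| →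
          ‖fourierTransform μ η‖ ^ 2 + δ (t + s) ≤ δ t) (K : ℕ) :
    ∀ t, t₁ ≤ t → ∀ (F : Finset Plane) (ξ : Plane), IsSparse p a B u q K t F →
      ((∀ l ∈ F, (q : ℝ) ^ t / (2 * p) ≤ |inner ℝ (ξ + l) (digitVec u)|) →
        ∑ l ∈ F, ‖fourierTransform μ (ξ + l)‖ ^ 2 ≤ δ t) ∧
      (∀ l₀ ∈ F, |inner ℝ (ξ + l₀) (digitVec u)| < (q : ℝ) ^ t / (2 * p) →
        ∑ l ∈ F.erase l₀, ‖fourierTransform μ (ξ + l)‖ ^ 2 ≤ δ t) := by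
  classical
  have hp := S.p_pos
  have hq1 : (1 : ℝ) ≤ q := by exact_mod_cast hq
  have hR1 := U.one_lt
  have hR0 : 0 < R := by linarith
  induction K using Nat.strong_induction_on with
  | _ K ih =>
  intro t ht F ξ hF
  rcases Nat.eq_zero_or_pos K with rfl | hK
  · have hsub : ∀ x ∈ F, ∀ y ∈ F, x = y := fun x hx y hy => by
      by_contra hne
      obtain ⟨k, hk, -⟩ := hF x hx y hy hne
      exact absurd hk (not_lt_zero)
    refine ⟨fun hfar => ?_, fun l₀ hl₀ _ => ?_⟩
    · rcases F.eq_empty_or_nonempty with rfl | ⟨m, hm⟩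
      · simpa using (hδ0 t).le
      · have : F = {m} := Finset.eq_singleton_iff_unique_mem.mpr ⟨hm, fun x hx => hsub x hx m hm⟩
        rw [this, Finset.sum_singleton]
        obtain ⟨s, -, hs⟩ := hgauge t ht
        have h1 : 1 ≤ R ^ s := one_le_pow₀ hR1.le
        have := hs (ξ + m) ((hfar m hm).trans (le_mul_of_one_le_left (abs_nonneg _) h1))
        linarith [hδ0 (t + s)]
    · have : F.erase l₀ = ∅ := Finset.eq_empty_of_forall_notMem fun x hx =>
        (Finset.mem_erase.mp hx).1 (hsub x (Finset.mem_erase.mp hx).2 l₀ hl₀)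
      rw [this, Finset.sum_empty]
      exact (hδ0 t).le
  · refine ⟨fun hfar => ?_, fun l₀ hl₀ hnear => ?_⟩
    · obtain ⟨s, hs1, hs⟩ := hgauge t ht
      refine S.sum_le_of_split_pow hF (hδ0 t) ξ s fun F' hF' hsub => ?_
      obtain ⟨ihf, ihn⟩ := ih (K - s) (by omega) (t + s) (by omega) F' ((B ^ s) ξ) hF'
      by_cases hall : ∀ l ∈ F', (q : ℝ) ^ (t + s) / (2 * p)
          ≤ |inner ℝ ((B ^ s) ξ + l) (digitVec u)|
      · exact (ihf hall).trans (hδ (by omega))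
      · push Not at hall
        obtain ⟨l₀, hl₀, hlt⟩ := hall
        rw [← Finset.add_sum_erase _ _ hl₀]
        refine (add_le_add_right (ihn l₀ hl₀ hlt) _).trans (hs _ ?_)
        obtain ⟨l, hl, rfl⟩ := hsub l₀ hl₀
        rw [← map_add, S.inner_B_pow U, abs_mul, abs_of_pos (by positivity), ← mul_assoc,
          ← mul_pow, mul_inv_cancel₀ hR0.ne', one_pow, one_mul]
        exact hfar l hl
    · have hpow : (q : ℝ) ^ t / (2 * p) ≤ (q : ℝ) ^ (t + 1) / (2 * p) :=
        div_le_div_of_nonneg_right (pow_le_pow_right₀ hq1 (Nat.le_succ t)) (by positivity)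
      have hB : ∀ z : Plane, |inner ℝ (B z) (digitVec u)| ≤ |inner ℝ z (digitVec u)| := fun z => by
        rw [S.inner_B U, abs_mul, abs_of_pos (inv_pos.mpr hR0)]
        exact mul_le_of_le_one_left (abs_nonneg _) (inv_le_one_of_one_le₀ hR1.le)
      have hF₀ : IsSparse p a B u q K t (F.erase l₀ : Finset Plane) :=
        hF.mono (by exact_mod_cast Finset.erase_subset _ _)
      refine S.sum_le_of_split hF₀ (hδ0 t) ξ fun F' hF' hint => ?_
      have hF'F : F' ⊆ F := hF'.trans (Finset.erase_subset _ _)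
      have himg : ∀ H : Finset Plane, ∑ l ∈ H, ‖fourierTransform μ (B (ξ + l))‖ ^ 2
          = ∑ l ∈ H.image B, ‖fourierTransform μ (B ξ + l)‖ ^ 2 := fun H => by
        rw [Finset.sum_image S.B_injective.injOn]
        simp only [map_add]
      have himage : ∀ H : Finset Plane, H ⊆ F → (∀ x ∈ H, ∀ y ∈ H, B (x - y) ∈ integerPoints) →
          IsSparse p a B u q (K - 1) (t + 1) (H.image B : Finset Plane) := fun H hH hi => by
        rw [Finset.coe_image]
        exact (hF.mono (by exact_mod_cast hH)).image_of_integer (by exact_mod_cast hi)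
      have hl₀F' : l₀ ∉ F' := fun h => (Finset.mem_erase.mp (hF' h)).1 rfl
      -- If F' shares the class of l₀, restore l₀ and use the near case by induction. Otherwise F'
      -- is separated from l₀ at level 0 by a gap of q^(t+1)/p, of which l₀ uses at most half, so
      -- all of F' is far at scale t + 1.
      by_cases hall : ∀ y ∈ F', B (y - l₀) ∈ integerPoints
      · have hall' : ∀ x ∈ insert l₀ F', ∀ y ∈ insert l₀ F', B (x - y) ∈ integerPoints := by
          intro x hx y hy
          rw [← sub_sub_sub_cancel_right x y l₀, map_sub]
          have h0 : ∀ x ∈ insert l₀ F', B (x - l₀) ∈ integerPoints := fun x hx => by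
            rcases Finset.mem_insert.mp hx with rfl | hx
            · rw [sub_self, map_zero]; exact zero_mem _
            · exact hall x hx
          exact sub_mem (h0 x hx) (h0 y hy)
        have h1 := (ih (K - 1) (by omega) (t + 1) (by omega) ((insert l₀ F').image B) (B ξ)
          (himage _ (Finset.insert_subset hl₀ hF'F) hall')).2 (B l₀)
          (Finset.mem_image_of_mem B (Finset.mem_insert_self _ _))
          (by rw [← map_add]; exact (hB _).trans_lt (hnear.trans_le hpow))
        rw [← Finset.image_erase S.B_injective, Finset.erase_insert hl₀F'] at h1
        rw [himg]
        exact h1.trans (hδ (Nat.le_succ t))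
      · push Not at hall
        obtain ⟨y₀, hy₀, hy₀'⟩ := hall
        rw [himg]
        refine ((ih (K - 1) (by omega) (t + 1) (by omega) (F'.image B) (B ξ)
          (himage _ hF'F hint)).1 ?_).trans (hδ (Nat.le_succ t))
        intro l hl
        obtain ⟨y, hy, rfl⟩ := Finset.mem_image.mp hl
        have hyl : B (y - l₀) ∉ integerPoints := fun h => hy₀' (by
          rw [show y₀ - l₀ = (y₀ - y) + (y - l₀) by abel, map_add]
          exact add_mem (hint y₀ hy₀ y hy) h)
        obtain ⟨k, -, h1, -, h3⟩ := hF y (hF'F hy) l₀ hl₀ fun h => hl₀F' (h ▸ hy)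
        cases k with
        | succ k => exact (hyl (by simpa using h1 0 (Nat.succ_pos k))).elim
        | zero =>
          rw [zero_add, pow_one, add_comm 1 t] at h3
          have h4 : inner ℝ (B (y - l₀)) (digitVec u)
              = inner ℝ (B ξ + B y) (digitVec u) - inner ℝ (B (ξ + l₀)) (digitVec u) := by
            rw [← inner_sub_left, map_sub, map_add]
            congr 1
            abel
          rw [h4] at h3
          have h5 := (h3.trans (abs_sub _ _)).trans
            (add_le_add_right ((hB (ξ + l₀)).trans (hnear.le.trans hpow)) _)
          have h6 : (q : ℝ) ^ (t + 1) / p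
              = (q : ℝ) ^ (t + 1) / (2 * p) + (q : ℝ) ^ (t + 1) / (2 * p) := by
            field_simp; norm_num
          rw [h6] at h5
          exact le_of_add_le_add_right h5

end SelfAffineSystem

/-! ### Expansion rates are multiples of p -/

namespace SelfAffineSystem

variable {p : ℕ} {D : Finset (Fin 2 → ℤ)} {a : Fin 2 → ℤ} {A B : Plane →L[ℝ] Plane}
  {μ : Measure Plane} (S : SelfAffineSystem p D a A B μ) {u : Fin 2 → ℤ} {R : ℝ}
  (U : Eigenfunctional p a A u R)
include S U

/-- There is no spectrum when the expansion rate is a proper fraction. -/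
theorem not_isSpectrum_of_fraction {Λ : Set Plane} {m q : ℤ} (hq : 2 ≤ q)
    (hm : 0 < m) (hcop : IsCoprime m q) (hR : R = m / q) : ¬ IsSpectrum p a B μ Λ := by
  classical
  intro hΛ
  have := S.prob
  have hp := S.p_pos
  obtain ⟨G, hG⟩ := S.exists_classSubgroup U hΛ
  obtain ⟨z, hz, -, -⟩ := S.exists_zero_integer hΛ hG
  have hz₀ : fourierTransform μ (A z) = 0 :=
    (S.fourierTransform_eq_zero_iff _).mpr ⟨0, by simpa [S.left_inv] using hz⟩
  obtain ⟨δ, hδ, hδ0, hδlim, t₁, hgauge⟩ := S.exists_gauge U hq hm hcop hR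
  have hqc : ((q.toNat : ℕ) : ℝ) = q := by exact_mod_cast Int.toNat_of_nonneg (by omega : 0 ≤ q)
  have hq1 : (1 : ℝ) < q := by exact_mod_cast (by omega : 1 < q)
  -- Choose ξ with ξ + x₀ near the zero Az of μ̂. The term of x₀ is below 1/2, and since x₀ is near
  -- at scale t the other terms add up to at most δ t < 1/2.
  obtain ⟨t, ht1, ht2, ht3⟩ := ((hδlim.eventually_lt_const (by norm_num : (0 : ℝ) < 1 / 2)).and
    ((Filter.eventually_ge_atTop t₁).and
      ((tendsto_pow_atTop_atTop_of_one_lt hq1).eventually_gt_atTop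
      ((|inner ℝ (A z) (digitVec u)| + 1) * (2 * p))))).exists
  obtain ⟨Λ', hΛ', hsparse⟩ := S.exists_isSparse U hΛ (by omega : 0 < q) hcop hR t
  obtain ⟨x₀, hx₀⟩ := hΛ'.nonempty
  obtain ⟨E, hE, hsum⟩ := hΛ'.total
  have hcont := continuous_fourierTransform μ
  have hopen : IsOpen {ξ : Plane | ‖fourierTransform μ (ξ + x₀)‖ ^ 2 < 1 / 2 ∧
      |inner ℝ (ξ + x₀) (digitVec u)| < |inner ℝ (A z) (digitVec u)| + 1} :=
    IsOpen.and (isOpen_lt (by fun_prop) continuous_const)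
      (isOpen_lt (by fun_prop) continuous_const)
  obtain ⟨ξ, ⟨h1, h2⟩, hξ⟩ := (hE.dense_compl ℝ).inter_open_nonempty _ hopen
    ⟨A z - x₀, by simp [hz₀]⟩
  obtain ⟨F, hF1, hF2⟩ := (((hsum ξ hξ).eventually_const_lt
    (show ‖fourierTransform μ (ξ + x₀)‖ ^ 2 + δ t < 1 by linarith)).and
      (Filter.eventually_ge_atTop ({⟨x₀, hx₀⟩} : Finset Λ'))).exists
  set F' : Finset Plane := F.map ⟨Subtype.val, Subtype.val_injective⟩ with hF'
  have hx₀F : x₀ ∈ F' := Finset.mem_map.mpr ⟨⟨x₀, hx₀⟩, hF2 (by simp), rfl⟩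
  obtain ⟨K, hK⟩ := hsparse F' (by
    intro x hx
    obtain ⟨y, -, rfl⟩ := Finset.mem_map.mp (Finset.mem_coe.mp hx)
    exact y.2)
  have h3 := (S.sum_le_of_isSparse U (q := q.toNat) (by omega) hδ hδ0
    (by rw [hqc]; exact hgauge) K t ht2 F' ξ hK).2 x₀ hx₀F (by
      rw [hqc, lt_div_iff₀ (by positivity)]
      refine lt_of_lt_of_le ?_ ht3.le
      exact mul_lt_mul_of_pos_right h2 (by positivity))
  have h4 : ∑ l ∈ F, ‖fourierTransform μ (ξ + l)‖ ^ 2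
      = ∑ l ∈ F', ‖fourierTransform μ (ξ + l)‖ ^ 2 := by
    rw [hF', Finset.sum_map]
    rfl
  rw [h4, ← Finset.add_sum_erase _ _ hx₀F] at hF1
  linarith

/-- The expansion rate of a system with a spectrum is a multiple of the number of digits. -/
theorem isIntMultiple_of_isSpectrum {Λ : Set Plane} (hΛ : IsSpectrum p a B μ Λ) :
    IsIntMultiple p R := by
  have hp := S.p_pos
  obtain ⟨G, hG⟩ := S.exists_classSubgroup U hΛ
  obtain ⟨z, hz, ⟨n, hn⟩, -⟩ := S.exists_zero_integer hΛ hG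
  obtain ⟨X, hX, he⟩ := S.inner_of_mem_maskZeros U hz
  have hR1 := U.one_lt
  have hX0 : X ≠ 0 := fun h0 => hX (by rw [h0]; exact dvd_zero _)
  have hXR : (X : ℝ) ≠ 0 := by exact_mod_cast hX0
  set N : ℤ := n 0 * u 0 + n 1 * u 1 with hN
  -- Pairing the integral vector Az with u gives RX/p ∈ ℤ with p ∤ X, so R is rational and p divides
  -- its reduced numerator.
  have h1 : R * (X / p) = N := by
    rw [← he, ← U.scale, ← hn, inner_digitVec, hN]; push_cast; simp
  set r : ℚ := p * N / X with hr
  have hRr : R = r := by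
    rw [hr]; push_cast
    field_simp at h1 ⊢
    linarith
  have hRq : R = (r.num : ℝ) / ((r.den : ℤ) : ℝ) := by
    rw [hRr]
    exact_mod_cast (Rat.num_div_den r).symm
  have hden : (0 : ℤ) < r.den := by exact_mod_cast r.den_pos
  have hdenR : (0 : ℝ) < ((r.den : ℤ) : ℝ) := by exact_mod_cast hden
  have hnum : 0 < r.num := by
    have : (0 : ℝ) < r.num := by
      have h2 : (r.num : ℝ) = R * ((r.den : ℤ) : ℝ) := by rw [hRq]; field_simp
      rw [h2]
      exact mul_pos (by linarith) hdenR
    exact_mod_cast this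
  have hpm : (p : ℤ) ∣ r.num := by
    have : r.num * X = p * (r.den * N) := by
      have : (r.num : ℝ) * X = p * (((r.den : ℤ) : ℝ) * N) := by
        rw [hRq] at h1
        field_simp at h1
        linarith
      exact_mod_cast this
    exact (S.prime_int.dvd_or_dvd ⟨_, this⟩).resolve_right hX
  have hden1 : (r.den : ℤ) = 1 := by
    by_contra hne
    exact S.not_isSpectrum_of_fraction U (q := r.den) (by omega) hnum
      (Int.isCoprime_iff_gcd_eq_one.mpr r.reduced) hRq hΛ
  obtain ⟨m, hm⟩ := hpm
  refine ⟨m, ?_⟩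
  rw [hRq, hden1, hm]
  push_cast
  simp

end SelfAffineSystem

/-! ### Triangular systems -/

/-- A self-affine system whose expansion has rows `(R₁, 0)` and `(c, R₂)`. -/
structure TriangularSystem (p : ℕ) (D : Finset (Fin 2 → ℤ)) (a : Fin 2 → ℤ) (R₁ R₂ c : ℝ)
    (A B : Plane →L[ℝ] Plane) (μ : Measure Plane) : Prop extends
    SelfAffineSystem p D a A B μ where
  one_lt_left : 1 < R₁
  one_lt_right : 1 < R₂
  apply_zero : ∀ ξ, A ξ 0 = R₁ * ξ 0
  apply_one : ∀ ξ, A ξ 1 = c * ξ 0 + R₂ * ξ 1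

/-! ### The self-affine measure as a triangular system -/

theorem act_apply (N : Matrix (Fin 2) (Fin 2) ℝ) (ξ : Plane) (i : Fin 2) :
    act N ξ i = N i 0 * ξ 0 + N i 1 * ξ 1 := by
  have : act N ξ i = (N.mulVec (WithLp.ofLp ξ)) i := by
    unfold act
    rw [← Matrix.ofLp_toEuclideanCLM (𝕜 := ℝ)]
  rw [this, Matrix.mulVec, dotProduct, Fin.sum_univ_two]

theorem inner_act (N : Matrix (Fin 2) (Fin 2) ℝ) (ξ x : Plane) :
    inner ℝ ξ (act N x) = inner ℝ (act N.transpose ξ) x := by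
  simp only [PiLp.inner_apply, Fin.sum_univ_two, act_apply, Matrix.transpose_apply]
  simp
  ring

theorem norm_act_transpose (N : Matrix (Fin 2) (Fin 2) ℝ) : ‖act N.transpose‖ = ‖act N‖ := by
  have : act N.transpose = star (act N) := by
    unfold act
    rw [← map_star, Matrix.star_eq_conjTranspose, Matrix.conjTranspose_eq_transpose_of_trivial]
  rw [this]
  exact ContinuousLinearMap.adjoint.norm_map _

theorem act_pow (N : Matrix (Fin 2) (Fin 2) ℝ) (n : ℕ) : act N ^ n = act (N ^ n) := by
  simp [act, map_pow]

theorem fourierTransform_selfAffineMeasure {M : Matrix (Fin 2) (Fin 2) ℝ}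
    {D : Finset (Fin 2 → ℤ)} [Nonempty D] (hM : Summable fun k : ℕ => ‖act (M⁻¹ ^ k)‖)
    (ξ : Plane) : fourierTransform (selfAffineMeasure M D) ξ
      = mask D (act M⁻¹.transpose ξ)
        * fourierTransform (selfAffineMeasure M D) (act M⁻¹.transpose ξ) := by
  have := isProbabilityMeasure_selfAffineMeasure (D := D) hM
  have hφ : ∀ d, Measurable (ifsMap M d) := fun d => by
    unfold ifsMap
    fun_prop
  have hpm : ∀ d, IsProbabilityMeasure ((selfAffineMeasure M D).map (ifsMap M d)) := fun d =>
    Measure.isProbabilityMeasure_map (hφ d).aemeasurable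
  have hd : ∀ d, ∫ x, expFun ξ x ∂((selfAffineMeasure M D).map (ifsMap M d))
      = expFun (act M⁻¹.transpose ξ) (digitVec d)
        * fourierTransform (selfAffineMeasure M D) (act M⁻¹.transpose ξ) := by
    intro d
    rw [integral_map (hφ d).aemeasurable (continuous_expFun ξ).aestronglyMeasurable]
    unfold fourierTransform
    rw [← integral_const_mul]
    refine integral_congr_ae (Filter.Eventually.of_forall fun x => ?_)
    have : expFun ξ (ifsMap M d x) = expFun (act M⁻¹.transpose ξ) (x + digitVec d) := by
      simp only [expFun, ifsMap, inner_act]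
    simp only [this, expFun_add_right]
    ring
  rw [mask_eq]
  conv_lhs => rw [fourierTransform, selfAffineMeasure_eq hM]
  rw [integral_smul_measure, integral_finsetSum_measure]
  · simp only [hd]
    rw [← Finset.sum_mul]
    simp [Complex.real_smul, mul_assoc]
  · exact fun d _ => integrable_expFun _ ξ

theorem triMatrix_inv {ρ₁ ρ₂ : ℝ} (c : ℝ) (h₁ : ρ₁ ≠ 0) (h₂ : ρ₂ ≠ 0) :
    triMatrix ρ₁ ρ₂ c * (triMatrix ρ₁ ρ₂ c)⁻¹ = 1 ∧
      (triMatrix ρ₁ ρ₂ c)⁻¹ * triMatrix ρ₁ ρ₂ c = 1 := by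
  have h : IsUnit (triMatrix ρ₁ ρ₂ c).det := by
    simp [triMatrix, Matrix.det_fin_two, h₁, h₂]
  exact ⟨Matrix.mul_nonsing_inv _ h, Matrix.nonsing_inv_mul _ h⟩

theorem triangularSystem_selfAffineMeasure {p : ℕ} {D : Finset (Fin 2 → ℤ)} {a : Fin 2 → ℤ}
    (H : DigitSystem p D a) {ρ₁ ρ₂ : ℝ} (c : ℝ) (h₁ : 0 < ρ₁) (h₁' : ρ₁ < 1) (h₂ : 0 < ρ₂)
    (h₂' : ρ₂ < 1) :
    TriangularSystem p D a ρ₁⁻¹ ρ₂⁻¹ c (act (triMatrix ρ₁ ρ₂ c).transpose)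
      (act (triMatrix ρ₁ ρ₂ c)⁻¹.transpose) (selfAffineMeasure (triMatrix ρ₁ ρ₂ c) D) := by
  have hM := summable_act_triMatrix c h₁ h₁' h₂ h₂'
  have : Nonempty D := ⟨⟨0, H.zero_mem⟩⟩
  obtain ⟨hl, hr⟩ := triMatrix_inv c h₁.ne' h₂.ne'
  have hone : ∀ ξ, act 1 ξ = ξ := fun ξ => by simp [act]
  refine ⟨⟨H, isProbabilityMeasure_selfAffineMeasure hM, fun ξ => ?_, fun ξ => ?_, fun ξ => ?_,
    fourierTransform_selfAffineMeasure hM⟩, (one_lt_inv₀ h₁).mpr h₁', (one_lt_inv₀ h₂).mpr h₂',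
    fun ξ => ?_, fun ξ => ?_⟩
  · rw [← act_mul, ← Matrix.transpose_mul, hl, Matrix.transpose_one, hone]
  · rw [← act_mul, ← Matrix.transpose_mul, hr, Matrix.transpose_one, hone]
  · have h0 := hM.tendsto_atTop_zero.mul_const ‖ξ‖
    rw [zero_mul] at h0
    refine squeeze_zero_norm (fun n => ?_) h0
    rw [act_pow, ← Matrix.transpose_pow, ← norm_act_transpose]
    exact ContinuousLinearMap.le_opNorm _ _
  · simp [act_apply, triMatrix]
  · simp [act_apply, triMatrix]

namespace TriangularSystem

variable {p : ℕ} {D : Finset (Fin 2 → ℤ)} {a : Fin 2 → ℤ} {R₁ R₂ c : ℝ}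
  {A B : Plane →L[ℝ] Plane} {μ : Measure Plane} (T : TriangularSystem p D a R₁ R₂ c A B μ)
include T

theorem eigenfunctional_left : Eigenfunctional p a A ![1, 0] R₁ where
  one_lt := T.one_lt_left
  scale ξ := by simp [inner_digitVec, T.apply_zero]
  not_dvd := by simpa using T.not_dvd 0

/-- The vector (−h, l) is an eigenvector of M for R₂ when c/(R₁ − R₂) = h/l, and the condition
defining E_a says that its pairing with a is prime to p. -/
theorem eigenfunctional_right {h l : ℤ} (hc : c * l = h * (R₁ - R₂))
    (hE : ¬ (p : ℤ) ∣ l * a 1 - h * a 0) :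
    Eigenfunctional p a A ![-h, l] R₂ where
  one_lt := T.one_lt_right
  scale ξ := by
    simp only [inner_digitVec, T.apply_zero, T.apply_one, Matrix.cons_val_zero,
      Matrix.cons_val_one]
    push_cast
    linear_combination ξ 0 * hc
  not_dvd := by
    simp only [Matrix.cons_val_zero, Matrix.cons_val_one]
    rwa [show -h * a 0 + l * a 1 = l * a 1 - h * a 0 by ring]

/-- The lower left entry of the powers of the expansion. -/
theorem pow_apply (ξ : Plane) (k : ℕ) : ((A ^ k) ξ) 0 = R₁ ^ k * ξ 0 ∧
    ((A ^ k) ξ) 1 = c * (∑ i ∈ Finset.range k, R₁ ^ i * R₂ ^ (k - 1 - i)) * ξ 0 + R₂ ^ k * ξ 1 := by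
  induction k with
  | zero => simp
  | succ k ih =>
    rw [pow_succ', mul_apply_eq_comp, T.apply_zero, T.apply_one, ih.1, ih.2]
    refine ⟨by ring, ?_⟩
    have : ∑ i ∈ Finset.range (k + 1), R₁ ^ i * R₂ ^ (k + 1 - 1 - i)
        = R₁ ^ k + R₂ * ∑ i ∈ Finset.range k, R₁ ^ i * R₂ ^ (k - 1 - i) := by
      rw [Finset.sum_range_succ, Finset.mul_sum, add_comm]
      congr 1
      · simp
      · refine Finset.sum_congr rfl fun i hi => ?_
        have := Finset.mem_range.mp hi
        rw [show k + 1 - 1 - i = (k - 1 - i) + 1 by omega, pow_succ]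
        ring
    rw [this]
    ring

theorem B_apply_zero (ξ : Plane) : B ξ 0 = R₁⁻¹ * ξ 0 := by
  have h := T.apply_zero (B ξ)
  have hR : R₁ ≠ 0 := by linarith [T.one_lt_left]
  rw [T.right_inv] at h
  rw [h]
  field_simp

theorem B_apply_one (ξ : Plane) : B ξ 1 = R₂⁻¹ * (ξ 1 - c * R₁⁻¹ * ξ 0) := by
  have h := T.apply_one (B ξ)
  have hR : R₂ ≠ 0 := by linarith [T.one_lt_right]
  rw [T.right_inv, T.B_apply_zero] at h
  rw [h]
  field_simp
  ring

end TriangularSystem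

theorem exists_reduced_of_mem_exceptionalSet {p : ℕ} {a : Fin 2 → ℤ} (ha : ¬ (p : ℤ) ∣ a 1) {x : ℝ}
    (hx : x ∈ exceptionalSet p a) : ∃ h l : ℤ, l ≠ 0 ∧ IsCoprime h l ∧
      ¬ (p : ℤ) ∣ l * a 1 - h * a 0 ∧ x = h / l := by
  rcases hx with hx | rfl
  · exact hx
  · exact ⟨0, 1, one_ne_zero, isCoprime_one_right, by simpa using ha, by simp⟩

/-! ### Arithmetic of the necessary conditions -/

namespace TriangularSystem

variable {p : ℕ} {D : Finset (Fin 2 → ℤ)} {a : Fin 2 → ℤ} {R₁ R₂ c : ℝ}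
  {A B : Plane →L[ℝ] Plane} {μ : Measure Plane} (T : TriangularSystem p D a R₁ R₂ c A B μ)
include T

/-- The arithmetic consequences of the existence of a spectrum. -/
theorem exists_integers {Λ : Set Plane} (hΛ : IsSpectrum p a B μ Λ) :
    ∃ r X Y m₁ m₂ : ℤ, R₁ = p * r ∧ ¬ (p : ℤ) ∣ X ∧ (p : ℤ) ∣ X * a 1 - Y * a 0 ∧
      c * X + R₂ * Y = p * m₁ ∧ c * r * X + R₂ * m₁ = m₂ := by
  have hp := T.p_pos
  obtain ⟨r, hr⟩ := T.isIntMultiple_of_isSpectrum T.eigenfunctional_left hΛ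
  obtain ⟨G, hG⟩ := T.exists_classSubgroup T.eigenfunctional_left hΛ
  obtain ⟨z, ⟨n, h1, h2, h3⟩, ⟨m, hm⟩, ⟨m', hm'⟩⟩ := T.exists_zero_integer hΛ hG
  have e0 : (p : ℝ) * z 0 = n 0 := by simpa using congrArg (fun v : Plane => v 0) h3
  have e1 : (p : ℝ) * z 1 = n 1 := by simpa using congrArg (fun v : Plane => v 1) h3
  have f1 : A z 1 = m 1 := by simpa using congrArg (fun v : Plane => v 1) hm.symm
  have g1 : A (A z) 1 = m' 1 := by simpa using congrArg (fun v : Plane => v 1) hm'.symm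
  rw [T.apply_one, T.apply_zero, f1] at g1
  rw [T.apply_one] at f1
  refine ⟨r, n 0, n 1, m 1, m' 1, hr, h1, h2, ?_, ?_⟩
  · rw [← e0, ← e1, ← f1]; ring
  · rw [← g1, hr, ← e0]; ring

/-- With R₂ = R₁ = pr, integrality of Az gives cX ∈ pℤ with p ∤ X, so p divides the reduced
numerator of c. -/
theorem necessary_of_eq (hμ : IsSpectralMeasure μ) (hR : R₁ = R₂) : IsIntMultiple p R₁ ∧
    ((∃ s t : ℤ, s ≠ 0 ∧ (p : ℤ) ∣ t ∧ IsCoprime t s ∧ c = (t : ℝ) / (s : ℝ)) ∨ c = 0) := by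
  obtain ⟨Λ, hΛ⟩ := T.exists_isSpectrum hμ
  obtain ⟨r, X, Y, m₁, m₂, hr, hX, -, h1, -⟩ := T.exists_integers hΛ
  refine ⟨⟨r, hr⟩, Or.inl ?_⟩
  have hXR : (X : ℝ) ≠ 0 := by
    intro h0
    exact hX (by rw [Int.cast_eq_zero.mp h0]; exact dvd_zero _)
  have h2 : c * X = p * (m₁ - r * Y) := by rw [← hR, hr] at h1; linarith
  set x : ℚ := p * (m₁ - r * Y) / X with hx
  have hcx : c = x := by
    rw [hx]; push_cast
    field_simp
    linarith
  have hd : (x.den : ℝ) ≠ 0 := by exact_mod_cast x.den_nz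
  have hcq : c = (x.num : ℝ) / ((x.den : ℤ) : ℝ) := by
    rw [hcx]
    exact_mod_cast (Rat.num_div_den x).symm
  refine ⟨x.den, x.num, by exact_mod_cast x.den_nz, ?_,
    Int.isCoprime_iff_gcd_eq_one.mpr x.reduced, hcq⟩
  have h3 : x.num * X = p * (x.den * (m₁ - r * Y)) := by
    have : (x.num : ℝ) * X = p * (((x.den : ℤ) : ℝ) * (m₁ - r * Y)) := by
      rw [hcq] at h2
      have : ((x.den : ℤ) : ℝ) ≠ 0 := by exact_mod_cast hd
      field_simp at h2
      linarith
    exact_mod_cast this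
  exact (T.prime_int.dvd_or_dvd ⟨_, h3⟩).resolve_right hX

/-- If c'' = h/l is in E_a, the second eigenvector gives R₂ ∈ pℤ. Integrality of Az makes pl divide
p(lY − hX)(r − r₂) up to the extra factor p already present, and lY − hX is prime to p, whence the
power p^(ℓ+1). Outside E_a only rationality is needed: either c'' = Y/X, or integrality of A²z makes
R₂, and then c, rational. -/
theorem necessary_of_ne (hμ : IsSpectralMeasure μ) (hR : R₁ ≠ R₂) :
    (IsIntMultiple p R₁ ∧ c / (R₁ - R₂) ∈ Set.range ((↑) : ℚ → ℝ) \ exceptionalSet p a) ∨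
    (IsIntMultiple p R₁ ∧ IsIntMultiple p R₂ ∧ c / (R₁ - R₂) ∈ exceptionalSet p a ∧
      ∃ (ℓ : ℕ) (s t : ℤ), t ≠ 0 ∧ IsCoprime s t ∧ c / (R₁ - R₂) = (s : ℝ) / (t : ℝ) ∧
        (∃ u : ℤ, ¬ (p : ℤ) ∣ u ∧ t = (p : ℤ) ^ ℓ * u) ∧
        IsIntMultiple (p ^ (ℓ + 1)) (R₁ - R₂)) := by
  obtain ⟨Λ, hΛ⟩ := T.exists_isSpectrum hμ
  obtain ⟨r, X, Y, m₁, m₂, hr, hX, hdet, h1, h2⟩ := T.exists_integers hΛ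
  have hp := T.p_pos
  have hXR : (X : ℝ) ≠ 0 := by
    intro h0
    exact hX (by rw [Int.cast_eq_zero.mp h0]; exact dvd_zero _)
  have hκ : R₁ - R₂ ≠ 0 := sub_ne_zero.mpr hR
  set x := c / (R₁ - R₂) with hx
  have hc : c = x * (R₁ - R₂) := by rw [hx]; field_simp
  have hW : (Y - x * X) * (R₂ - R₁) = p * (m₁ - r * Y) := by
    have : x * X * (R₁ - R₂) = c * X := by rw [hc]; ring
    rw [hr] at this ⊢
    linarith
  have hW2 : R₂ * (m₁ - r * Y) = m₂ - p * r * m₁ := by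
    have : c * r * X + R₂ * r * Y = p * r * m₁ := by linear_combination (r : ℝ) * h1
    linarith
  by_cases hE : x ∈ exceptionalSet p a
  · obtain ⟨h, l, hl, hcop, hnd, hxl⟩ :=
      exists_reduced_of_mem_exceptionalSet (T.not_dvd 1) hE
    have hlR : (l : ℝ) ≠ 0 := by exact_mod_cast hl
    have hcl : c * l = h * (R₁ - R₂) := by rw [hc, hxl]; field_simp
    obtain ⟨r₂, hr₂⟩ := T.isIntMultiple_of_isSpectrum (T.eigenfunctional_right hcl hnd) hΛ
    obtain ⟨w, hlw, hw⟩ := (Int.finiteMultiplicity_iff.mpr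
      ⟨by simpa using T.prime.ne_one, hl⟩ :
        FiniteMultiplicity (p : ℤ) l).exists_eq_pow_mul_and_not_dvd
    refine Or.inr ⟨⟨r, hr⟩, ⟨r₂, hr₂⟩, hE, _, h, l, hl, hcop, hxl, ⟨w, hw, hlw⟩, ?_⟩
    generalize multiplicity (p : ℤ) l = ℓ at hlw
    have h3 : (l * Y - h * X) * (p * (r - r₂)) = (p : ℤ) ^ (ℓ + 1) * (-(w * (m₁ - r * Y))) := by
      have h4 : (l * Y - h * X : ℝ) * (p * (r - r₂)) = -(p * l * (m₁ - r * Y)) := by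
        rw [hxl, hr, hr₂] at hW
        field_simp at hW
        linear_combination (-p : ℝ) * hW
      have h5 : (l * Y - h * X) * (p * (r - r₂)) = -(p * l * (m₁ - r * Y)) := by exact_mod_cast h4
      rw [h5, pow_succ]
      linear_combination (-(p * (m₁ - r * Y)) : ℤ) * hlw
    have h6 : ¬ (p : ℤ) ∣ l * Y - h * X := fun hdvd => by
      have : (p : ℤ) ∣ X * (l * a 1 - h * a 0) := by
        have := dvd_add (hdvd.mul_left (a 0)) (hdet.mul_left l)
        rwa [show a 0 * (l * Y - h * X) + l * (X * a 1 - Y * a 0) = X * (l * a 1 - h * a 0) by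
          ring] at this
      exact (T.prime_int.dvd_or_dvd this).elim hX hnd
    have h7 : IsCoprime ((p : ℤ) ^ (ℓ + 1)) (l * Y - h * X) :=
      ((T.prime_int.coprime_iff_not_dvd).mpr h6).pow_left
    obtain ⟨k, hk⟩ := h7.dvd_of_dvd_mul_left ⟨_, h3⟩
    refine ⟨k, ?_⟩
    rw [hr, hr₂, ← mul_sub]
    exact_mod_cast hk
  · refine Or.inl ⟨⟨r, hr⟩, ?_, hE⟩
    by_cases h0 : Y - x * X = 0
    · refine ⟨Y / X, ?_⟩
      push_cast
      field_simp
      linarith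
    · have hw : ((m₁ : ℝ) - r * Y) ≠ 0 := fun h => by
        rw [h, mul_zero] at hW
        rcases mul_eq_zero.mp hW with h | h
        · exact h0 h
        · exact hR (by linarith)
      have hR2 : R₂ = (((m₂ - p * r * m₁) / (m₁ - r * Y) : ℚ) : ℝ) := by
        push_cast
        field_simp
        exact hW2
      have hR1 : R₁ = ((p * r : ℚ) : ℝ) := by push_cast; exact hr
      set y : ℚ := (m₂ - p * r * m₁) / (m₁ - r * Y) with hy
      refine ⟨(p * m₁ - y * Y) / X / (p * r - y), ?_⟩
      have hden : (p * r - y : ℝ) ≠ 0 := by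
        have : (p * r - y : ℝ) = R₁ - R₂ := by rw [hR1, hR2]; push_cast; ring
        rwa [this]
      rw [hx, hR1, hR2]
      push_cast
      rw [hR2] at h1
      congr 1
      field_simp
      linarith

end TriangularSystem

theorem mem_integerPoints_of_apply {ξ : Plane} {m n : ℤ} (h0 : ξ 0 = m) (h1 : ξ 1 = n) :
    ξ ∈ integerPoints := by
  refine ⟨![m, n], ?_⟩
  ext i
  fin_cases i
  · simpa using h0.symm
  · simpa using h1.symm

/-! ### Construction of spectra -/

namespace TriangularSystem

variable {p : ℕ} {D : Finset (Fin 2 → ℤ)} {a : Fin 2 → ℤ} {R₁ R₂ c : ℝ}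
  {A B : Plane →L[ℝ] Plane} {μ : Measure Plane} (T : TriangularSystem p D a R₁ R₂ c A B μ)
include T

/-- A spectrum along an integral eigenvector of the expansion. -/
theorem isSpectralMeasure_of_eigenvector {r h l : ℤ} (hr : R₁ = p * r) (hcop : IsCoprime h l)
    (hc : c * l = h * (R₁ - R₂)) (hdet : (p : ℤ) ∣ l * a 1 - h * a 0) : IsSpectralMeasure μ := by
  have hp := T.p_pos
  have hR1 := T.one_lt_left
  have hR0 : R₁ ≠ 0 := by linarith
  set v : Fin 2 → ℤ := ![l, h] with hv
  have hA : A (digitVec v) = R₁ • digitVec v := by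
    ext i
    fin_cases i
    · simp [T.apply_zero, hv]
    · simp [T.apply_one, hv]; linarith
  have hB : B (digitVec v) = R₁⁻¹ • digitVec v := by
    have := congrArg B hA
    rw [T.left_inv, map_smul] at this
    nth_rewrite 2 [this]
    rw [smul_smul, inv_mul_cancel₀ hR0, one_smul]
  have hApow : ∀ k : ℕ, (A ^ k) (digitVec v) = R₁ ^ k • digitVec v := fun k => by
    induction k with
    | zero => simp
    | succ k ih => rw [pow_succ, mul_apply_eq_comp, hA, map_smul, ih, smul_smul, pow_succ, mul_comm]
  have hBpow : ∀ k : ℕ, (B ^ k) (digitVec v) = (R₁ ^ k)⁻¹ • digitVec v := fun k => by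
    induction k with
    | zero => simp
    | succ k ih =>
      rw [pow_succ, mul_apply_eq_comp, hB, map_smul, ih, smul_smul, pow_succ, mul_inv, mul_comm]
  have hint : ∀ n : ℤ, (n : ℝ) • digitVec v ∈ integerPoints := fun n => by
    rw [show (n : ℝ) • digitVec v = digitVec (n • v) by ext i; simp]
    exact digitVec_mem _
  have hr0 : (r : ℝ) ≠ 0 := fun h0 => hR0 (by rw [hr, h0, mul_zero])
  -- All frequencies are multiples of v = (l, h), which A multiplies by R₁. Rounding the coefficient
  -- to the nearest integer keeps it in [−1/2, 1/2].
  refine T.isSpectralMeasure_of_compact (v := v) (K := (fun s : ℝ => s • digitVec v) ''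
    Set.Icc (-(1 / 2)) (1 / 2)) ?_ hdet (fun k => ?_) (isCompact_Icc.image (by fun_prop))
    ⟨0, by norm_num, by simp⟩ ?_ ?_ ?_
  · simp only [hv, Matrix.cons_val_zero]
    intro hl
    have h1 : (p : ℤ) ∣ h * a 0 := by
      have := dvd_sub (hl.mul_right (a 1)) hdet
      rwa [sub_sub_cancel] at this
    exact T.prime_int.not_isUnit (hcop.isUnit_of_dvd'
      ((T.prime_int.dvd_or_dvd h1).resolve_right (T.not_dvd 0)) hl)
  · rw [map_smul, hApow, smul_smul, show (p : ℝ)⁻¹ * R₁ ^ (k + 1) = ((r * (p * r) ^ k : ℤ) : ℝ) by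
      rw [hr]; push_cast; field_simp; ring]
    exact hint _
  · rintro _ ⟨s, hs, rfl⟩
    refine ⟨R₁⁻¹ * s, ?_, by simp only [map_smul, hB, smul_smul]; rw [mul_comm]⟩
    rw [Set.mem_Icc, ← abs_le] at hs ⊢
    rw [abs_mul, abs_of_pos (inv_pos.mpr (by linarith))]
    exact (mul_le_of_le_one_left (abs_nonneg _) (inv_le_one_of_one_le₀ hR1.le)).trans hs
  · rintro _ ⟨s, -, rfl⟩ j -
    set x : ℝ := s * R₁⁻¹ + ((j : ℤ) : ℝ) / p with hx
    refine ⟨((-round x : ℤ) : ℝ) • digitVec v, fun k => ?_, x - round x, ?_, ?_⟩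
    · rw [map_smul, hApow, smul_smul, show ((-round x : ℤ) : ℝ) * R₁ ^ k
        = ((-round x * (p * r) ^ k : ℤ) : ℝ) by rw [hr]; push_cast; ring]
      exact hint _
    · rw [Set.mem_Icc, ← abs_le]
      exact abs_sub_round x
    · simp only [map_smul, hB, smul_smul, ← add_smul]
      congr 1
      rw [hx]
      push_cast
      ring
  · rintro _ ⟨s, hs, rfl⟩ hzero
    rw [T.fourierTransform_eq_zero_iff] at hzero
    obtain ⟨k, n, hn, -, he⟩ := hzero
    rw [map_smul, hBpow, smul_smul, smul_smul] at he
    set x : ℝ := p * s * (R₁ ^ (k + 1))⁻¹ with hx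
    have e0 : x * l = n 0 := by simpa [hv] using congrArg (fun v : Plane => v 0) he
    have e1 : x * h = n 1 := by simpa [hv] using congrArg (fun v : Plane => v 1) he
    -- Since v is primitive, an integral multiple of it has an integer coefficient. A zero on the
    -- segment would thus have s an integer, so s = 0, and its first numerator would be 0.
    obtain ⟨α, β, hαβ⟩ := hcop
    have hxN : x = ((α * n 1 + β * n 0 : ℤ) : ℝ) := by
      have : (α * h + β * l : ℝ) = 1 := by exact_mod_cast hαβ
      push_cast
      rw [← e0, ← e1]
      linear_combination (-x) * this
    set N := α * n 1 + β * n 0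
    have hsN : s = ((N * (r * (p * r) ^ k) : ℤ) : ℝ) := by
      push_cast
      rw [← hxN, hx, hr]
      field_simp
      ring
    have h0 : N * (r * (p * r) ^ k) = 0 := by
      rw [Set.mem_Icc, ← abs_le, hsN, ← Int.cast_abs] at hs
      rw [← Int.abs_lt_one_iff]
      have : ((|N * (r * (p * r) ^ k)| : ℤ) : ℝ) < 1 := by linarith
      exact_mod_cast this
    have hs0 : s = 0 := by rw [hsN, h0, Int.cast_zero]
    rw [hx, hs0, mul_zero, zero_mul, zero_mul] at e0
    exact hn (by rw [Int.cast_eq_zero.mp e0.symm]; exact dvd_zero _)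

/-- Suppose both points are zeros. Their first coordinates agree, so R₁ ∈ pℤ and p ∤ n₀, n'₀ force
equal levels and n₀ = n'₀. Then p divides n'₁ − n₁ while R₂^(k+1) (n'₁ − n₁) = p, which is
impossible for R₂ > 1. -/
theorem fourierTransform_translate_ne_zero {r : ℤ} (hr : R₁ = p * r) {ξ : Plane}
    (h : fourierTransform μ ξ = 0) : fourierTransform μ (ξ + digitVec ![0, 1]) ≠ 0 := by
  intro h'
  have hp := T.p_pos
  have hR1 := T.one_lt_left
  have hR2 := T.one_lt_right
  rw [T.fourierTransform_eq_zero_iff] at h h'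
  obtain ⟨k, n, hn, hdet, hz⟩ := h
  obtain ⟨k', n', hn', hdet', hz'⟩ := h'
  have hBpow : ∀ (k : ℕ) (ζ : Plane), R₁ ^ k * ((B ^ k) ζ) 0 = ζ 0 := fun k ζ => by
    have := (T.pow_apply ((B ^ k) ζ) k).1
    rwa [T.A_pow_B_pow, eq_comm] at this
  have e0 : (p : ℝ) * ((B ^ (k + 1)) ξ) 0 = n 0 := by
    simpa using congrArg (fun v : Plane => v 0) hz
  have e0' : (p : ℝ) * ((B ^ (k' + 1)) (ξ + digitVec ![0, 1])) 0 = n' 0 := by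
    simpa only [PiLp.smul_apply, smul_eq_mul, digitVec_apply] using
      congrArg (fun v : Plane => v 0) hz'
  have f0 : R₁ ^ (k + 1) * n 0 = R₁ ^ (k' + 1) * n' 0 := by
    have h1 := hBpow (k + 1) ξ
    have h2 := hBpow (k' + 1) (ξ + digitVec ![0, 1])
    rw [← e0, ← e0']
    have h3 : (ξ + digitVec ![0, 1]) 0 = ξ 0 := by simp
    rw [h3] at h2
    linear_combination (p : ℝ) * h1 - (p : ℝ) * h2
  have hlt : ∀ (k d : ℕ) (X X' : ℤ), ¬ (p : ℤ) ∣ X →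
      R₁ ^ (k + 1) * X = R₁ ^ (k + 1 + (d + 1)) * X' → False := by
    intro k d X X' hX he
    rw [pow_add _ (k + 1), mul_assoc] at he
    have h1 := mul_left_cancel₀ (pow_ne_zero (k + 1) (by linarith : R₁ ≠ 0)) he
    rw [hr] at h1
    have h2 : X = (p * r) ^ (d + 1) * X' := by exact_mod_cast h1
    exact hX ⟨r * (p * r) ^ d * X', by rw [h2]; ring⟩
  have hkk : k = k' := by
    rcases lt_trichotomy k k' with hlt' | h | hgt
    · obtain ⟨d, rfl⟩ := Nat.exists_eq_add_of_lt hlt'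
      exact (hlt k d _ _ hn (by rw [f0]; ring)).elim
    · exact h
    · obtain ⟨d, rfl⟩ := Nat.exists_eq_add_of_lt hgt
      exact (hlt k' d _ _ hn' (by rw [← f0]; ring)).elim
  subst hkk
  have hn0 : n 0 = n' 0 := by
    exact_mod_cast mul_left_cancel₀ (pow_ne_zero (k + 1) (by linarith : R₁ ≠ 0)) f0
  have e1 : R₂ ^ (k + 1) * (n' 1 - n 1) = p := by
    have h1 := (T.pow_apply ((B ^ (k + 1)) (digitVec ![0, 1])) (k + 1)).2
    have h0 := hBpow (k + 1) (digitVec ![0, 1])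
    rw [T.A_pow_B_pow] at h1
    have h2 : ((B ^ (k + 1)) (digitVec ![0, 1])) 0 = 0 := by
      rw [show (digitVec ![0, 1]) 0 = 0 by simp] at h0
      exact (mul_eq_zero.mp h0).resolve_left (pow_ne_zero _ (by linarith))
    have h3 : (p : ℝ) * ((B ^ (k + 1)) (digitVec ![0, 1])) 1 = n' 1 - n 1 := by
      have a1 : (p : ℝ) * ((B ^ (k + 1)) ξ) 1 = n 1 := by
        simpa using congrArg (fun v : Plane => v 1) hz
      have a2 : (p : ℝ) * ((B ^ (k + 1)) (ξ + digitVec ![0, 1])) 1 = n' 1 := by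
        simpa only [PiLp.smul_apply, smul_eq_mul, digitVec_apply] using
          congrArg (fun v : Plane => v 1) hz'
      rw [map_add, PiLp.add_apply] at a2
      linarith
    rw [h2, mul_zero, zero_add, show (digitVec ![0, 1]) 1 = 1 by simp] at h1
    rw [← h3]
    linear_combination (-p : ℝ) * h1
  obtain ⟨s, hs⟩ : (p : ℤ) ∣ n' 1 - n 1 := by
    have := dvd_sub hdet hdet'
    rw [← hn0, show n 0 * a 1 - n 1 * a 0 - (n 0 * a 1 - n' 1 * a 0) = (n' 1 - n 1) * a 0 by
      ring] at this
    exact (T.prime_int.dvd_or_dvd this).resolve_right (T.not_dvd 0)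
  have h3 : R₂ ^ (k + 1) * s = 1 := by
    have : (n' 1 - n 1 : ℝ) = p * s := by exact_mod_cast hs
    rw [this] at e1
    exact mul_left_cancel₀ hp.ne' (by linarith)
  have h4 : 1 < R₂ ^ (k + 1) := one_lt_pow₀ hR2 (by omega)
  have h5 : 0 < (s : ℝ) := by
    by_contra! h
    nlinarith
  have h6 : (1 : ℝ) ≤ s := by exact_mod_cast (by exact_mod_cast h5 : 0 < s)
  nlinarith

/-- A spectrum for an expansion that is integral along multiples of the residue vector. -/
theorem isSpectralMeasure_of_integral {r r₂ w m : ℤ} (hr : R₁ = p * r) (hr₂ : R₂ = p * r₂)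
    (hw : ¬ (p : ℤ) ∣ w) (hcw : c * w = p * m) : IsSpectralMeasure μ := by
  have hprob := T.prob
  have hp := T.p_pos
  have hR1 := T.one_lt_left
  have hR2 := T.one_lt_right
  have htwo : ∀ {R : ℝ} {r : ℤ}, 1 < R → R = p * r → 2 ≤ R := by
    intro R r h1 h2
    have h3 : (1 : ℤ) < p * r := by exact_mod_cast (h2 ▸ h1)
    rw [h2]
    exact_mod_cast h3
  have hR1' : R₁⁻¹ ≤ 1 / 2 := by
    rw [one_div]; exact inv_anti₀ (by norm_num) (htwo hR1 hr)
  have hR2' : R₂⁻¹ ≤ 1 / 2 := by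
    rw [one_div]; exact inv_anti₀ (by norm_num) (htwo hR2 hr₂)
  have hR1p : 0 < R₁⁻¹ := inv_pos.mpr (by linarith)
  have hR2p : 0 < R₂⁻¹ := inv_pos.mpr (by linarith)
  -- The multiple w of a is used because cw ∈ pℤ makes A^(k+1)(v/p) integral.
  set v : Fin 2 → ℤ := fun i => w * a i with hv
  set e : Plane := digitVec ![0, 1] with he
  -- As R₁, R₂ ≥ 2, this box absorbs Bη + sv for |s| ≤ 1, with room 1 left in the second coordinate
  -- for adding e.
  set x₀ : ℝ := 2 * |(v 0 : ℝ)| with hx₀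
  set y₀ : ℝ := |c| * x₀ + 2 * |(v 1 : ℝ)| + 2 with hy₀
  have hx₀0 : 0 ≤ x₀ := by positivity
  have hy₀0 : 0 ≤ y₀ := by positivity
  let Box : Set Plane := {ξ | |ξ 0| ≤ x₀ ∧ |ξ 1| ≤ y₀}
  have hBox : IsCompact Box := by
    refine Metric.isCompact_of_isClosed_isBounded ?_ ?_
    · exact IsClosed.and (isClosed_le (by fun_prop) continuous_const)
        (isClosed_le (by fun_prop) continuous_const)
    · refine isBounded_iff_forall_norm_le.mpr ⟨x₀ + y₀, fun ξ hξ => ?_⟩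
      rw [EuclideanSpace.norm_eq, Fin.sum_univ_two]
      refine Real.sqrt_le_iff.mpr ⟨by positivity, ?_⟩
      obtain ⟨h1, h2⟩ : |ξ 0| ≤ x₀ ∧ |ξ 1| ≤ y₀ := hξ
      simp only [Real.norm_eq_abs]
      nlinarith [abs_nonneg (ξ 0), abs_nonneg (ξ 1)]
  have hBox0 : (0 : Plane) ∈ Box := ⟨by simpa using hx₀0, by simpa using hy₀0⟩
  have hcont := continuous_fourierTransform μ
  obtain ⟨ζ₀, -, hζ₀⟩ := hBox.exists_isMinOn ⟨0, hBox0⟩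
    (f := fun ξ => max ‖fourierTransform μ ξ‖ ‖fourierTransform μ (ξ + e)‖)
    (Continuous.continuousOn (by fun_prop))
  -- The minimum over the box of the larger of |μ̂(ζ)| and |μ̂(ζ + e)|. It is positive, so one of
  -- the corrections 0 and e always leads to |μ̂| ≥ ε.
  set ε : ℝ := max ‖fourierTransform μ ζ₀‖ ‖fourierTransform μ (ζ₀ + e)‖ with hε
  have hε0 : 0 < ε := by
    rw [hε, lt_max_iff, norm_pos_iff, norm_pos_iff]
    by_cases h : fourierTransform μ ζ₀ = 0
    · exact Or.inr (T.fourierTransform_translate_ne_zero hr h)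
    · exact Or.inl h
  have hε1 : ε ≤ 1 := max_le (norm_fourierTransform_le μ _) (norm_fourierTransform_le μ _)
  have hBbox : ∀ η ∈ Box, ∀ s : ℝ, |s| ≤ 1 → |(B η + s • digitVec v) 0| ≤ x₀ ∧
      |(B η + s • digitVec v) 1| ≤ y₀ - 1 := by
    rintro η ⟨h1, h2⟩ s hs
    have k1 : |s * v 0| ≤ |(v 0 : ℝ)| := by
      rw [abs_mul]; exact mul_le_of_le_one_left (abs_nonneg _) hs
    have k2 : |s * v 1| ≤ |(v 1 : ℝ)| := by
      rw [abs_mul]; exact mul_le_of_le_one_left (abs_nonneg _) hs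
    have k3 : |R₁⁻¹ * η 0| ≤ 1 / 2 * x₀ := by
      rw [abs_mul, abs_of_pos hR1p]
      exact mul_le_mul hR1' h1 (abs_nonneg _) (by norm_num)
    have k4 : |R₂⁻¹ * (η 1 - c * R₁⁻¹ * η 0)| ≤ 1 / 2 * (y₀ + |c| * (1 / 2 * x₀)) := by
      rw [abs_mul, abs_of_pos hR2p]
      refine mul_le_mul hR2' ((abs_sub _ _).trans (add_le_add h2 ?_)) (abs_nonneg _) (by norm_num)
      rw [mul_assoc, abs_mul]
      exact mul_le_mul_of_nonneg_left k3 (abs_nonneg _)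
    simp only [PiLp.add_apply, PiLp.smul_apply, smul_eq_mul, digitVec_apply, T.B_apply_zero,
      T.B_apply_one]
    refine ⟨(abs_add_le _ _).trans ?_, (abs_add_le _ _).trans ?_⟩
    · linarith
    · have : 0 ≤ |c| * x₀ := by positivity
      linarith
  have hint : ∀ k : ℕ, (A ^ k) e ∈ integerPoints := fun k => by
    obtain ⟨h1, h2⟩ := T.pow_apply e k
    have e0 : e 0 = 0 := by simp [he]
    have e1 : e 1 = 1 := by simp [he]
    rw [e0, mul_zero] at h1 h2
    rw [e1] at h2
    exact mem_integerPoints_of_apply (m := 0) (n := (p * r₂) ^ k) (by rw [h1, Int.cast_zero])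
      (by rw [h2, hr₂]; push_cast; ring)
  refine T.isSpectralMeasure_of_compact (v := v) (K := Box ∩ {ξ | ε ≤ ‖fourierTransform μ ξ‖})
    (fun h => (T.prime_int.dvd_or_dvd h).elim hw (T.not_dvd 0))
    ⟨0, by simp only [hv]; ring⟩ (fun k => ?_)
    (hBox.inter_right (isClosed_le continuous_const (by fun_prop)))
    ⟨hBox0, by simpa using hε1⟩ ?_ ?_ ?_
  · obtain ⟨h1, h2⟩ := T.pow_apply (digitVec v) (k + 1)
    set N : ℤ := ∑ i ∈ Finset.range (k + 1), (p * r) ^ i * (p * r₂) ^ (k + 1 - 1 - i) with hN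
    have h3 : ∑ i ∈ Finset.range (k + 1), R₁ ^ i * R₂ ^ (k + 1 - 1 - i) = (N : ℝ) := by
      rw [hN, hr, hr₂]; push_cast; rfl
    rw [h3] at h2
    rw [digitVec_apply] at h1 h2
    rw [digitVec_apply] at h2
    rw [map_smul]
    refine mem_integerPoints_of_apply (m := r * (p * r) ^ k * v 0)
      (n := m * N * a 0 + r₂ * (p * r₂) ^ k * v 1) ?_ ?_
    · rw [PiLp.smul_apply, smul_eq_mul, h1, inv_mul_eq_iff_eq_mul₀ hp.ne', hr]
      push_cast
      ring
    · rw [PiLp.smul_apply, smul_eq_mul, h2, inv_mul_eq_iff_eq_mul₀ hp.ne', hr₂]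
      simp only [hv]
      push_cast
      linear_combination ((N : ℝ) * a 0) * hcw
  · rintro η ⟨hη, hη'⟩
    have h1 := hBbox η hη 0 (by norm_num)
    rw [zero_smul, add_zero] at h1
    refine ⟨⟨h1.1, by linarith [h1.2]⟩, Set.mem_ofPred_eq ▸ le_trans (Set.mem_ofPred.mp hη') ?_⟩
    rw [T.refine η, norm_mul]
    exact mul_le_of_le_one_left (norm_nonneg _) (T.norm_mask_le _)
  · rintro η ⟨hη, -⟩ j hj
    have hjp : |((j : ℤ) : ℝ) / p| ≤ 1 := by
      rw [Int.cast_natCast, abs_of_nonneg (by positivity), div_le_one hp]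
      exact_mod_cast hj.le
    obtain ⟨h1, h2⟩ := hBbox η hη _ hjp
    set ζ := B η + (((j : ℤ) : ℝ) / p) • digitVec v with hζ
    have hmin : ε ≤ max ‖fourierTransform μ ζ‖ ‖fourierTransform μ (ζ + e)‖ :=
      hζ₀ ⟨h1, by linarith⟩
    rcases le_max_iff.mp hmin with h | h
    · exact ⟨0, fun k => by rw [map_zero]; exact zero_mem _, by
        rw [add_zero]; exact ⟨⟨h1, by linarith⟩, h⟩⟩
    · refine ⟨e, hint, ⟨?_, ?_⟩, h⟩
      · simpa [he] using h1
      · have : (ζ + e) 1 = ζ 1 + 1 := by simp [he]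
        rw [this]
        refine (abs_add_le _ _).trans ?_
        rw [abs_one]
        linarith
  · rintro η ⟨-, hη⟩ h0
    simp only [Set.mem_ofPred_eq, h0, norm_zero] at hη
    linarith

end TriangularSystem

/-! ### The three sufficient cases -/

namespace TriangularSystem

variable {p : ℕ} {D : Finset (Fin 2 → ℤ)} {a : Fin 2 → ℤ} {R₁ R₂ c : ℝ}
  {A B : Plane →L[ℝ] Plane} {μ : Measure Plane} (T : TriangularSystem p D a R₁ R₂ c A B μ)
include T

/-- Outside E_a the reduced fraction h/l satisfies p ∣ l a₁ − h a₀, so the eigenvector (l, h) is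
proportional to a modulo p and can carry the digits. -/
theorem isSpectralMeasure_of_not_mem_exceptionalSet (hR : R₁ ≠ R₂) (h₁ : IsIntMultiple p R₁)
    (hc : c / (R₁ - R₂) ∈ Set.range ((↑) : ℚ → ℝ) \ exceptionalSet p a) :
    IsSpectralMeasure μ := by
  obtain ⟨r, hr⟩ := h₁
  obtain ⟨⟨x, hx⟩, hE⟩ := hc
  have hκ : R₁ - R₂ ≠ 0 := sub_ne_zero.mpr hR
  have hd : ((x.den : ℤ) : ℝ) ≠ 0 := by exact_mod_cast x.den_nz
  have hxq : (x : ℝ) = (x.num : ℝ) / ((x.den : ℤ) : ℝ) := by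
    exact_mod_cast (Rat.num_div_den x).symm
  have hcop : IsCoprime x.num (x.den : ℤ) := Int.isCoprime_iff_gcd_eq_one.mpr x.reduced
  rw [← hx] at hE
  refine T.isSpectralMeasure_of_eigenvector hr hcop ?_ ?_
  · rw [hxq] at hx
    field_simp at hx
    linarith
  · by_contra hnd
    exact hE (Or.inl ⟨x.num, x.den, by exact_mod_cast x.den_nz, hcop, hnd, hxq⟩)

/-- From c = s(R₁ − R₂)/t, the power p^ℓ in t cancels against p^(ℓ+1) in R₁ − R₂, leaving cw ∈ pℤ
with p ∤ w. -/
theorem isSpectralMeasure_of_dvd_sub (hR : R₁ ≠ R₂) (h₁ : IsIntMultiple p R₁)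
    (h₂ : IsIntMultiple p R₂) {ℓ : ℕ} {s t w : ℤ} (ht : t ≠ 0)
    (hc : c / (R₁ - R₂) = (s : ℝ) / (t : ℝ)) (hw : ¬ (p : ℤ) ∣ w) (htw : t = (p : ℤ) ^ ℓ * w)
    (hsub : IsIntMultiple (p ^ (ℓ + 1)) (R₁ - R₂)) : IsSpectralMeasure μ := by
  obtain ⟨r, hr⟩ := h₁
  obtain ⟨r₂, hr₂⟩ := h₂
  obtain ⟨k, hk⟩ := hsub
  have hp := T.p_pos
  have hκ : R₁ - R₂ ≠ 0 := sub_ne_zero.mpr hR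
  have htR : (t : ℝ) ≠ 0 := by exact_mod_cast ht
  have htw' : (t : ℝ) = (p : ℝ) ^ ℓ * w := by exact_mod_cast htw
  refine T.isSpectralMeasure_of_integral hr hr₂ hw (m := s * k) ?_
  rw [div_eq_div_iff hκ htR, htw', hk] at hc
  refine mul_left_cancel₀ (pow_ne_zero ℓ hp.ne') ?_
  push_cast at hc ⊢
  rw [pow_succ] at hc
  linarith

theorem isSpectralMeasure_of_eq (hR : R₁ = R₂) (h₁ : IsIntMultiple p R₁)
    (hc : (∃ s t : ℤ, s ≠ 0 ∧ (p : ℤ) ∣ t ∧ IsCoprime t s ∧ c = (t : ℝ) / (s : ℝ)) ∨ c = 0) :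
    IsSpectralMeasure μ := by
  obtain ⟨r, hr⟩ := h₁
  rcases hc with ⟨s, t, hs, ⟨m, hm⟩, hcop, hc⟩ | hc
  · have hsR : (s : ℝ) ≠ 0 := by exact_mod_cast hs
    refine T.isSpectralMeasure_of_integral hr (hR ▸ hr) (w := s) (m := m) (fun h => ?_) ?_
    · exact T.prime_int.not_isUnit (hcop.isUnit_of_dvd' ⟨m, hm⟩ h)
    · rw [hc, hm]
      push_cast
      field_simp
  · exact T.isSpectralMeasure_of_integral hr (hR ▸ hr) (w := 1) (m := 0)
      (fun h => T.prime_int.not_isUnit (isUnit_of_dvd_one h)) (by simp [hc])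

end TriangularSystem

end SierpinskiSpectral

/-! ### The classification -/

theorem theorem1p6 (p : ℕ) (hp : p.Prime)
    (ρ₁ ρ₂ c : ℝ) (hρ₁ : 0 < ρ₁) (hρ₁' : ρ₁ < 1) (hρ₂ : 0 < ρ₂) (hρ₂' : ρ₂ < 1)
    (D : Finset (Fin 2 → ℤ)) (hcard : D.card = p) (h0 : ![0, 0] ∈ D)
    (d₁₁ : ℤ) (hd₁₁ : d₁₁ ≠ 0) (h1 : ![d₁₁, 0] ∈ D)
    (a : Fin 2 → ℤ) (ha : ∀ i, 1 ≤ a i ∧ a i ≤ (p : ℤ) - 1)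
    (hzero : SierpinskiSpectral.fourierZeros (SierpinskiSpectral.discreteMeasure D)
      = SierpinskiSpectral.latticeTranslates p a) :
    SierpinskiSpectral.IsSpectralMeasure
        (SierpinskiSpectral.selfAffineMeasure (SierpinskiSpectral.triMatrix ρ₁ ρ₂ c) D) ↔
      ((ρ₁ ≠ ρ₂ ∧ SierpinskiSpectral.IsIntMultiple p ρ₁⁻¹ ∧
          c / (ρ₁⁻¹ - ρ₂⁻¹) ∈
            Set.range ((↑) : ℚ → ℝ) \ SierpinskiSpectral.exceptionalSet p a) ∨
        (ρ₁ ≠ ρ₂ ∧ SierpinskiSpectral.IsIntMultiple p ρ₁⁻¹ ∧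
          SierpinskiSpectral.IsIntMultiple p ρ₂⁻¹ ∧
          c / (ρ₁⁻¹ - ρ₂⁻¹) ∈ SierpinskiSpectral.exceptionalSet p a ∧
          ∃ (ℓ : ℕ) (s t : ℤ), t ≠ 0 ∧ IsCoprime s t ∧
            c / (ρ₁⁻¹ - ρ₂⁻¹) = (s : ℝ) / (t : ℝ) ∧
            (∃ u : ℤ, ¬ (p : ℤ) ∣ u ∧ t = (p : ℤ) ^ ℓ * u) ∧
            SierpinskiSpectral.IsIntMultiple (p ^ (ℓ + 1)) (ρ₁⁻¹ - ρ₂⁻¹)) ∨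
        (ρ₁ = ρ₂ ∧ SierpinskiSpectral.IsIntMultiple p ρ₁⁻¹ ∧
          ((∃ s t : ℤ, s ≠ 0 ∧ (p : ℤ) ∣ t ∧ IsCoprime t s ∧ c = (t : ℝ) / (s : ℝ)) ∨
            c = 0))) := by
  have hzero_vec : (![0, 0] : Fin 2 → ℤ) = 0 := by
    ext i
    fin_cases i <;> rfl
  have T := SierpinskiSpectral.triangularSystem_selfAffineMeasure (p := p) (D := D) (a := a)
    ⟨hp, hcard, hzero_vec ▸ h0, ⟨![d₁₁, 0], h1, hd₁₁, rfl⟩, ha, hzero⟩ c hρ₁ hρ₁' hρ₂ hρ₂'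
  constructor
  · intro h
    rcases eq_or_ne ρ₁ ρ₂ with he | he
    · exact Or.inr (Or.inr ⟨he, T.necessary_of_eq h (by rw [he])⟩)
    · rcases T.necessary_of_ne h (inv_injective.ne he) with h | h
      · exact Or.inl ⟨he, h⟩
      · exact Or.inr (Or.inl ⟨he, h⟩)
  · rintro (⟨he, h₁, hc⟩ | ⟨he, h₁, h₂, -, ℓ, s, t, ht, -, hc, ⟨w, hw, htw⟩, hsub⟩ | ⟨he, h₁, hc⟩)
    · exact T.isSpectralMeasure_of_not_mem_exceptionalSet (inv_injective.ne he) h₁ hc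
    · exact T.isSpectralMeasure_of_dvd_sub (inv_injective.ne he) h₁ h₂ ht hc hw htw hsub
    · exact T.isSpectralMeasure_of_eq (by rw [he]) h₁ hc
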